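/- **Setting.** Let $m\ge 1$ machines observe independent sequences $X_{i,jk}=\theta_{jk}+\sigma z_{i,jk}$ with $z_{i,jk}$ i.i.d. $N(0,1)$, $1\le i\le m$, $j\ge 0$, $1\le k\le 2^j$. Machine $i$ sends a bit string $Z_i=Z_i(X_i)$ (uniquely decodable; or the empty string if the machine is silent); the estimator is a function of $Z_1,\dots,Z_m$ and its cost $L$ is the total length of the $Z_i$. Let $\mathcal A_E(B,\Theta)$ be the set of such protocols with $\sup_{\theta\in\Theta}\mathbb E_\theta L\le B$. For $0<p,q\le\infty$ with $s=\alpha+\frac12-\frac1p>0$ let $$\mathcal B^\alpha_{p,q}(M)=\Big\{\theta:\Big(\sum_{j\ge0}\big(2^{js}(\textstyle\sum_{k}|\theta_{jk}|^p)^{1/p}\big)^q\Big)^{1/q}\le M\Big\}$$ (suprema if $p$ or $q$ is $\infty$). Write $\log$ for $\log_2$. **Code.** $g:\mathbb Z\to\bigcup_{k\ge1}\{0,1\}^k$ is given by $g(0)=0$; for $x>0$ with $k$-digit binary representation $b$, $g(x)=1\,0^k\,b$; for $x<0$, with $b$ the $k$-digit binary representation of $|x|$, $g(x)=11\,0^{k-1}\,b$.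 **The seq-MODGAME estimator $\hat\theta^O$** with budget $B>0$ and tuning constant $\Lambda_0$. *Case 1: $B<(\Lambda_0M/\sigma)^{2/(2\alpha+1)}$.* Put $\delta=\Lambda_0MB^{-(\alpha+1/2)}$ and $j_{\max}=\max\{j\ge0:M2^{-j(\alpha+1/2)}\ge\delta\}$ (if there is no such $j$, no level is estimated). Only machine 1 transmits, namely the strings $g(\lfloor X_{1,jk}/\delta\rfloor)$ for $j\le j_{\max}$, and $\hat\theta^O_{jk}=\lfloor X_{1,jk}/\delta\rfloor\,\delta$ for $j\le j_{\max}$, $\hat\theta^O_{jk}=0$ otherwise. *Case 2: $B\ge(\Lambda_0M/\sigma)^{2/(2\alpha+1)}$.* Put $u=\big((\Lambda_0M/\sigma)^{-1/(\alpha+1)}B^{(2\alpha+1)/(2\alpha+2)}\big)\wedge m$, $\delta=\sigma/\sqrt u$, $j_{\max}$ as before, and $\ell=\max(1,\lfloor\log u\rfloor)$. Machines $i>u$ are silent. For every $j\le j_{\max}$ and $k$, machine 1 sends $g(\lfloor X_{1,jk}/\sigma\rfloor)$; the finer localization machines $2\le i\le 1+\lfloor\log^2u\rfloor$, $i\le u$,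 send $g(\lfloor X_{i,jk}/\sigma\rfloor\bmod \ell)$; the refinement machines $2+\lfloor\log^2u\rfloor\le i\le u$ send $g(\lfloor X_{i,jk}/\sigma\rfloor\bmod 8)$. From these strings the central machine decodes the integers. For each $(j,k)$ with $j\le j_{\max}$ let $z$ be a mode in $\{0,\dots,\ell-1\}$ of the residues sent by the finer localization machines (ties, and the case where there are no such machines, are decided by an arbitrary fixed rule); let $x$ be the unique integer in $[a,a+\ell)$, $a=\lfloor X_{1,jk}/\sigma\rfloor-\lfloor\ell/2\rfloor$, with $x\equiv z \pmod \ell$; let $p^h$ be the proportion of refinement machines whose residue equals $(x-2)\bmod 8$ ($p^h=0$ if there are none); and let $h(y)=\sum_{l\in\mathbb Z}\int_{x-2+8l}^{x-1+8l}\frac1{\sqrt{2\pi}}e^{-(w-y)^2/2}\,dw$, which is strictly decreasing on $[x-1,x+2]$. Then $\hat\theta^O_{jk}/\sigma$ is $x+2$ if $p^h\le h(x+2)$, is $x-1$ if $p^h\ge h(x-1)$, and is otherwise the point $y\in[x-1,x+2]$ with $h(y)=p^h$. For $j>j_{\max}$, $\hat\theta^O_{jk}=0$. **Theorem 1.** Let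 $\alpha>0$ and $\Lambda_0>(24\alpha+64)^{\alpha+1/2}$. Then for all $m\ge1$, $\sigma,M,B>0$ and all $0<p,q\le\infty$ with $s>0$, $\hat\theta^O\in\mathcal A_E(B,\mathcal B^\alpha_{p,q}(M))$. Moreover there is a constant $C>0$ depending only on $\alpha$ and $\Lambda_0$ such that for all $m\ge1$, $\sigma,M,B>0$, $2\le p\le\infty$ and $0<q\le\infty$, $$\sup_{\theta\in\mathcal B^\alpha_{p,q}(M)}\mathbb E\|\hat\theta^O-\theta\|_2^2\le C\cdot\begin{cases}M^2B^{-2\alpha}&\text{if }B<(M/\sigma)^{\frac2{2\alpha+1}},\\ M^{\frac2{\alpha+1}}\big(\sigma^2/B\big)^{\frac\alpha{\alpha+1}}&\text{if }(M/\sigma)^{\frac2{2\alpha+1}}\le B<(M/\sigma)^{\frac2{2\alpha+1}}m^{\frac{2\alpha+2}{2\alpha+1}},\\ M^{\frac2{2\alpha+1}}\big(\sigma^2/m\big)^{\frac{2\alpha}{2\alpha+1}}&\text{if }B\ge(M/\sigma)^{\frac2{2\alpha+1}}m^{\frac{2\alpha+2}{2\alpha+1}}.\end{cases}$$ -/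

import Mathlib

open MeasureTheory ProbabilityTheory
open scoped ENNReal

namespace SeqModgame

noncomputable section

/-! ### Sequences, Besov balls and the Gaussian sequence model -/

/-- Positions `(j, k)`: resolution level `j = 0, 1, 2, …` and one of the `2 ^ j` coefficients
of that level. -/
abbrev Idx : Type := Σ j : ℕ, Fin (2 ^ j)

/-- Coefficient sequences `(θ_{jk})`. -/
abbrev Seq : Type := Idx → ℝ

/-- The `ℓ_r` (quasi-)norm, `0 < r ≤ ∞`, of a family of extended nonnegative numbers. -/
def ellNorm {ι : Type*} (r : ℝ≥0∞) (a : ι → ℝ≥0∞) : ℝ≥0∞ :=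
  if r = ∞ then ⨆ i, a i else (∑' i, a i ^ r.toReal) ^ (1 / r.toReal)

/-- The index `s = α + 1/2 - 1/p`  (with `1/∞ = 0`). -/
def besovIndex (α : ℝ) (p : ℝ≥0∞) : ℝ := α + 1 / 2 - 1 / p.toReal

/-- The Besov sequence norm: the `ℓ_q` norm over `j` of `2 ^ (j s)` times the `ℓ_p` norm of the
`j`-th level. -/
def besovNorm (α : ℝ) (p q : ℝ≥0∞) (θ : Seq) : ℝ≥0∞ :=
  ellNorm q fun j : ℕ =>
    ENNReal.ofReal ((2 : ℝ) ^ ((j : ℝ) * besovIndex α p)) *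
      ellNorm p fun k : Fin (2 ^ j) => ENNReal.ofReal |θ ⟨j, k⟩|

/-- The Besov ball of radius `M`. -/
def besovBall (α : ℝ) (p q : ℝ≥0∞) (M : ℝ) : Set Seq :=
  {θ | besovNorm α p q θ ≤ ENNReal.ofReal M}

/-- The joint law of the data `(X_1, …, X_m)`: all `X_{i,jk}` are independent, and `X_{i,jk}` has
the normal distribution with mean `θ_{jk}` and variance `σ ^ 2`. -/
def dataLaw (m : ℕ) (σ : ℝ) (θ : Seq) : Measure (Fin m → Seq) :=
  Measure.pi fun _ : Fin m =>
    Measure.infinitePi fun a : Idx => gaussianReal (θ a) (σ ^ 2).toNNReal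

/-! ### Distributed protocols -/

/-- An independent distributed protocol with `m` local machines: machine `i` sends a bit string
that is a measurable function of its own observation `X_i` only, and the central machine computes
an estimate from the `m` strings. The empty string means that the machine sends nothing. -/
structure Protocol (m : ℕ) where
  /-- the transcript `Z_i` as a function of `X_i` -/
  enc : Fin m → Seq → List Bool
  measurable_enc : ∀ i, Measurable[MeasurableSpace.pi, ⊤] (enc i)
  /-- the estimator as a function of the transcripts -/
  dec : (Fin m → List Bool) → Seq

namespace Protocol

variable {m : ℕ}

/-- The estimate computed from the data. -/
def estimate (P : Protocol m) (X : Fin m → Seq) : Seq := P.dec fun i => P.enc i (X i)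

/-- The total communication cost, in bits. -/
def cost (P : Protocol m) (X : Fin m → Seq) : ℕ := ∑ i, (P.enc i (X i)).length

/-- The expected total communication cost under `θ`. -/
def expectedCost (P : Protocol m) (σ : ℝ) (θ : Seq) : ℝ≥0∞ :=
  ∫⁻ X, (P.cost X : ℝ≥0∞) ∂(dataLaw m σ θ)

/-- The mean squared error under `θ`. -/
def mse (P : Protocol m) (σ : ℝ) (θ : Seq) : ℝ≥0∞ :=
  ∫⁻ X, ∑' a : Idx, ENNReal.ofReal ((P.estimate X a - θ a) ^ 2) ∂(dataLaw m σ θ)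

end Protocol

/-- Protocols with expected total communication budget `B` over `Θ`: every machine that is not
silent uses a uniquely decodable set of strings, and the expected total cost is at most `B`
for all parameters in `Θ`. -/
def budgetClass (m : ℕ) (σ B : ℝ) (Θ : Set Seq) : Set (Protocol m) :=
  {P | (∀ i, (∀ x, P.enc i x = []) ∨ InformationTheory.UniquelyDecodable (Set.range (P.enc i))) ∧
    ⨆ θ ∈ Θ, P.expectedCost σ θ ≤ ENNReal.ofReal B}

/-! ### The localization code and its blockwise extension -/

/-- Binary representation, most significant bit first. -/
def binRep (n : ℕ) : List Bool := n.bits.reverse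

/-- The localization encoding function `g : ℤ → ⋃ {0,1} ^ k`. -/
def locCode (x : ℤ) : List Bool :=
  if x = 0 then [false]
  else if 0 < x then
    true :: (List.replicate (binRep x.natAbs).length false ++ binRep x.natAbs)
  else
    true :: true :: (List.replicate ((binRep x.natAbs).length - 1) false ++ binRep x.natAbs)

/-- The positions of the first `N` levels, listed level by level. -/
def coeffList (N : ℕ) : List Idx :=
  (List.range N).flatMap fun j => (List.finRange (2 ^ j)).map fun k => ⟨j, k⟩

/-- The concatenation of the strings `g (v_{jk})` over the first `N` levels. -/
def encodeBlock (N : ℕ) (v : Idx → ℤ) : List Bool :=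
  (coeffList N).flatMap fun a => locCode (v a)

/-- Decoding of a transcript: some integers `v_{jk}` whose strings concatenate to `w`. Since `g` is
a prefix code, those on the first `N` levels are determined by `w`. -/
def decodeBlock (N : ℕ) (w : List Bool) : Idx → ℤ := Function.invFun (encodeBlock N) w

theorem measurable_encodeBlock (N : ℕ) {f : ℝ → ℤ} (hf : Measurable f) :
    Measurable[MeasurableSpace.pi, ⊤] fun X : Seq => encodeBlock N fun a => f (X a) := by
  unfold encodeBlock
  induction coeffList N with
  | nil =>
    simp only [List.flatMap_nil]
    exact @measurable_const _ _ ⊤ _ _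
  | cons a l ih =>
    simp only [List.flatMap_cons]
    let _ : MeasurableSpace (List Bool) := ⊤
    have h1 : Measurable fun X : Seq => locCode (f (X a)) :=
      (measurable_of_countable locCode).comp (hf.comp (measurable_pi_apply a))
    have h2 : Measurable fun z : List Bool × List Bool => z.1 ++ z.2 := measurable_of_countable _
    exact h2.comp (h1.prodMk ih)

/-! ### The estimator: few bits -/

/-- The number `j_max + 1` of estimated levels, `j_max` being the largest `j` such that
`M 2 ^ (-j (α + 1/2)) ≥ δ`; it is `0` if there is no such `j`. The levels `j ≤ j_max` are thus
those with `j < numLevels`. -/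
def numLevels (α M δ : ℝ) : ℕ :=
  sSup ((fun j : ℕ => j + 1) '' {j : ℕ | δ ≤ M * (2 : ℝ) ^ (-((j : ℝ) * (α + 1 / 2)))})

/-- The protocol in which only the first machine sends `g ⌊X_{jk} / δ⌋` for the first `N` levels,
and these coefficients are estimated by `⌊X_{jk} / δ⌋ δ`. -/
def crudeProtocol (m : ℕ) [NeZero m] (δ : ℝ) (N : ℕ) : Protocol m where
  enc i X := if i = 0 then encodeBlock N fun a => ⌊X a / δ⌋ else []
  measurable_enc i := by
    by_cases h : i = 0
    · simp only [h, if_true]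
      exact measurable_encodeBlock N (f := fun x => ⌊x / δ⌋)
        (Int.measurable_floor.comp (measurable_id.div_const δ))
    · simp only [h, if_false]
      exact @measurable_const _ _ ⊤ _ _
  dec Z a := if a.1 < N then (decodeBlock N (Z 0) a : ℝ) * δ else 0

/-! ### The estimator: many bits -/

/-- The number, counted from 1, of a machine. -/
def machineNo {m : ℕ} (i : Fin m) : ℕ := i.val + 1

/-- The modulus `⌊log₂ u⌋` of the finer localization strings (at least `1`). -/
def modulus (u : ℝ) : ℕ := max 1 ⌊Real.logb 2 u⌋₊

/-- `⌊(log₂ u) ^ 2⌋`. -/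
def finerCount (u : ℝ) : ℕ := ⌊(Real.logb 2 u) ^ 2⌋₊

/-- The machines `2 ≤ i ≤ 1 + ⌊(log₂ u) ^ 2⌋` (with `i ≤ u`). -/
def finerMachines (m : ℕ) (u : ℝ) : Finset (Fin m) :=
  Finset.univ.filter fun i =>
    2 ≤ machineNo i ∧ machineNo i ≤ 1 + finerCount u ∧ (machineNo i : ℝ) ≤ u

/-- The machines `2 + ⌊(log₂ u) ^ 2⌋ ≤ i ≤ u`. -/
def refinementMachines (m : ℕ) (u : ℝ) : Finset (Fin m) :=
  Finset.univ.filter fun i => 2 + finerCount u ≤ machineNo i ∧ (machineNo i : ℝ) ≤ u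

/-- A rule that picks an element of every nonempty finite set of integers. -/
def IsTieBreak (sel : Finset ℤ → ℤ) : Prop := ∀ S : Finset ℤ, S.Nonempty → sel S ∈ S

/-- The mode, among the residues `0, …, L - 1`, of the values `v i`, `i ∈ S`; ties are
broken by `sel`. -/
def modeStat {ι : Type*} (sel : Finset ℤ → ℤ) (L : ℕ) (S : Finset ι) (v : ι → ℤ) : ℤ :=
  sel ((Finset.Ico (0 : ℤ) L).filter fun z =>
    ∀ z' ∈ Finset.Ico (0 : ℤ) L,
      (S.filter fun i => v i = z').card ≤ (S.filter fun i => v i = z).card)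

/-- Left end of the half-open interval of length `L` around `x`: it is
`x - (L - 1) / 2` if `L` is odd and `x - L / 2` if `L` is even. -/
def leftEnd (x : ℤ) (L : ℕ) : ℤ := x - ((L / 2 : ℕ) : ℤ)

/-- The integer in `[leftEnd x L, leftEnd x L + L)` that is congruent to `z` modulo `L`. -/
def fineCenter (x : ℤ) (L : ℕ) (z : ℤ) : ℤ := leftEnd x L + (z - leftEnd x L) % (L : ℤ)

/-- `fineCenter` is the unique integer of the interval with the given residue. -/
theorem eq_fineCenter_iff (x : ℤ) (L : ℕ) (z y : ℤ) (hz : 0 ≤ z) (hzL : z < L) :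
    y = fineCenter x L z ↔ (leftEnd x L ≤ y ∧ y < leftEnd x L + L) ∧ y % (L : ℤ) = z := by
  have hL : (0 : ℤ) < L := by lia
  unfold fineCenter
  generalize leftEnd x L = a
  have h0 := Int.emod_nonneg (z - a) hL.ne'
  have h1 := Int.emod_lt_of_pos (z - a) hL
  constructor
  · rintro rfl
    refine ⟨⟨by lia, by lia⟩, ?_⟩
    rw [Int.add_emod_emod, add_sub_cancel, Int.emod_eq_of_lt hz hzL]
  · rintro ⟨⟨h2, h3⟩, rfl⟩
    rw [Int.emod_sub_emod, Int.emod_eq_of_lt (by lia) (by lia)]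
    lia

/-- `h(y) = ∑_{l ∈ ℤ} ∫_{x - 2 + 8 l}^{x - 1 + 8 l} φ(w - y) dw`, `φ` the standard normal density. -/
def refineFn (x : ℤ) (y : ℝ) : ℝ :=
  ∑' l : ℤ, ∫ w in ((x : ℝ) - 2 + 8 * (l : ℝ))..((x : ℝ) - 1 + 8 * (l : ℝ)),
    gaussianPDFReal 0 1 (w - y)

/-- The point of the interval `[x - 1, x + 2]` at which the decreasing function `h` takes the
value `r`, or the nearest end of the interval if there is none. -/
def refinePoint (x : ℤ) (r : ℝ) : ℝ :=
  if r ≤ refineFn x (x + 2) then x + 2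
  else if refineFn x (x - 1) ≤ r then x - 1
  else Function.invFunOn (refineFn x) (Set.Icc ((x : ℝ) - 1) (x + 2)) r

/-- The estimate of one coefficient divided by `σ`, computed from the integers `v i` which the
machines have sent for this coefficient. -/
def refineEstimate (m : ℕ) [NeZero m] (sel : Finset ℤ → ℤ) (u : ℝ) (v : Fin m → ℤ) : ℝ :=
  let L := modulus u
  let x : ℤ := fineCenter (v 0) L (modeStat sel L (finerMachines m u) v)
  let R := refinementMachines m u
  refinePoint x (((R.filter fun i => v i = (x - 2) % 8).card : ℝ) / (R.card : ℝ))

/-- The integer that machine `i` sends for a coefficient with rescaled observation `x = X / σ`,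
or `none` if it sends nothing. -/
def machineSymbol (m : ℕ) [NeZero m] (u : ℝ) (i : Fin m) : Option (ℝ → ℤ) :=
  if i = 0 then some fun x => ⌊x⌋
  else if i ∈ finerMachines m u then some fun x => ⌊x⌋ % (modulus u : ℤ)
  else if i ∈ refinementMachines m u then some fun x => ⌊x⌋ % 8
  else none

/-- The protocol with crude localization (machine 1), finer localization and refinement strings
for the first `N` levels. -/
def refinedProtocol (m : ℕ) [NeZero m] (sel : Finset ℤ → ℤ) (σ u : ℝ) (N : ℕ) : Protocol m where
  enc i X := match machineSymbol m u i with
    | some f => encodeBlock N fun a => f (X a / σ)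
    | none => []
  measurable_enc i := by
    have key : ∀ f : ℝ → ℤ, machineSymbol m u i = some f → Measurable f := by
      intro f hf
      unfold machineSymbol at hf
      split_ifs at hf <;> simp only [Option.some.injEq] at hf <;> subst hf
      · exact Int.measurable_floor
      · exact (measurable_of_countable fun n : ℤ => n % (modulus u : ℤ)).comp Int.measurable_floor
      · exact (measurable_of_countable fun n : ℤ => n % 8).comp Int.measurable_floor
    cases h : machineSymbol m u i with
    | some f =>
      exact measurable_encodeBlock N (f := fun x => f (x / σ))
        ((key f h).comp (measurable_id.div_const σ))
    | none => exact @measurable_const _ _ ⊤ _ _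
  dec Z a :=
    if a.1 < N then refineEstimate m sel u (fun i => decodeBlock N (Z i) a) * σ else 0

/-- `u = ((Λ₀ M / σ) ^ (-1 / (α + 1)) B ^ ((2 α + 1) / (2 α + 2))) ∧ m`. -/
def effectiveMachines (m : ℕ) (α M σ B Λ₀ : ℝ) : ℝ :=
  min ((Λ₀ * M / σ) ^ (-1 / (α + 1)) * B ^ ((2 * α + 1) / (2 * α + 2))) (m : ℝ)

/-- The seq-MODGAME protocol with budget `B` and tuning constant `Λ₀`. -/
def seqModgame (m : ℕ) [NeZero m] (sel : Finset ℤ → ℤ) (α M σ B Λ₀ : ℝ) : Protocol m :=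
  if B < (Λ₀ * M / σ) ^ (2 / (2 * α + 1)) then
    let δ := Λ₀ * M * B ^ (-(α + 1 / 2))
    crudeProtocol m δ (numLevels α M δ)
  else
    let u := effectiveMachines m α M σ B Λ₀
    let δ := σ / Real.sqrt u
    refinedProtocol m sel σ u (numLevels α M δ)

/-- The three-phase rate of convergence. -/
def threePhaseRate (m : ℕ) (α M σ B : ℝ) : ℝ :=
  if B < (M / σ) ^ (2 / (2 * α + 1)) then
    M ^ 2 * B ^ (-2 * α)
  else if B < (M / σ) ^ (2 / (2 * α + 1)) * (m : ℝ) ^ ((2 * α + 2) / (2 * α + 1)) then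
    M ^ (2 / (α + 1)) * (σ ^ 2 / B) ^ (α / (α + 1))
  else
    M ^ (2 / (2 * α + 1)) * (σ ^ 2 / (m : ℝ)) ^ (2 * α / (2 * α + 1))

end

end SeqModgame

/-!
Both claims are controlled by the single quantity `T = (M / δ) ^ (1 / (α + 1/2))`: the estimated
levels are exactly those with `2 ^ j ≤ T` (`lt_numLevels_iff`), so that at most `2 T` coefficients
are estimated.

*Communication.* The string for `⌊y⌋` has at most `3 + 2 log₂ (1 + |y|)` bits. A coefficient of
level `j` in the Besov ball is, in the mean of order `p`, at most `M 2 ^ (-j (α + 1/2))`, and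
because `1 / p < α + 1/2` the average of the logarithms over the level is bounded independently of
`p` (`sum_logb_one_add_div_le`). Summing the geometric series over the levels, the strings of
machine `1` cost at most `(12 α + 22) T` bits on average. The other machines send residues; as
`(log₂ u) ^ 2` machines with `O(log log u)` bits each are dominated by `u` machines, they cost at
most `42 u T`. The choice of `u` and `Λ₀` gives `u T ≤ B / (24 α + 64)`. Since the localization code
is a prefix code, concatenations of its strings are uniquely decodable, and the central machine
recovers all integers (`decodeBlock_encodeBlock`).

*Risk.* For `p ≥ 2` the levels that are not estimated contribute `O(M ^ 2 T ^ (-2 α))`, and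
`T δ ^ 2 = M ^ 2 T ^ (-2 α)`; so it suffices that each estimated coefficient has risk `O(δ ^ 2)`
(`mse_le_of_coeff`). This is immediate for the crude protocol. For the refined protocol, in units of
`σ`, the claim is a bound `C / u` uniform in the mean `t` (`exists_coeff_risk_constant`):

* Every interval of length one that contains `t` has probability larger than `1 / 3`, so the cell
  `[⌊t⌋, ⌊t⌋ + 1)` is more likely than all observations at distance at least one from `t` together
  (`measureReal_one_le_abs_le`). By a Chernoff bound the mode of the finer
  localization residues therefore comes from a cell near `t`, up to an event whose probability is
  exponentially small in `(log₂ u) ^ 2` (`noiseLaw_misled_le`). The observation of machine `1`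
  selects the right cell unless it is off by about `log₂ u / 2`, which is also rare enough.
* For such a cell `x`, the function `h = refineFn x` is the probability of the residue of `x - 2`,
  and decreases at least linearly on `[x - 1, x + 2]` (`refineFn_sub_ge`), so that inverting it at
  the observed frequency is as precise as the frequency itself. The cell `x` depends on the data, but
  only four cells are possible, and summing the variances of their frequencies is enough.

Beyond its first phase the rate equals
`M ^ 2 ((M / σ) ^ 2 u') ^ (-2 α / (2 α + 1))` with `u'` the smaller of `m`
and the number of machines that the budget can pay for (`threePhaseRate_eq`), and the tuning
constant changes this number only by a factor.
-/

namespace SeqModgame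

noncomputable section

/-! ### The localization code -/

theorem length_binRep (n : ℕ) : (binRep n).length = n.size := by
  rw [binRep, List.length_reverse, Nat.size_eq_bits_len]

theorem bits_injective : Function.Injective Nat.bits := by
  intro m n h
  have h' : Nat.digits 2 m = Nat.digits 2 n := by
    rw [Nat.digits_two_eq_bits, Nat.digits_two_eq_bits, h]
  exact Nat.digits_inj_iff.1 h'

theorem binRep_injective : Function.Injective binRep :=
  List.reverse_injective.comp bits_injective

theorem exists_binRep_eq_cons {n : ℕ} (hn : n ≠ 0) : ∃ l, binRep n = true :: l := by
  unfold binRep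
  induction n using Nat.strong_induction_on with
  | _ n ih =>
    obtain ⟨k, rfl | rfl⟩ := n.even_or_odd'
    · have hk : k ≠ 0 := by lia
      obtain ⟨l, hl⟩ := ih k (by lia) hk
      exact ⟨l ++ [false], by rw [Nat.bit0_bits k hk, List.reverse_cons, hl, List.cons_append]⟩
    · rcases eq_or_ne k 0 with rfl | hk
      · exact ⟨[], by simp⟩
      · obtain ⟨l, hl⟩ := ih k (by lia) hk
        exact ⟨l ++ [true], by rw [Nat.bit1_bits, List.reverse_cons, hl, List.cons_append]⟩

theorem replicate_false_append_cancel {k k' : ℕ} {s s' : List Bool}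
    (h : List.replicate k false ++ true :: s = List.replicate k' false ++ true :: s') :
    k = k' ∧ s = s' := by
  induction k generalizing k' with
  | zero => cases k' <;> simp_all [List.replicate_succ]
  | succ k ih =>
    cases k' with
    | zero => simp [List.replicate_succ] at h
    | succ k' =>
      simp only [List.replicate_succ, List.cons_append, List.cons.injEq, true_and] at h
      obtain ⟨h1, h2⟩ := ih h
      exact ⟨by rw [h1], h2⟩

/-- The run of zeros announces the number of digits, so that a binary representation can be read
off the front of a longer string. -/
theorem zeros_binRep_cancel {m n : ℕ} (hm : m ≠ 0) (hn : n ≠ 0) (c : ℕ) {s t : List Bool}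
    (h : List.replicate ((binRep m).length - c) false ++ (binRep m ++ s) =
      List.replicate ((binRep n).length - c) false ++ (binRep n ++ t))
    (hc : c ≤ 1) : m = n ∧ s = t := by
  obtain ⟨l, hl⟩ := exists_binRep_eq_cons hm
  obtain ⟨l', hl'⟩ := exists_binRep_eq_cons hn
  have h0 := h
  rw [hl, hl'] at h0
  simp only [List.cons_append, List.length_cons] at h0
  obtain ⟨h1, h2⟩ := replicate_false_append_cancel h0
  have h3 : (binRep m).length = (binRep n).length := by
    rw [hl, hl']; simp only [List.length_cons]; lia
  rw [h3] at h
  obtain ⟨h4, h5⟩ := List.append_inj (List.append_cancel_left h) h3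
  exact ⟨binRep_injective h4, h5⟩

/-- `locCode` is a prefix code. -/
theorem locCode_append_cancel {x y : ℤ} {s t : List Bool}
    (h : locCode x ++ s = locCode y ++ t) : x = y ∧ s = t := by
  have key : ∀ n : ℕ, n ≠ 0 → ∃ k, (binRep n).length = k + 1 := fun n hn => by
    obtain ⟨l, hl⟩ := exists_binRep_eq_cons hn
    exact ⟨l.length, by rw [hl, List.length_cons]⟩
  unfold locCode at h
  split_ifs at h with hx hy hy' hx' hy hy' hy hy'
  · simp_all
  · simp at h
  · simp at h
  · simp at h
  · simp only [List.cons_append, List.cons.injEq, true_and, List.append_assoc] at h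
    obtain ⟨h1, h2⟩ := zeros_binRep_cancel (by lia) (by lia) 0 h (by lia)
    exact ⟨by lia, h2⟩
  · obtain ⟨k, hk⟩ := key x.natAbs (by lia)
    simp [hk, List.replicate_succ] at h
  · simp at h
  · obtain ⟨k, hk⟩ := key y.natAbs (by lia)
    simp [hk, List.replicate_succ] at h
  · simp only [List.cons_append, List.cons.injEq, true_and, List.append_assoc] at h
    obtain ⟨h1, h2⟩ := zeros_binRep_cancel (by lia) (by lia) 1 h (by lia)
    exact ⟨by lia, h2⟩

theorem length_locCode (x : ℤ) : (locCode x).length = 1 + 2 * x.natAbs.size := by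
  unfold locCode
  split_ifs with h h'
  · simp [h]
  · simp [length_binRep]; lia
  · have : 0 < x.natAbs.size := Nat.size_pos.2 (by lia)
    simp [length_binRep]; lia

theorem locCode_ne_nil (x : ℤ) : locCode x ≠ [] := by
  intro h
  have := length_locCode x
  rw [h, List.length_nil] at this
  lia

theorem flatMap_locCode_append_cancel {l : List Idx} {v w : Idx → ℤ} {s t : List Bool}
    (h : (l.flatMap fun a => locCode (v a)) ++ s = (l.flatMap fun a => locCode (w a)) ++ t) :
    (∀ a ∈ l, v a = w a) ∧ s = t := by
  induction l with
  | nil => simpa using h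
  | cons a l ih =>
    simp only [List.flatMap_cons, List.append_assoc] at h
    obtain ⟨h1, h2⟩ := locCode_append_cancel h
    obtain ⟨h3, h4⟩ := ih h2
    exact ⟨by simpa [h1] using h3, h4⟩

theorem mem_coeffList {N : ℕ} {a : Idx} : a ∈ coeffList N ↔ a.1 < N := by
  obtain ⟨j, k⟩ := a
  simp only [coeffList, List.mem_flatMap, List.mem_range, List.mem_map, List.mem_finRange,
    true_and]
  constructor
  · rintro ⟨j', h, k', h'⟩
    cases h'; exact h
  · intro h
    exact ⟨j, h, k, rfl⟩

theorem decodeBlock_encodeBlock {N : ℕ} (v : Idx → ℤ) {a : Idx} (ha : a.1 < N) :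
    decodeBlock N (encodeBlock N v) a = v a := by
  have h : encodeBlock N (decodeBlock N (encodeBlock N v)) = encodeBlock N v :=
    Function.invFun_eq ⟨v, rfl⟩
  have h' : encodeBlock N (decodeBlock N (encodeBlock N v)) ++ [] = encodeBlock N v ++ [] := by
    rw [h]
  exact (flatMap_locCode_append_cancel h').1 a (mem_coeffList.2 ha)

/-- A prefix code without the empty string is uniquely decodable. -/
theorem uniquelyDecodable_of_append_cancel {S : Set (List Bool)} (h0 : [] ∉ S)
    (h : ∀ x ∈ S, ∀ y ∈ S, ∀ s t, x ++ s = y ++ t → x = y ∧ s = t) :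
    InformationTheory.UniquelyDecodable S := by
  intro L₁
  induction L₁ with
  | nil =>
    intro L₂ _ h2 hf
    cases L₂ with
    | nil => rfl
    | cons y L₂ =>
      have : y = [] := by
        have := hf.symm
        simp only [List.flatten_cons, List.flatten_nil, List.append_eq_nil_iff] at this
        exact this.1
      exact absurd (h2 y (by simp)) (this ▸ h0)
  | cons x L₁ ih =>
    intro L₂ h1 h2 hf
    cases L₂ with
    | nil =>
      have : x = [] := by
        simp only [List.flatten_cons, List.flatten_nil, List.append_eq_nil_iff] at hf
        exact hf.1
      exact absurd (h1 x (by simp)) (this ▸ h0)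
    | cons y L₂ =>
      simp only [List.flatten_cons] at hf
      obtain ⟨hxy, hst⟩ := h x (h1 x (by simp)) y (h2 y (by simp)) _ _ hf
      rw [hxy, ih L₂ (fun w hw => h1 w (by simp [hw])) (fun w hw => h2 w (by simp [hw])) hst]

theorem uniquelyDecodable_range_encodeBlock {N : ℕ} (hN : N ≠ 0) {X : Type*} (f : X → Idx → ℤ) :
    InformationTheory.UniquelyDecodable (Set.range fun x => encodeBlock N (f x)) := by
  refine uniquelyDecodable_of_append_cancel ?_ ?_
  · rintro ⟨x, hx⟩
    have hmem : (⟨0, 0⟩ : Idx) ∈ coeffList N := mem_coeffList.2 (Nat.pos_of_ne_zero hN)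
    exact locCode_ne_nil _ (List.flatMap_eq_nil_iff.1 hx _ hmem)
  · rintro _ ⟨x, rfl⟩ _ ⟨y, rfl⟩ s t h
    obtain ⟨h1, h2⟩ := flatMap_locCode_append_cancel h
    refine ⟨?_, h2⟩
    simp only [encodeBlock, List.flatMap]
    congr 1
    exact List.map_congr_left fun a ha => by rw [h1 a ha]

theorem encodeBlock_zero (v : Idx → ℤ) : encodeBlock 0 v = [] := rfl

/-- Sums over the first `N` levels, arranged by level. -/
theorem sum_map_coeffList {R : Type*} [AddCommMonoid R] (N : ℕ) (f : Idx → R) :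
    ((coeffList N).map f).sum = ∑ j ∈ Finset.range N, ∑ k : Fin (2 ^ j), f ⟨j, k⟩ := by
  induction N with
  | zero => simp [coeffList]
  | succ N ih =>
    have : coeffList (N + 1) =
        coeffList N ++ (List.finRange (2 ^ N)).map fun k => (⟨N, k⟩ : Idx) := by
      simp [coeffList, List.range_succ]
    rw [this, List.map_append, List.sum_append, ih, Finset.sum_range_succ, List.map_map]
    congr 1

theorem length_encodeBlock (N : ℕ) (v : Idx → ℤ) :
    (encodeBlock N v).length =
      ∑ j ∈ Finset.range N, ∑ k : Fin (2 ^ j), (locCode (v ⟨j, k⟩)).length := by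
  rw [← sum_map_coeffList N fun a => (locCode (v a)).length, encodeBlock, List.length_flatMap]

/-- `log₂ (1 + |y|)` governs the number of bits for `⌊y⌋`. -/
theorem length_locCode_floor_le (y : ℝ) :
    ((locCode ⌊y⌋).length : ℝ) ≤ 3 + 2 * Real.logb 2 (1 + |y|) := by
  have hlog : 0 ≤ Real.logb 2 (1 + |y|) :=
    Real.logb_nonneg (by norm_num) (by linarith [abs_nonneg y])
  rw [length_locCode]
  push_cast
  rcases Nat.eq_zero_or_pos (⌊y⌋).natAbs.size with h | h
  · rw [h]; push_cast; linarith
  · obtain ⟨k, hk⟩ : ∃ k, (⌊y⌋).natAbs.size = k + 1 := ⟨_, (Nat.succ_pred_eq_of_pos h).symm⟩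
    have h1 : 2 ^ k ≤ (⌊y⌋).natAbs := Nat.lt_size.1 (by lia)
    have h2 : ((2 : ℝ) ^ k) ≤ 1 + |y| := by
      calc ((2 : ℝ) ^ k) ≤ ((⌊y⌋).natAbs : ℝ) := by exact_mod_cast h1
        _ = |(⌊y⌋ : ℝ)| := by rw [Nat.cast_natAbs]; push_cast; rfl
        _ ≤ 1 + |y| := by
          rw [abs_le]
          have h3 := Int.floor_le y
          have h4 := Int.lt_floor_add_one y
          constructor <;> cases abs_cases y <;> linarith
    have h3 : (k : ℝ) ≤ Real.logb 2 (1 + |y|) := by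
      rw [Real.le_logb_iff_rpow_le (by norm_num) (by positivity), Real.rpow_natCast]
      exact h2
    rw [hk]; push_cast; linarith

/-! ### The number of levels -/

theorem le_two_rpow_neg_iff {α M δ : ℝ} (hα : 0 < α) (hM : 0 < M) (hδ : 0 < δ) (j : ℕ) :
    δ ≤ M * (2 : ℝ) ^ (-((j : ℝ) * (α + 1 / 2))) ↔ (2 : ℝ) ^ j ≤ (M / δ) ^ (1 / (α + 1 / 2)) := by
  have hs : 0 < α + 1 / 2 := by linarith
  rw [one_div (α + 1 / 2), Real.le_rpow_inv_iff_of_pos (by positivity) (by positivity) hs,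
    ← Real.rpow_natCast, ← Real.rpow_mul (by norm_num), Real.rpow_neg (by norm_num),
    le_div_iff₀ hδ, ← div_eq_mul_inv, le_div_iff₀ (by positivity), mul_comm]

theorem lt_numLevels_iff {α M δ : ℝ} (hα : 0 < α) (hM : 0 < M) (hδ : 0 < δ) (j : ℕ) :
    j < numLevels α M δ ↔ (2 : ℝ) ^ j ≤ (M / δ) ^ (1 / (α + 1 / 2)) := by
  simp only [numLevels, le_two_rpow_neg_iff hα hM hδ]
  set T := (M / δ) ^ (1 / (α + 1 / 2))
  obtain ⟨n, hn⟩ := pow_unbounded_of_one_lt T (one_lt_two : (1 : ℝ) < 2)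
  have hbdd : BddAbove ((fun j : ℕ => j + 1) '' {j : ℕ | (2 : ℝ) ^ j ≤ T}) := by
    refine ⟨n, ?_⟩
    rintro _ ⟨i, hi, rfl⟩
    exact (pow_lt_pow_iff_right₀ (one_lt_two : (1 : ℝ) < 2)).1 (lt_of_le_of_lt hi hn)
  constructor
  · intro h
    have hne : ((fun j : ℕ => j + 1) '' {j : ℕ | (2 : ℝ) ^ j ≤ T}).Nonempty := by
      by_contra hne
      rw [Set.not_nonempty_iff_eq_empty] at hne
      simp [hne] at h
    obtain ⟨i, hi, hi'⟩ := Nat.sSup_mem hne hbdd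
    simp only at hi'
    exact le_trans (pow_le_pow_right₀ one_le_two (by lia)) hi
  · intro h
    exact le_csSup hbdd ⟨j, h, rfl⟩

theorem two_pow_numLevels_gt {α M δ : ℝ} (hα : 0 < α) (hM : 0 < M) (hδ : 0 < δ) :
    (M / δ) ^ (1 / (α + 1 / 2)) < (2 : ℝ) ^ numLevels α M δ := by
  by_contra! h
  exact lt_irrefl _ ((lt_numLevels_iff hα hM hδ _).2 h)

theorem two_pow_le_of_numLevels_eq_succ {α M δ : ℝ} (hα : 0 < α) (hM : 0 < M) (hδ : 0 < δ) {n : ℕ}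
    (h : numLevels α M δ = n + 1) : (2 : ℝ) ^ n ≤ (M / δ) ^ (1 / (α + 1 / 2)) :=
  (lt_numLevels_iff hα hM hδ n).1 (by lia)

/-- The number of estimated coefficients is at most `2 (M / δ) ^ (1 / (α + 1/2))`. -/
theorem sum_two_pow_numLevels_le {α M δ : ℝ} (hα : 0 < α) (hM : 0 < M) (hδ : 0 < δ) :
    ∑ j ∈ Finset.range (numLevels α M δ), (2 : ℝ) ^ j ≤ 2 * (M / δ) ^ (1 / (α + 1 / 2)) := by
  rw [geom_sum_eq (by norm_num)]
  rcases h : numLevels α M δ with _ | n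
  · simp; positivity
  · have := two_pow_le_of_numLevels_eq_succ hα hM hδ h
    rw [pow_succ]; linarith

theorem sum_two_pow_mul_sub_numLevels_le {α M δ : ℝ} (hα : 0 < α) (hM : 0 < M) (hδ : 0 < δ) :
    ∑ j ∈ Finset.range (numLevels α M δ), (2 : ℝ) ^ j * ((numLevels α M δ : ℝ) - j) ≤
      4 * (M / δ) ^ (1 / (α + 1 / 2)) := by
  have key : ∀ n : ℕ, ∑ j ∈ Finset.range n, (2 : ℝ) ^ j * ((n : ℝ) - j) =
      2 * 2 ^ n - n - 2 := by
    intro n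
    induction n with
    | zero => norm_num
    | succ n ih =>
      rw [Finset.sum_range_succ]
      have h1 : ∀ j ∈ Finset.range n, (2 : ℝ) ^ j * (((n + 1 : ℕ) : ℝ) - j) =
          2 ^ j * ((n : ℝ) - j) + 2 ^ j := fun j _ => by push_cast; ring
      rw [Finset.sum_congr rfl h1, Finset.sum_add_distrib, ih, geom_sum_eq (by norm_num)]
      push_cast; ring
  rw [key]
  rcases h : numLevels α M δ with _ | n
  · simp; positivity
  · have := two_pow_le_of_numLevels_eq_succ hα hM hδ h
    have h3 : (0 : ℝ) ≤ ((n + 1 : ℕ) : ℝ) := by positivity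
    rw [pow_succ]; linarith

/-! ### Single levels of a Besov ball -/

/-- The size `M 2 ^ (-j (α + 1/2))` of a typical coefficient at level `j` of a Besov ball. -/
def levelScale (α M : ℝ) (j : ℕ) : ℝ := M * (2 : ℝ) ^ (-((j : ℝ) * (α + 1 / 2)))

theorem levelScale_pos {α M : ℝ} (hM : 0 < M) (j : ℕ) : 0 < levelScale α M j := by
  unfold levelScale; positivity

theorem le_ellNorm {ι : Type*} {r : ℝ≥0∞} (hr : 0 < r) (a : ι → ℝ≥0∞) (i : ι) :
    a i ≤ ellNorm r a := by
  unfold ellNorm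
  split_ifs with h
  · exact le_iSup a i
  · have hr' : 0 < r.toReal := ENNReal.toReal_pos hr.ne' h
    calc a i = (a i ^ r.toReal) ^ (1 / r.toReal) := by
          rw [← ENNReal.rpow_mul, mul_one_div_cancel hr'.ne', ENNReal.rpow_one]
      _ ≤ _ := ENNReal.rpow_le_rpow (ENNReal.le_tsum i) (by positivity)

theorem ellNorm_level_le {α M : ℝ} {p q : ℝ≥0∞} (hq : 0 < q) {θ : Seq}
    (hθ : θ ∈ besovBall α p q M) (j : ℕ) :
    ellNorm p (fun k : Fin (2 ^ j) => ENNReal.ofReal |θ ⟨j, k⟩|) ≤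
      ENNReal.ofReal (M * (2 : ℝ) ^ (-((j : ℝ) * besovIndex α p))) := by
  have h1 := (le_ellNorm hq (fun j : ℕ =>
    ENNReal.ofReal ((2 : ℝ) ^ ((j : ℝ) * besovIndex α p)) *
      ellNorm p fun k : Fin (2 ^ j) => ENNReal.ofReal |θ ⟨j, k⟩|) j).trans hθ
  have h2 : (0 : ℝ) < (2 : ℝ) ^ ((j : ℝ) * besovIndex α p) := by positivity
  rw [Real.rpow_neg (by norm_num), ← div_eq_mul_inv, ENNReal.ofReal_div_of_pos h2,
    ENNReal.le_div_iff_mul_le (Or.inl (by simpa using h2)) (Or.inl ENNReal.ofReal_ne_top), mul_comm]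
  exact h1

/-- For `p = ∞` every coefficient of level `j` is at most `levelScale α M j`. -/
theorem abs_le_levelScale {α M : ℝ} {q : ℝ≥0∞} (hM : 0 < M) (hq : 0 < q) {θ : Seq}
    (hθ : θ ∈ besovBall α ∞ q M) (a : Idx) : |θ a| ≤ levelScale α M a.1 := by
  obtain ⟨j, k⟩ := a
  have h := (le_ellNorm ENNReal.zero_lt_top
    (fun k : Fin (2 ^ j) => ENNReal.ofReal |θ ⟨j, k⟩|) k).trans (ellNorm_level_le hq hθ j)
  have h' := (ENNReal.ofReal_le_ofReal_iff (by positivity)).1 h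
  simpa [besovIndex, levelScale] using h'

/-- For `p < ∞` the `p`-th powers of the coefficients of level `j`, in units of
`levelScale α M j`, are at most `1` on average. -/
theorem sum_rpow_div_levelScale_le {α M : ℝ} {p q : ℝ≥0∞} (hM : 0 < M) (hp : 0 < p) (hp' : p ≠ ∞)
    (hq : 0 < q) {θ : Seq} (hθ : θ ∈ besovBall α p q M) (j : ℕ) :
    ∑ k : Fin (2 ^ j), (|θ ⟨j, k⟩| / levelScale α M j) ^ p.toReal ≤ (2 : ℝ) ^ j := by
  have hr : 0 < p.toReal := ENNReal.toReal_pos hp.ne' hp'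
  have h := ellNorm_level_le hq hθ j
  set r := p.toReal with hr_def
  have hsum : ∑ k : Fin (2 ^ j), |θ ⟨j, k⟩| ^ r ≤
      (M * (2 : ℝ) ^ (-((j : ℝ) * besovIndex α p))) ^ r := by
    unfold ellNorm at h
    rw [if_neg hp', tsum_fintype, ← hr_def, one_div, ENNReal.rpow_inv_le_iff hr,
      ENNReal.ofReal_rpow_of_nonneg (by positivity) hr.le] at h
    rw [← ENNReal.ofReal_le_ofReal_iff (by positivity)]
    refine le_trans (le_of_eq ?_) h
    rw [ENNReal.ofReal_sum_of_nonneg fun _ _ => by positivity]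
    exact Finset.sum_congr rfl fun k _ => by
      rw [ENNReal.ofReal_rpow_of_nonneg (abs_nonneg _) hr.le]
  have hpos : 0 < levelScale α M j := levelScale_pos hM j
  have h1 : ∀ k : Fin (2 ^ j), (|θ ⟨j, k⟩| / levelScale α M j) ^ r =
      |θ ⟨j, k⟩| ^ r / levelScale α M j ^ r := fun k => Real.div_rpow (abs_nonneg _) hpos.le r
  rw [Finset.sum_congr rfl fun k _ => h1 k, ← Finset.sum_div, div_le_iff₀ (by positivity)]
  refine hsum.trans (le_of_eq ?_)
  have h2 : M * (2 : ℝ) ^ (-((j : ℝ) * besovIndex α p)) =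
      levelScale α M j * (2 : ℝ) ^ ((j : ℝ) * (1 / r)) := by
    rw [levelScale, mul_assoc, ← Real.rpow_add (by norm_num)]
    congr 2
    rw [besovIndex]; ring
  rw [h2, Real.mul_rpow hpos.le (by positivity), ← Real.rpow_mul (by norm_num),
    mul_assoc, one_div_mul_cancel hr.ne', mul_one, Real.rpow_natCast, mul_comm]

/-- The logarithm is so small that the bound below does not depend on `p`, provided that
`1 / p < α + 1/2`. -/
theorem sum_logb_one_add_div_le {α M δ : ℝ} {p q : ℝ≥0∞} (hM : 0 < M) (hδ : 0 < δ) (hp : 0 < p)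
    (hq : 0 < q) (hs : 0 < besovIndex α p) {θ : Seq} (hθ : θ ∈ besovBall α p q M) (j : ℕ)
    (hj : δ ≤ levelScale α M j) :
    ∑ k : Fin (2 ^ j), Real.logb 2 (1 + |θ ⟨j, k⟩| / δ) ≤
      2 ^ j * (Real.logb 2 (levelScale α M j / δ) + α + 3 / 2) := by
  have hw := levelScale_pos (α := α) hM j
  set w := levelScale α M j with hw_def
  have hA : 1 ≤ w / δ := (one_le_div hδ).2 hj
  have hlog2 : 0 < Real.log 2 := Real.log_pos one_lt_two
  -- separate the scale of the level from the relative size of the coefficient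
  have hsplit : ∀ k : Fin (2 ^ j), Real.logb 2 (1 + |θ ⟨j, k⟩| / δ) ≤
      Real.logb 2 (w / δ) + Real.logb 2 (1 + |θ ⟨j, k⟩| / w) := by
    intro k
    rw [← Real.logb_mul (by positivity) (by positivity)]
    refine Real.logb_le_logb_of_le (by norm_num) (by positivity) ?_
    have : w / δ * (|θ ⟨j, k⟩| / w) = |θ ⟨j, k⟩| / δ := by field_simp
    rw [mul_add, this]; linarith
  have hmain : ∑ k : Fin (2 ^ j), Real.logb 2 (1 + |θ ⟨j, k⟩| / w) ≤ 2 ^ j * (α + 3 / 2) := by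
    by_cases hp' : p = ∞
    · subst hp'
      have hα : 0 < α + 1 / 2 := by simpa [besovIndex] using hs
      calc ∑ k : Fin (2 ^ j), Real.logb 2 (1 + |θ ⟨j, k⟩| / w)
          ≤ ∑ k : Fin (2 ^ j), (α + 3 / 2) := by
            refine Finset.sum_le_sum fun k _ => ?_
            have h1 : |θ ⟨j, k⟩| / w ≤ 1 := (div_le_one hw).2 (abs_le_levelScale hM hq hθ ⟨j, k⟩)
            have h2 : Real.logb 2 (1 + |θ ⟨j, k⟩| / w) ≤ Real.logb 2 2 :=
              Real.logb_le_logb_of_le (by norm_num) (by positivity) (by linarith)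
            rw [Real.logb_self_eq_one (by norm_num)] at h2
            linarith
        _ = _ := by simp [mul_add]
    · have hr : 0 < p.toReal := ENNReal.toReal_pos hp.ne' hp'
      have hinv : 1 / p.toReal < α + 1 / 2 := by unfold besovIndex at hs; linarith
      have hα : 0 ≤ α + 1 / 2 := le_trans (by positivity) hinv.le
      have hsum := sum_rpow_div_levelScale_le hM hp hp' hq hθ j
      set r := p.toReal with hr_def
      have hpt : ∀ b : ℝ, 0 ≤ b → Real.logb 2 (1 + b) ≤ 1 + 1 / r * b ^ r := by
        intro b hb
        rcases le_or_gt b 1 with h1 | h1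
        · have h2 : Real.logb 2 (1 + b) ≤ Real.logb 2 2 :=
            Real.logb_le_logb_of_le (by norm_num) (by positivity) (by linarith)
          rw [Real.logb_self_eq_one (by norm_num)] at h2
          have : 0 ≤ 1 / r * b ^ r := by positivity
          linarith
        · have hb0 : 0 < b := by linarith
          have h2 : Real.logb 2 (1 + b) ≤ Real.logb 2 (2 * b) :=
            Real.logb_le_logb_of_le (by norm_num) (by positivity) (by linarith)
          rw [Real.logb_mul (by norm_num) hb0.ne', Real.logb_self_eq_one (by norm_num)] at h2
          -- `log₂ y ≤ y` for `y = b ^ r`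
          have h3 : Real.logb 2 (b ^ r) ≤ b ^ r := by
            rw [Real.logb, div_le_iff₀ hlog2]
            have h4 := Real.log_le_sub_one_of_pos (x := b ^ r / 2) (by positivity)
            rw [Real.log_div (by positivity) (by norm_num)] at h4
            have h5 := Real.log_two_gt_d9
            have h6 : (0 : ℝ) < b ^ r := by positivity
            nlinarith [Real.log_two_lt_d9]
          rw [Real.logb_rpow_eq_mul_logb_of_pos hb0] at h3
          have h4 : Real.logb 2 b ≤ 1 / r * b ^ r := by
            rw [one_div, ← div_eq_inv_mul, le_div_iff₀ hr]; linarith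
          linarith
      calc ∑ k : Fin (2 ^ j), Real.logb 2 (1 + |θ ⟨j, k⟩| / w)
          ≤ ∑ k : Fin (2 ^ j), (1 + 1 / r * (|θ ⟨j, k⟩| / w) ^ r) :=
            Finset.sum_le_sum fun k _ => hpt _ (by positivity)
        _ = 2 ^ j + 1 / r * ∑ k : Fin (2 ^ j), (|θ ⟨j, k⟩| / w) ^ r := by
            rw [Finset.sum_add_distrib, Finset.mul_sum]; simp
        _ ≤ 2 ^ j + (α + 1 / 2) * 2 ^ j := by gcongr
        _ = _ := by ring
  calc _ ≤ ∑ k : Fin (2 ^ j), (Real.logb 2 (w / δ) + Real.logb 2 (1 + |θ ⟨j, k⟩| / w)) :=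
        Finset.sum_le_sum fun k _ => hsplit k
    _ = 2 ^ j * Real.logb 2 (w / δ) + ∑ k : Fin (2 ^ j), Real.logb 2 (1 + |θ ⟨j, k⟩| / w) := by
        rw [Finset.sum_add_distrib]; simp
    _ ≤ 2 ^ j * Real.logb 2 (w / δ) + 2 ^ j * (α + 3 / 2) := by gcongr
    _ = _ := by ring

/-- Since `x ^ 2 ≤ 1 + x ^ p` for `p ≥ 2`, the energy of level `j` is at most
`2 · 2 ^ j · (levelScale α M j) ^ 2`. -/
theorem sum_sq_level_le {α M : ℝ} {p q : ℝ≥0∞} (hM : 0 < M) (hp : 2 ≤ p) (hq : 0 < q) {θ : Seq}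
    (hθ : θ ∈ besovBall α p q M) (j : ℕ) :
    ∑ k : Fin (2 ^ j), θ ⟨j, k⟩ ^ 2 ≤ 2 * 2 ^ j * levelScale α M j ^ 2 := by
  have hw := levelScale_pos (α := α) hM j
  by_cases hp' : p = ∞
  · subst hp'
    calc ∑ k : Fin (2 ^ j), θ ⟨j, k⟩ ^ 2 ≤ ∑ k : Fin (2 ^ j), levelScale α M j ^ 2 := by
          refine Finset.sum_le_sum fun k _ => ?_
          rw [← sq_abs]
          exact pow_le_pow_left₀ (abs_nonneg _) (abs_le_levelScale hM hq hθ ⟨j, k⟩) 2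
      _ = 2 ^ j * levelScale α M j ^ 2 := by simp
      _ ≤ _ := by
          have : 0 ≤ (2 : ℝ) ^ j * levelScale α M j ^ 2 := by positivity
          linarith
  · have hsum := sum_rpow_div_levelScale_le hM (lt_of_lt_of_le (by norm_num) hp) hp' hq hθ j
    have hr : 2 ≤ p.toReal := by simpa using ENNReal.toReal_mono hp' hp
    set r := p.toReal
    set w := levelScale α M j
    have hpt : ∀ b : ℝ, 0 ≤ b → b ^ 2 ≤ 1 + b ^ r := by
      intro b hb
      rcases le_or_gt b 1 with h1 | h1
      · have : 0 ≤ b ^ r := by positivity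
        nlinarith
      · have := Real.rpow_le_rpow_of_exponent_le h1.le hr
        rw [Real.rpow_two] at this
        linarith
    calc ∑ k : Fin (2 ^ j), θ ⟨j, k⟩ ^ 2 ≤ ∑ k : Fin (2 ^ j), w ^ 2 * (1 + (|θ ⟨j, k⟩| / w) ^ r) := by
          refine Finset.sum_le_sum fun k _ => ?_
          have h1 := hpt (|θ ⟨j, k⟩| / w) (by positivity)
          have h2 : θ ⟨j, k⟩ ^ 2 = w ^ 2 * (|θ ⟨j, k⟩| / w) ^ 2 := by
            rw [div_pow, sq_abs]; field_simp
          rw [h2]; gcongr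
      _ = w ^ 2 * (2 ^ j + ∑ k : Fin (2 ^ j), (|θ ⟨j, k⟩| / w) ^ r) := by
          rw [← Finset.mul_sum, Finset.sum_add_distrib]; simp
      _ ≤ w ^ 2 * (2 ^ j + 2 ^ j) := by gcongr
      _ = _ := by ring

/-! ### One coefficient of the Gaussian sequence model -/

/-- The law of the `m` standardized errors in the observations of one coefficient. -/
def noiseLaw (m : ℕ) : Measure (Fin m → ℝ) := Measure.pi fun _ => gaussianReal 0 1

instance (m : ℕ) : IsProbabilityMeasure (noiseLaw m) := by unfold noiseLaw; infer_instance

instance (m : ℕ) (σ : ℝ) (θ : Seq) : IsProbabilityMeasure (dataLaw m σ θ) := by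
  unfold dataLaw; infer_instance

theorem measurePreserving_affine (t σ : ℝ) :
    MeasurePreserving (fun z => t + σ * z) (gaussianReal 0 1)
      (gaussianReal t (σ ^ 2).toNNReal) := by
  refine ⟨by fun_prop, ?_⟩
  have h : (fun z : ℝ => t + σ * z) = (fun y => t + y) ∘ fun z => σ * z := rfl
  rw [h, ← Measure.map_map (by fun_prop) (by fun_prop), gaussianReal_map_const_mul,
    gaussianReal_map_const_add]
  congr 1
  · ring
  · ext
    rw [Real.coe_toNNReal _ (sq_nonneg σ)]
    simp

theorem measurePreserving_coeff (m : ℕ) (σ : ℝ) (θ : Seq) (a : Idx) :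
    MeasurePreserving (fun (X : Fin m → Seq) i => X i a) (dataLaw m σ θ)
      (Measure.pi fun _ => gaussianReal (θ a) (σ ^ 2).toNNReal) :=
  measurePreserving_pi _ _ (f := fun (_ : Fin m) (x : Seq) => x a) fun _ =>
    measurePreserving_eval_infinitePi (fun a : Idx => gaussianReal (θ a) (σ ^ 2).toNNReal) a

theorem lintegral_coeff (m : ℕ) (σ : ℝ) (θ : Seq) (a : Idx) {F : (Fin m → ℝ) → ℝ≥0∞}
    (hF : Measurable F) :
    ∫⁻ X, F (fun i => X i a) ∂(dataLaw m σ θ) = ∫⁻ z, F (fun i => θ a + σ * z i) ∂(noiseLaw m) := by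
  rw [(measurePreserving_coeff m σ θ a).lintegral_comp hF, noiseLaw]
  exact ((measurePreserving_pi (fun _ : Fin m => gaussianReal 0 1) _
    fun _ => measurePreserving_affine (θ a) σ).lintegral_comp hF).symm

theorem lintegral_noise_eval {m : ℕ} (i : Fin m) {F : ℝ → ℝ≥0∞} (hF : Measurable F) :
    ∫⁻ z, F (z i) ∂(noiseLaw m) = ∫⁻ z, F z ∂(gaussianReal 0 1) :=
  (measurePreserving_eval (fun _ : Fin m => gaussianReal 0 1) i).lintegral_comp hF

theorem lintegral_coeff_eval {m : ℕ} (σ : ℝ) (θ : Seq) (i : Fin m) (a : Idx) {F : ℝ → ℝ≥0∞}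
    (hF : Measurable F) :
    ∫⁻ X, F (X i a) ∂(dataLaw m σ θ) = ∫⁻ z, F (θ a + σ * z) ∂(gaussianReal 0 1) := by
  rw [lintegral_coeff m σ θ a (F := fun x => F (x i)) (hF.comp (measurable_pi_apply i)),
    lintegral_noise_eval i (F := fun z => F (θ a + σ * z)) (hF.comp (by fun_prop))]

theorem integrable_sq_gaussian : Integrable (fun z : ℝ => z ^ 2) (gaussianReal 0 1) :=
  (memLp_id_gaussianReal (μ := 0) (v := 1) 2).integrable_sq

theorem integral_sq_gaussian : ∫ z, z ^ 2 ∂(gaussianReal 0 1) = 1 := by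
  have h := variance_fun_id_gaussianReal (μ := 0) (v := 1)
  rw [variance_of_integral_eq_zero (by fun_prop) (by simp)] at h
  simpa using h

theorem lintegral_affine_sq_gaussian {a b : ℝ} (ha : 0 ≤ a) (hb : 0 ≤ b) :
    ∫⁻ z, ENNReal.ofReal (a + b * z ^ 2) ∂(gaussianReal 0 1) = ENNReal.ofReal (a + b) := by
  have hint : Integrable (fun z : ℝ => a + b * z ^ 2) (gaussianReal 0 1) :=
    (integrable_const _).add (integrable_sq_gaussian.const_mul b)
  rw [← ofReal_integral_eq_lintegral_ofReal hint (Filter.Eventually.of_forall fun z => by positivity),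
    integral_add (integrable_const _) (integrable_sq_gaussian.const_mul b), integral_const_mul,
    integral_sq_gaussian]
  simp

/-! ### Communication cost of one machine -/

theorem measurable_length_locCode : Measurable fun n : ℤ => ((locCode n).length : ℝ≥0∞) :=
  measurable_of_countable _

theorem lintegral_length_encodeBlock {m : ℕ} (σ : ℝ) (θ : Seq) (i : Fin m) (N : ℕ) {f : ℝ → ℤ}
    (hf : Measurable f) :
    ∫⁻ X, ((encodeBlock N fun a => f (X i a)).length : ℝ≥0∞) ∂(dataLaw m σ θ) =
      ∑ j ∈ Finset.range N, ∑ k : Fin (2 ^ j),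
        ∫⁻ z, ((locCode (f (θ ⟨j, k⟩ + σ * z))).length : ℝ≥0∞) ∂(gaussianReal 0 1) := by
  have hmeas : ∀ a : Idx, Measurable fun X : Fin m → Seq =>
      ((locCode (f (X i a))).length : ℝ≥0∞) := fun a =>
    measurable_length_locCode.comp
      (hf.comp ((measurable_pi_apply a).comp (measurable_pi_apply i)))
  simp only [length_encodeBlock, Nat.cast_sum]
  rw [lintegral_finsetSum _ fun j _ => Finset.measurable_sum _ fun k _ => hmeas ⟨j, k⟩]
  refine Finset.sum_congr rfl fun j _ => ?_
  rw [lintegral_finsetSum _ fun k _ => hmeas ⟨j, k⟩]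
  exact Finset.sum_congr rfl fun k _ =>
    lintegral_coeff_eval σ θ i ⟨j, k⟩ (F := fun x => ((locCode (f x)).length : ℝ≥0∞))
      (measurable_length_locCode.comp hf)

theorem lintegral_length_locCode_floor_le {t σ δ : ℝ} (hσ : 0 < σ) (hσδ : σ ≤ δ) :
    ∫⁻ z, ((locCode ⌊(t + σ * z) / δ⌋).length : ℝ≥0∞) ∂(gaussianReal 0 1) ≤
      ENNReal.ofReal (6 + 2 * Real.logb 2 (1 + |t| / δ)) := by
  have hδ : 0 < δ := hσ.trans_le hσδ
  have hlog : 0 ≤ Real.logb 2 (1 + |t| / δ) :=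
    Real.logb_nonneg (by norm_num) (le_add_of_nonneg_right (by positivity))
  have hpt : ∀ z : ℝ, ((locCode ⌊(t + σ * z) / δ⌋).length : ℝ≥0∞) ≤
      ENNReal.ofReal ((9 / 2 + 2 * Real.logb 2 (1 + |t| / δ)) + 3 / 2 * z ^ 2) := by
    intro z
    rw [← ENNReal.ofReal_natCast]
    refine ENNReal.ofReal_le_ofReal ((length_locCode_floor_le _).trans ?_)
    have h1 : |(t + σ * z) / δ| ≤ |t| / δ + |z| := by
      rw [abs_div, abs_of_pos hδ, div_le_iff₀ hδ, add_mul, div_mul_cancel₀ _ hδ.ne']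
      refine (abs_add_le _ _).trans ?_
      rw [abs_mul, abs_of_pos hσ, mul_comm σ]
      gcongr
    have h2 : Real.logb 2 (1 + |(t + σ * z) / δ|) ≤
        Real.logb 2 (1 + |t| / δ) + Real.logb 2 (1 + |z|) := by
      rw [← Real.logb_mul (by positivity) (by positivity)]
      refine Real.logb_le_logb_of_le (by norm_num) (by positivity) ?_
      have : 0 ≤ |t| / δ * |z| := by positivity
      linarith
    have h3 : Real.logb 2 (1 + |z|) ≤ 3 / 4 + 3 / 4 * z ^ 2 := by
      have h4 := Real.log_le_sub_one_of_pos (x := 1 + |z|) (by positivity)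
      have h5 := Real.log_two_gt_d9
      rw [Real.logb, div_le_iff₀ (by linarith)]
      have h6 : |z| ≤ (1 + z ^ 2) / 2 := by nlinarith [sq_nonneg (|z| - 1), sq_abs z]
      nlinarith [sq_nonneg z]
    linarith
  refine (lintegral_mono hpt).trans (le_of_eq ?_)
  rw [lintegral_affine_sq_gaussian (by positivity) (by norm_num)]
  congr 1; ring

theorem le_levelScale_iff {α M δ : ℝ} (hα : 0 < α) (hM : 0 < M) (hδ : 0 < δ) (j : ℕ) :
    δ ≤ levelScale α M j ↔ j < numLevels α M δ := by
  rw [levelScale, le_two_rpow_neg_iff hα hM hδ, lt_numLevels_iff hα hM hδ]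

theorem logb_levelScale_div_le {α M δ : ℝ} (hα : 0 < α) (hM : 0 < M) (hδ : 0 < δ) (j : ℕ) :
    Real.logb 2 (levelScale α M j / δ) ≤ (α + 1 / 2) * (numLevels α M δ - j) := by
  have hN : levelScale α M (numLevels α M δ) < δ := by
    rw [← not_le, le_levelScale_iff hα hM hδ]; exact lt_irrefl _
  have h : levelScale α M j / δ ≤ 2 ^ ((α + 1 / 2) * ((numLevels α M δ : ℝ) - j)) := by
    rw [div_le_iff₀ hδ]
    have h1 : levelScale α M j = 2 ^ ((α + 1 / 2) * ((numLevels α M δ : ℝ) - j)) *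
        levelScale α M (numLevels α M δ) := by
      rw [levelScale, levelScale, mul_left_comm, ← Real.rpow_add (by norm_num)]
      congr 2; ring
    rw [h1]; gcongr
  have h2 := Real.logb_le_logb_of_le (b := 2) (by norm_num)
    (div_pos (levelScale_pos hM j) hδ) h
  rwa [Real.logb_rpow (by norm_num) (by norm_num)] at h2

/-- Expected cost of the crude localization strings of one machine. -/
theorem lintegral_length_encodeBlock_floor_le {m : ℕ} {α M σ δ δ' : ℝ} {p q : ℝ≥0∞} (hα : 0 < α)
    (hM : 0 < M) (hσ : 0 < σ) (hδ : 0 < δ) (hσδ : σ ≤ δ') (hδδ : δ ≤ δ') (hp : 0 < p) (hq : 0 < q)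
    (hs : 0 < besovIndex α p) {θ : Seq} (hθ : θ ∈ besovBall α p q M) (i : Fin m) :
    ∫⁻ X, ((encodeBlock (numLevels α M δ) fun a => ⌊X i a / δ'⌋).length : ℝ≥0∞) ∂(dataLaw m σ θ) ≤
      ENNReal.ofReal ((12 * α + 22) * (M / δ) ^ (1 / (α + 1 / 2))) := by
  have hδ' : 0 < δ' := hδ.trans_le hδδ
  rw [lintegral_length_encodeBlock σ θ i _ (f := fun x => ⌊x / δ'⌋)
    (Int.measurable_floor.comp (measurable_id.div_const δ'))]
  set N := numLevels α M δ with hN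
  have hpos : ∀ a : Idx, 0 ≤ 6 + 2 * Real.logb 2 (1 + |θ a| / δ) := fun a => by
    have := Real.logb_nonneg (b := 2) (by norm_num)
      (le_add_of_nonneg_right (by positivity) : (1 : ℝ) ≤ 1 + |θ a| / δ)
    linarith
  calc _ ≤ ∑ j ∈ Finset.range N, ∑ k : Fin (2 ^ j),
        ENNReal.ofReal (6 + 2 * Real.logb 2 (1 + |θ ⟨j, k⟩| / δ)) := by
        refine Finset.sum_le_sum fun j _ => Finset.sum_le_sum fun k _ => ?_
        refine (lintegral_length_locCode_floor_le hσ hσδ).trans (ENNReal.ofReal_le_ofReal ?_)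
        have : Real.logb 2 (1 + |θ ⟨j, k⟩| / δ') ≤ Real.logb 2 (1 + |θ ⟨j, k⟩| / δ) :=
          Real.logb_le_logb_of_le (by norm_num) (by positivity) (by gcongr)
        linarith
    _ = ENNReal.ofReal (∑ j ∈ Finset.range N, ∑ k : Fin (2 ^ j),
          (6 + 2 * Real.logb 2 (1 + |θ ⟨j, k⟩| / δ))) := by
        rw [ENNReal.ofReal_sum_of_nonneg fun j _ => Finset.sum_nonneg fun k _ => hpos ⟨j, k⟩]
        exact Finset.sum_congr rfl fun j _ =>
          (ENNReal.ofReal_sum_of_nonneg fun k _ => hpos ⟨j, k⟩).symm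
    _ ≤ _ := by
        refine ENNReal.ofReal_le_ofReal ?_
        calc ∑ j ∈ Finset.range N, ∑ k : Fin (2 ^ j), (6 + 2 * Real.logb 2 (1 + |θ ⟨j, k⟩| / δ))
            ≤ ∑ j ∈ Finset.range N, ((2 * α + 9) * 2 ^ j +
                (2 * α + 1) * (2 ^ j * ((N : ℝ) - j))) := by
              refine Finset.sum_le_sum fun j hj => ?_
              have h1 := sum_logb_one_add_div_le hM hδ hp hq hs hθ j
                ((le_levelScale_iff hα hM hδ j).2 (Finset.mem_range.1 hj))
              have h2 := logb_levelScale_div_le hα hM hδ j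
              have h3 : (2 : ℝ) ^ j * Real.logb 2 (levelScale α M j / δ) ≤
                  2 ^ j * ((α + 1 / 2) * ((N : ℝ) - j)) := by gcongr
              rw [Finset.sum_add_distrib, ← Finset.mul_sum]
              simp only [Finset.sum_const, Finset.card_univ, Fintype.card_fin, nsmul_eq_mul,
                Nat.cast_pow, Nat.cast_ofNat]
              nlinarith
          _ = (2 * α + 9) * ∑ j ∈ Finset.range N, (2 : ℝ) ^ j +
                (2 * α + 1) * ∑ j ∈ Finset.range N, (2 : ℝ) ^ j * ((N : ℝ) - j) := by
              rw [Finset.sum_add_distrib, Finset.mul_sum, Finset.mul_sum]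
          _ ≤ (2 * α + 9) * (2 * (M / δ) ^ (1 / (α + 1 / 2))) +
                (2 * α + 1) * (4 * (M / δ) ^ (1 / (α + 1 / 2))) := by
              gcongr
              · exact sum_two_pow_numLevels_le hα hM hδ
              · exact sum_two_pow_mul_sub_numLevels_le hα hM hδ
          _ = _ := by ring

/-- Cost of the strings for residues in `{0, …, K}`. -/
theorem lintegral_length_encodeBlock_bounded_le {m : ℕ} {α M σ δ : ℝ} (hα : 0 < α) (hM : 0 < M)
    (hδ : 0 < δ) (θ : Seq) (i : Fin m) {f : ℝ → ℤ} (hf : Measurable f) {K : ℕ}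
    (hK : ∀ x, (f x).natAbs ≤ K) :
    ∫⁻ X, ((encodeBlock (numLevels α M δ) fun a => f (X i a)).length : ℝ≥0∞) ∂(dataLaw m σ θ) ≤
      ENNReal.ofReal ((1 + 2 * K.size) * (2 * (M / δ) ^ (1 / (α + 1 / 2)))) := by
  rw [lintegral_length_encodeBlock σ θ i _ hf]
  calc _ ≤ ∑ j ∈ Finset.range (numLevels α M δ), ∑ k : Fin (2 ^ j),
        ENNReal.ofReal (1 + 2 * K.size) := by
        refine Finset.sum_le_sum fun j _ => Finset.sum_le_sum fun k _ => ?_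
        calc _ ≤ ∫⁻ _, ENNReal.ofReal (1 + 2 * K.size) ∂(gaussianReal 0 1) := by
              refine lintegral_mono fun z => ?_
              rw [← ENNReal.ofReal_natCast, length_locCode]
              refine ENNReal.ofReal_le_ofReal ?_
              have := Nat.size_le_size (hK (θ ⟨j, k⟩ + σ * z))
              push_cast
              gcongr
          _ = _ := by simp
    _ = ENNReal.ofReal ((1 + 2 * K.size) * ∑ j ∈ Finset.range (numLevels α M δ), (2 : ℝ) ^ j) := by
        rw [Finset.mul_sum, ENNReal.ofReal_sum_of_nonneg fun j _ => by positivity]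
        refine Finset.sum_congr rfl fun j _ => ?_
        rw [ENNReal.ofReal_mul (by positivity), mul_comm (ENNReal.ofReal _)]
        simp
    _ ≤ _ := by
        refine ENNReal.ofReal_le_ofReal ?_
        gcongr
        exact sum_two_pow_numLevels_le hα hM hδ

/-! ### The sets of machines -/

theorem card_filter_machineNo_le (m a b : ℕ) :
    (Finset.univ.filter fun i : Fin m => a ≤ machineNo i ∧ machineNo i ≤ b).card ≤ b + 1 - a := by
  rw [← Nat.card_Icc]
  refine Finset.card_le_card_of_injOn machineNo (fun i hi => ?_) (fun i _ j _ h => ?_)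
  · simpa using hi
  · exact Fin.ext (by simpa [machineNo] using h)

theorem card_filter_machineNo {m a b : ℕ} (ha : 1 ≤ a) (hb : b ≤ m) :
    (Finset.univ.filter fun i : Fin m => a ≤ machineNo i ∧ machineNo i ≤ b).card = b + 1 - a := by
  refine le_antisymm (card_filter_machineNo_le m a b) ?_
  rw [← Nat.card_Icc]
  refine Finset.card_le_card_of_surjOn machineNo fun n hn => ?_
  rw [Finset.mem_coe, Finset.mem_Icc] at hn
  exact ⟨⟨n - 1, by lia⟩, by simp [machineNo]; lia, by simp [machineNo]; lia⟩

theorem finerMachines_eq {m : ℕ} {u : ℝ} (hu : 0 ≤ u) :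
    finerMachines m u = Finset.univ.filter fun i : Fin m =>
      2 ≤ machineNo i ∧ machineNo i ≤ min (1 + finerCount u) ⌊u⌋₊ := by
  ext i
  simp only [finerMachines, Finset.mem_filter, Finset.mem_univ, true_and, le_min_iff,
    Nat.le_floor_iff hu]

theorem refinementMachines_eq {m : ℕ} {u : ℝ} (hu : 0 ≤ u) :
    refinementMachines m u = Finset.univ.filter fun i : Fin m =>
      2 + finerCount u ≤ machineNo i ∧ machineNo i ≤ ⌊u⌋₊ := by
  ext i
  simp only [refinementMachines, Finset.mem_filter, Finset.mem_univ, true_and, Nat.le_floor_iff hu]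

theorem card_finerMachines_le {m : ℕ} {u : ℝ} (hu : 0 ≤ u) :
    ((finerMachines m u).card : ℝ) ≤ Real.logb 2 u ^ 2 := by
  have h : (finerMachines m u).card ≤ finerCount u := by
    rw [finerMachines_eq hu]
    refine (card_filter_machineNo_le _ _ _).trans ?_
    lia
  exact (Nat.cast_le.2 h).trans (Nat.floor_le (sq_nonneg _))

theorem card_refinementMachines_le {m : ℕ} {u : ℝ} (hu : 0 ≤ u) :
    ((refinementMachines m u).card : ℝ) ≤ u := by
  have h : (refinementMachines m u).card ≤ ⌊u⌋₊ := by
    rw [refinementMachines_eq hu]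
    refine (card_filter_machineNo_le _ _ _).trans ?_
    lia
  exact (Nat.cast_le.2 h).trans (Nat.floor_le hu)

theorem zero_notMem_finerMachines {m : ℕ} [NeZero m] (u : ℝ) : (0 : Fin m) ∉ finerMachines m u := by
  simp [finerMachines, machineNo]

theorem zero_notMem_refinementMachines {m : ℕ} [NeZero m] (u : ℝ) :
    (0 : Fin m) ∉ refinementMachines m u := by
  simp [refinementMachines, machineNo]
  lia

theorem notMem_finerMachines_of_mem {m : ℕ} {u : ℝ} {i : Fin m} (hi : i ∈ refinementMachines m u) :
    i ∉ finerMachines m u := by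
  simp only [refinementMachines, finerMachines, Finset.mem_filter, Finset.mem_univ,
    true_and] at hi ⊢
  lia

theorem measurable_machineSymbol {m : ℕ} [NeZero m] {u : ℝ} {i : Fin m} {f : ℝ → ℤ}
    (h : machineSymbol m u i = some f) : Measurable f := by
  unfold machineSymbol at h
  split_ifs at h <;> simp only [Option.some.injEq] at h <;> subst h
  · exact Int.measurable_floor
  · exact (measurable_of_countable fun n : ℤ => n % (modulus u : ℤ)).comp Int.measurable_floor
  · exact (measurable_of_countable fun n : ℤ => n % 8).comp Int.measurable_floor

/-! ### The protocols respect the budget -/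

theorem uniquelyDecodable_crudeProtocol (m : ℕ) [NeZero m] (δ : ℝ) (N : ℕ) (i : Fin m) :
    (∀ x, (crudeProtocol m δ N).enc i x = []) ∨
      InformationTheory.UniquelyDecodable (Set.range ((crudeProtocol m δ N).enc i)) := by
  by_cases hi : i = 0
  · rcases Nat.eq_zero_or_pos N with rfl | hN
    · exact Or.inl fun x => by simp [crudeProtocol, hi, encodeBlock_zero]
    · right
      simp only [crudeProtocol, hi, if_true]
      exact uniquelyDecodable_range_encodeBlock hN.ne' _
  · exact Or.inl fun x => by simp [crudeProtocol, hi]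

theorem uniquelyDecodable_refinedProtocol (m : ℕ) [NeZero m] (sel : Finset ℤ → ℤ) (σ u : ℝ) (N : ℕ)
    (i : Fin m) :
    (∀ x, (refinedProtocol m sel σ u N).enc i x = []) ∨
      InformationTheory.UniquelyDecodable (Set.range ((refinedProtocol m sel σ u N).enc i)) := by
  rcases h : machineSymbol m u i with _ | f
  · exact Or.inl fun x => by simp [refinedProtocol, h]
  · rcases Nat.eq_zero_or_pos N with rfl | hN
    · exact Or.inl fun x => by simp [refinedProtocol, h, encodeBlock_zero]
    · right
      simp only [refinedProtocol, h]
      exact uniquelyDecodable_range_encodeBlock hN.ne' _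

theorem measurable_length_enc {m : ℕ} (P : Protocol m) (i : Fin m) :
    Measurable fun X : Fin m → Seq => ((P.enc i (X i)).length : ℝ≥0∞) := by
  let _ : MeasurableSpace (List Bool) := ⊤
  have h1 : Measurable fun w : List Bool => (w.length : ℝ≥0∞) := measurable_from_top
  exact h1.comp ((P.measurable_enc i).comp (measurable_pi_apply i))

theorem expectedCost_eq_sum {m : ℕ} (P : Protocol m) (σ : ℝ) (θ : Seq) :
    P.expectedCost σ θ = ∑ i, ∫⁻ X, ((P.enc i (X i)).length : ℝ≥0∞) ∂(dataLaw m σ θ) := by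
  simp only [Protocol.expectedCost, Protocol.cost, Nat.cast_sum]
  exact lintegral_finsetSum _ fun i _ => measurable_length_enc P i

theorem expectedCost_crudeProtocol_le {m : ℕ} [NeZero m] {α M σ δ : ℝ} {p q : ℝ≥0∞} (hα : 0 < α)
    (hM : 0 < M) (hσ : 0 < σ) (hσδ : σ ≤ δ) (hp : 0 < p) (hq : 0 < q) (hs : 0 < besovIndex α p)
    {θ : Seq} (hθ : θ ∈ besovBall α p q M) :
    (crudeProtocol m δ (numLevels α M δ)).expectedCost σ θ ≤
      ENNReal.ofReal ((12 * α + 22) * (M / δ) ^ (1 / (α + 1 / 2))) := by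
  rw [expectedCost_eq_sum, Finset.sum_eq_single_of_mem 0 (Finset.mem_univ _)]
  · simp only [crudeProtocol, if_true]
    exact lintegral_length_encodeBlock_floor_le hα hM hσ (hσ.trans_le hσδ) hσδ le_rfl hp hq hs hθ 0
  · intro i _ hi
    simp [crudeProtocol, hi]

theorem modulus_pos (u : ℝ) : 0 < modulus u := lt_max_of_lt_left one_pos

theorem natAbs_emod_le (n : ℤ) {L : ℕ} (hL : 0 < L) : (n % (L : ℤ)).natAbs ≤ L - 1 := by
  have h1 := Int.emod_nonneg n (b := (L : ℤ)) (by lia)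
  have h2 := Int.emod_lt_of_pos n (b := (L : ℤ)) (by lia)
  lia

theorem expectedCost_refinedProtocol_le {m : ℕ} [NeZero m] (sel : Finset ℤ → ℤ) {α M σ δ u : ℝ}
    {p q : ℝ≥0∞} (hα : 0 < α) (hM : 0 < M) (hσ : 0 < σ) (hδ : 0 < δ) (hδσ : δ ≤ σ) (hp : 0 < p)
    (hq : 0 < q) (hs : 0 < besovIndex α p) {θ : Seq} (hθ : θ ∈ besovBall α p q M) :
    (refinedProtocol m sel σ u (numLevels α M δ)).expectedCost σ θ ≤
      ENNReal.ofReal ((12 * α + 22 + 2 * (finerMachines m u).card * (1 + 2 * (modulus u - 1).size) +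
        14 * (refinementMachines m u).card) * (M / δ) ^ (1 / (α + 1 / 2))) := by
  set T := (M / δ) ^ (1 / (α + 1 / 2)) with hT
  have hT0 : 0 ≤ T := by positivity
  set b : ℝ := (1 + 2 * (modulus u - 1).size) * (2 * T) with hb
  have hb0 : 0 ≤ b := by positivity
  rw [expectedCost_eq_sum]
  have hi : ∀ i : Fin m,
      ∫⁻ X, (((refinedProtocol m sel σ u (numLevels α M δ)).enc i (X i)).length : ℝ≥0∞)
        ∂(dataLaw m σ θ) ≤
      (if i = 0 then ENNReal.ofReal ((12 * α + 22) * T) else 0) +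
        (if i ∈ finerMachines m u then ENNReal.ofReal b else 0) +
        (if i ∈ refinementMachines m u then ENNReal.ofReal (14 * T) else 0) := by
    intro i
    by_cases h0 : i = 0
    · subst h0
      have hsym : machineSymbol m u 0 = some fun x => ⌊x⌋ := by simp [machineSymbol]
      simp only [refinedProtocol, hsym, if_true, add_assoc]
      exact (lintegral_length_encodeBlock_floor_le hα hM hσ hδ le_rfl hδσ hp hq hs hθ 0).trans
        le_self_add
    by_cases h1 : i ∈ finerMachines m u
    · have hsym : machineSymbol m u i = some fun x => ⌊x⌋ % (modulus u : ℤ) := by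
        simp [machineSymbol, h0, h1]
      simp only [refinedProtocol, hsym, h0, h1, if_true, if_false, zero_add]
      refine (lintegral_length_encodeBlock_bounded_le hα hM hδ θ i
        (f := fun x => ⌊x / σ⌋ % (modulus u : ℤ)) ?_ (K := modulus u - 1) ?_).trans le_self_add
      · exact (measurable_machineSymbol hsym).comp (measurable_id.div_const σ)
      · exact fun x => natAbs_emod_le _ (modulus_pos u)
    by_cases h2 : i ∈ refinementMachines m u
    · have hsym : machineSymbol m u i = some fun x => ⌊x⌋ % 8 := by
        simp [machineSymbol, h0, h1, h2]
      simp only [refinedProtocol, hsym, h0, h1, h2, if_true, if_false, zero_add]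
      refine (lintegral_length_encodeBlock_bounded_le hα hM hδ θ i
        (f := fun x => ⌊x / σ⌋ % 8) ?_ (K := 7) ?_).trans (le_of_eq ?_)
      · exact (measurable_machineSymbol hsym).comp (measurable_id.div_const σ)
      · exact fun x => natAbs_emod_le _ (L := 8) (by norm_num)
      · have : Nat.size 7 = 3 := by decide
        rw [this]; congr 1; push_cast; ring
    · have hsym : machineSymbol m u i = none := by simp [machineSymbol, h0, h1, h2]
      simp [refinedProtocol, hsym]
  refine (Finset.sum_le_sum fun i _ => hi i).trans (le_of_eq ?_)
  rw [Finset.sum_add_distrib, Finset.sum_add_distrib, Finset.sum_ite_eq' Finset.univ (0 : Fin m),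
    if_pos (Finset.mem_univ _), Finset.sum_ite_mem, Finset.sum_ite_mem, Finset.univ_inter,
    Finset.univ_inter, Finset.sum_const, Finset.sum_const, ← ENNReal.ofReal_nsmul,
    ← ENNReal.ofReal_nsmul, ← ENNReal.ofReal_add (by positivity) (by positivity),
    ← ENNReal.ofReal_add (by positivity) (by positivity)]
  congr 1
  rw [nsmul_eq_mul, nsmul_eq_mul, hb]
  ring

theorem logb_two_le_mul_rpow {u : ℝ} (hu : 1 ≤ u) :
    Real.logb 2 u ≤ 8 / 5 * u ^ (1 / 3 : ℝ) := by
  have hu0 : 0 < u := by linarith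
  set w := u ^ (1 / 3 : ℝ) with hw
  have hw0 : 0 < w := by positivity
  have h1 : Real.log u = 3 * Real.log w := by rw [hw, Real.log_rpow hu0]; ring
  have h2 := Real.log_le_sub_one_of_pos (x := w / Real.exp 1) (by positivity)
  rw [Real.log_div hw0.ne' (Real.exp_ne_zero _), Real.log_exp] at h2
  have h3 : w / Real.exp 1 ≤ w / 2.718 := by
    gcongr; linarith [Real.exp_one_gt_d9]
  have h4 := Real.log_two_gt_d9
  rw [Real.logb, div_le_iff₀ (by linarith), h1]
  have h5 : w / 2.718 = 500 / 1359 * w := by ring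
  nlinarith

/-- The cost of the finer localization strings is linear in `u`. -/
theorem card_finerMachines_mul_size_le {m : ℕ} {u : ℝ} (hu : 1 ≤ u) :
    ((finerMachines m u).card : ℝ) * (1 + 2 * (modulus u - 1).size) ≤ 14 * u := by
  have hu0 : 0 < u := by linarith
  have hL0 : 0 ≤ Real.logb 2 u := Real.logb_nonneg (by norm_num) hu
  have hsize : ((modulus u - 1).size : ℝ) ≤ Real.logb 2 u := by
    have h1 : (modulus u - 1).size ≤ modulus u - 1 := Nat.size_le.2 Nat.lt_two_pow_self
    have h2 : modulus u - 1 ≤ ⌊Real.logb 2 u⌋₊ := by unfold modulus; lia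
    exact (Nat.cast_le.2 (h1.trans h2)).trans (Nat.floor_le hL0)
  have hcard := card_finerMachines_le (m := m) hu0.le
  have hw := logb_two_le_mul_rpow hu
  set L := Real.logb 2 u
  set w := u ^ (1 / 3 : ℝ) with hw_def
  have hw1 : 1 ≤ w := Real.one_le_rpow hu (by norm_num)
  have hw3 : w ^ 3 = u := by
    rw [hw_def, ← Real.rpow_natCast, ← Real.rpow_mul hu0.le]; norm_num
  calc ((finerMachines m u).card : ℝ) * (1 + 2 * (modulus u - 1).size) ≤ L ^ 2 * (1 + 2 * L) := by
        gcongr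
    _ ≤ (8 / 5 * w) ^ 2 * (1 + 2 * (8 / 5 * w)) := by gcongr
    _ ≤ (8 / 5 * w) ^ 2 * (w + 2 * (8 / 5 * w)) := by gcongr
    _ = 1344 / 125 * w ^ 3 := by ring
    _ ≤ 14 * u := by rw [hw3]; linarith

theorem rpow_inv_gt_of_tuning {α Λ₀ : ℝ} (hα : 0 < α) (hΛ : (24 * α + 64) ^ (α + 1 / 2) < Λ₀) :
    24 * α + 64 < Λ₀ ^ (1 / (α + 1 / 2)) := by
  have hs : 0 < α + 1 / 2 := by linarith
  rw [one_div]
  have h0 : (0 : ℝ) ≤ (24 * α + 64) ^ (α + 1 / 2) := by positivity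
  rwa [Real.lt_rpow_inv_iff_of_pos (by positivity) (h0.trans hΛ.le) hs]

theorem one_lt_of_tuning {α Λ₀ : ℝ} (hα : 0 < α) (hΛ : (24 * α + 64) ^ (α + 1 / 2) < Λ₀) :
    1 < Λ₀ :=
  lt_of_le_of_lt (Real.one_le_rpow (by linarith) (by linarith)) hΛ

theorem rpow_div_crude_step {α Λ₀ M B : ℝ} (hα : 0 < α) (hΛ : 0 < Λ₀) (hM : 0 < M) (hB : 0 < B) :
    (M / (Λ₀ * M * B ^ (-(α + 1 / 2)))) ^ (1 / (α + 1 / 2)) = B / Λ₀ ^ (1 / (α + 1 / 2)) := by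
  have hs : 0 < α + 1 / 2 := by linarith
  have h1 : M / (Λ₀ * M * B ^ (-(α + 1 / 2))) = B ^ (α + 1 / 2) / Λ₀ := by
    rw [Real.rpow_neg hB.le]
    field_simp
  rw [h1, Real.div_rpow (by positivity) hΛ.le, ← Real.rpow_mul hB.le, mul_one_div_cancel hs.ne',
    Real.rpow_one]

theorem lt_crude_step {α Λ₀ M σ B : ℝ} (hα : 0 < α) (hΛ : 0 < Λ₀) (hM : 0 < M) (hσ : 0 < σ)
    (hB : 0 < B) (h : B < (Λ₀ * M / σ) ^ (2 / (2 * α + 1))) :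
    σ < Λ₀ * M * B ^ (-(α + 1 / 2)) := by
  have hs : 0 < α + 1 / 2 := by linarith
  have h1 : 2 / (2 * α + 1) = (α + 1 / 2)⁻¹ := by field_simp
  rw [h1, Real.lt_rpow_inv_iff_of_pos hB.le (by positivity) hs, lt_div_iff₀ hσ] at h
  rw [Real.rpow_neg hB.le, ← div_eq_mul_inv, lt_div_iff₀ (by positivity), mul_comm]
  exact h

theorem one_le_effectiveMachines {m : ℕ} [NeZero m] {α Λ₀ M σ B : ℝ} (hα : 0 < α) (hΛ : 0 < Λ₀)
    (hM : 0 < M) (hσ : 0 < σ) (h : (Λ₀ * M / σ) ^ (2 / (2 * α + 1)) ≤ B) :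
    1 ≤ effectiveMachines m α M σ B Λ₀ := by
  have hm : 1 ≤ m := NeZero.one_le
  refine le_min ?_ (by exact_mod_cast hm)
  have hA : 0 < Λ₀ * M / σ := by positivity
  set A := Λ₀ * M / σ
  calc (1 : ℝ) = A ^ (-1 / (α + 1)) * (A ^ (2 / (2 * α + 1))) ^ ((2 * α + 1) / (2 * α + 2)) := by
        rw [← Real.rpow_mul hA.le, ← Real.rpow_add hA]
        have : -1 / (α + 1) + 2 / (2 * α + 1) * ((2 * α + 1) / (2 * α + 2)) = 0 := by
          field_simp; ring
        rw [this, Real.rpow_zero]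
    _ ≤ _ := by gcongr

/-- The number of effective machines is chosen so that `u` times the number of coefficients is a
small multiple of `B`. -/
theorem effectiveMachines_mul_le {m : ℕ} [NeZero m] {α Λ₀ M σ B : ℝ} (hα : 0 < α) (hΛ : 0 < Λ₀)
    (hM : 0 < M) (hσ : 0 < σ) (hB : 0 < B) (h : (Λ₀ * M / σ) ^ (2 / (2 * α + 1)) ≤ B) :
    effectiveMachines m α M σ B Λ₀ *
        (M / (σ / √(effectiveMachines m α M σ B Λ₀))) ^ (1 / (α + 1 / 2)) ≤
      B / Λ₀ ^ (1 / (α + 1 / 2)) := by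
  have hu1 := one_le_effectiveMachines (m := m) hα hΛ hM hσ h
  have hule : effectiveMachines m α M σ B Λ₀ ≤ (Λ₀ * M / σ) ^ (-1 / (α + 1)) *
    B ^ ((2 * α + 1) / (2 * α + 2)) := min_le_left _ _
  set u := effectiveMachines m α M σ B Λ₀
  have hu0 : 0 < u := by linarith
  have hs : 0 < α + 1 / 2 := by linarith
  have hMσ : 0 < M / σ := by positivity
  set e := 1 / (α + 1 / 2) with he
  have h1 : M / (σ / √u) = M / σ * u ^ (1 / 2 : ℝ) := by
    rw [← Real.sqrt_eq_rpow]; field_simp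
  have h2 : u * (M / (σ / √u)) ^ e = (M / σ) ^ e * u ^ ((2 * α + 2) / (2 * α + 1)) := by
    rw [h1, Real.mul_rpow hMσ.le (by positivity), ← Real.rpow_mul hu0.le, mul_left_comm]
    congr 1
    rw [← Real.rpow_one_add' hu0.le (by positivity)]
    congr 1
    rw [he]; field_simp; ring
  rw [h2]
  calc (M / σ) ^ e * u ^ ((2 * α + 2) / (2 * α + 1))
      ≤ (M / σ) ^ e * ((Λ₀ * M / σ) ^ (-1 / (α + 1)) *
          B ^ ((2 * α + 1) / (2 * α + 2))) ^ ((2 * α + 2) / (2 * α + 1)) := by gcongr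
    _ = (M / σ) ^ e * ((Λ₀ * (M / σ)) ^ (-e) * B) := by
        rw [Real.mul_rpow (by positivity) (by positivity), ← Real.rpow_mul (by positivity),
          ← Real.rpow_mul hB.le, mul_div_assoc Λ₀]
        have e1 : (2 * α + 1) / (2 * α + 2) * ((2 * α + 2) / (2 * α + 1)) = 1 := by field_simp
        have e2 : -1 / (α + 1) * ((2 * α + 2) / (2 * α + 1)) = -e := by
          rw [he]; field_simp
        rw [e1, e2, Real.rpow_one]
    _ = _ := by
        rw [Real.mul_rpow hΛ.le hMσ.le, Real.rpow_neg hMσ.le, Real.rpow_neg hΛ.le]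
        have : 0 < (M / σ) ^ e := by positivity
        field_simp

theorem seqModgame_mem_budgetClass {α Λ₀ : ℝ} (hα : 0 < α)
    (hΛ : (24 * α + 64) ^ (α + 1 / 2) < Λ₀) (m : ℕ) [NeZero m] (sel : Finset ℤ → ℤ) {σ M B : ℝ}
    (hσ : 0 < σ) (hM : 0 < M) (hB : 0 < B) {p q : ℝ≥0∞} (hp : 0 < p) (hq : 0 < q)
    (hs : 0 < besovIndex α p) :
    seqModgame m sel α M σ B Λ₀ ∈ budgetClass m σ B (besovBall α p q M) := by
  have hΛ0 : 0 < Λ₀ := one_pos.trans (one_lt_of_tuning hα hΛ)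
  have htune := rpow_inv_gt_of_tuning hα hΛ
  have hsmall : (24 * α + 64) * (B / Λ₀ ^ (1 / (α + 1 / 2))) ≤ B := by
    rw [mul_div_assoc', div_le_iff₀ (by positivity), mul_comm]
    gcongr
  unfold seqModgame
  split_ifs with hcase
  · have hstep := lt_crude_step hα hΛ0 hM hσ hB hcase
    refine ⟨uniquelyDecodable_crudeProtocol m _ _, iSup₂_le fun θ hθ => ?_⟩
    refine (expectedCost_crudeProtocol_le hα hM hσ hstep.le hp hq hs hθ).trans
      (ENNReal.ofReal_le_ofReal ?_)
    rw [rpow_div_crude_step hα hΛ0 hM hB]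
    refine le_trans ?_ hsmall
    gcongr <;> linarith
  · rw [not_lt] at hcase
    have hu1 := one_le_effectiveMachines (m := m) hα hΛ0 hM hσ hcase
    have hbudget := effectiveMachines_mul_le (m := m) hα hΛ0 hM hσ hB hcase
    refine ⟨uniquelyDecodable_refinedProtocol m sel σ _ _, iSup₂_le fun θ hθ => ?_⟩
    simp only
    set u := effectiveMachines m α M σ B Λ₀
    have hu0 : 0 < u := by linarith
    have hδσ : σ / √u ≤ σ := div_le_self hσ.le (Real.one_le_sqrt.2 hu1)
    refine (expectedCost_refinedProtocol_le sel hα hM hσ (by positivity) hδσ hp hq hs hθ).trans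
      (ENNReal.ofReal_le_ofReal ?_)
    have h1 := card_finerMachines_mul_size_le (m := m) hu1
    have h2 := card_refinementMachines_le (m := m) hu0.le
    set T := (M / (σ / √u)) ^ (1 / (α + 1 / 2))
    have hT : 0 ≤ T := by positivity
    calc _ ≤ ((24 * α + 64) * u) * T := by
          gcongr
          nlinarith
      _ = (24 * α + 64) * (u * T) := by ring
      _ ≤ (24 * α + 64) * (B / Λ₀ ^ (1 / (α + 1 / 2))) := by gcongr
      _ ≤ B := hsmall

/-! ### The function that refinement inverts -/

/-- The standard normal density up to its normalization. -/
def bell (w : ℝ) : ℝ := Real.exp (-(w ^ 2 / 2))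

theorem continuous_bell : Continuous bell := by unfold bell; fun_prop

theorem bell_pos (w : ℝ) : 0 < bell w := Real.exp_pos _

theorem gaussianPDFReal_eq_bell (w y : ℝ) :
    gaussianPDFReal y 1 w = (√(2 * Real.pi))⁻¹ * bell (w - y) := by
  simp [gaussianPDFReal, bell, neg_div]

theorem gaussianPDFReal_eq_exp_mul (w y : ℝ) :
    gaussianPDFReal y 1 w =
      gaussianPDFReal 0 1 w * (Real.exp (-(y ^ 2 / 2)) * Real.exp (y * w)) := by
  rw [gaussianPDFReal_eq_bell, gaussianPDFReal_eq_bell, bell, bell, mul_assoc, ← Real.exp_add,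
    ← Real.exp_add]
  congr 2; ring

/-- The event, for an observation, on which a refinement machine reports the residue of
`x - 2`. -/
def residueSet (x : ℤ) : Set ℝ := {w | ⌊w⌋ % 8 = (x - 2) % 8}

theorem measurableSet_residueSet (x : ℤ) : MeasurableSet (residueSet x) :=
  (measurable_of_countable fun n : ℤ => n % 8).comp Int.measurable_floor (measurableSet_singleton _)

theorem residueSet_eq_iUnion (x : ℤ) :
    residueSet x = ⋃ l : ℤ, Set.Ico ((x : ℝ) - 2 + 8 * (l : ℝ)) ((x : ℝ) - 1 + 8 * (l : ℝ)) := by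
  ext w
  have h : ∀ l : ℤ, w ∈ Set.Ico ((x : ℝ) - 2 + 8 * (l : ℝ)) ((x : ℝ) - 1 + 8 * (l : ℝ)) ↔
      ⌊w⌋ = x - 2 + 8 * l := by
    intro l
    rw [Int.floor_eq_iff, Set.mem_Ico]
    push_cast
    constructor <;> rintro ⟨h1, h2⟩ <;> constructor <;> linarith
  simp only [residueSet, Set.mem_ofPred_eq, Set.mem_iUnion, h]
  constructor
  · intro h
    exact ⟨(⌊w⌋ - (x - 2)) / 8, by lia⟩
  · rintro ⟨l, hl⟩
    lia

theorem hasSum_refineFn (x : ℤ) (y : ℝ) :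
    HasSum (fun l : ℤ => ∫ w in ((x : ℝ) - 2 + 8 * (l : ℝ))..((x : ℝ) - 1 + 8 * (l : ℝ)),
      gaussianPDFReal 0 1 (w - y)) ((gaussianReal y 1).real (residueSet x)) := by
  have h1 : (gaussianReal y 1).real (residueSet x) =
      ∫ w in residueSet x, gaussianPDFReal y 1 w := by
    rw [Measure.real, gaussianReal_apply_eq_integral y one_ne_zero,
      ENNReal.toReal_ofReal (integral_nonneg fun _ => gaussianPDFReal_nonneg _ _ _)]
  rw [h1, residueSet_eq_iUnion]
  have h2 := hasSum_integral_iUnion (μ := volume) (f := gaussianPDFReal y 1)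
    (s := fun l : ℤ => Set.Ico ((x : ℝ) - 2 + 8 * (l : ℝ)) ((x : ℝ) - 1 + 8 * (l : ℝ)))
    (fun l => measurableSet_Ico) ?_ (integrable_gaussianPDFReal y 1).integrableOn
  · refine (funext fun l => ?_ :
      (fun l : ℤ => ∫ w in ((x : ℝ) - 2 + 8 * (l : ℝ))..((x : ℝ) - 1 + 8 * (l : ℝ)),
        gaussianPDFReal 0 1 (w - y)) = _) ▸ h2
    rw [intervalIntegral.integral_of_le (by linarith), integral_Ico_eq_integral_Ioc]
    simp only [gaussianPDFReal_sub, zero_add]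
  · intro l l' hl
    refine Set.disjoint_left.2 fun w hw hw' => hl ?_
    have e1 : ⌊w⌋ = x - 2 + 8 * l := by
      rw [Int.floor_eq_iff]; push_cast; constructor <;> linarith [hw.1, hw.2]
    have e2 : ⌊w⌋ = x - 2 + 8 * l' := by
      rw [Int.floor_eq_iff]; push_cast; constructor <;> linarith [hw'.1, hw'.2]
    lia

/-- `refineFn x y` is the probability that a refinement machine reports the residue of `x - 2` when
the rescaled coefficient is `y`. -/
theorem refineFn_eq_real (x : ℤ) (y : ℝ) :
    refineFn x y = (gaussianReal y 1).real (residueSet x) :=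
  (hasSum_refineFn x y).tsum_eq

theorem continuous_refineFn (x : ℤ) : Continuous (refineFn x) := by
  -- up to the factor `exp (-y² / 2)` this is a moment generating function
  have h : refineFn x = fun y => Real.exp (-(y ^ 2 / 2)) *
      mgf id ((gaussianReal 0 1).restrict (residueSet x)) y := by
    ext y
    rw [refineFn_eq_real, Measure.real, gaussianReal_apply_eq_integral y one_ne_zero,
      ENNReal.toReal_ofReal (integral_nonneg fun _ => gaussianPDFReal_nonneg _ _ _), mgf,
      ← integral_const_mul, ← integral_indicator (measurableSet_residueSet x),
      ← integral_indicator (measurableSet_residueSet x),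
      integral_gaussianReal_eq_integral_smul one_ne_zero]
    congr 1
    ext w
    by_cases hw : w ∈ residueSet x
    · rw [Set.indicator_of_mem hw, Set.indicator_of_mem hw, gaussianPDFReal_eq_exp_mul, smul_eq_mul]
      rfl
    · simp [Set.indicator_of_notMem hw]
  rw [h]
  refine Continuous.mul (by fun_prop) (continuous_mgf fun t => ?_)
  exact (integrable_exp_mul_gaussianReal t).restrict

/-- One term of the difference `refineFn x t₁ - refineFn x t₂`, up to the normalization of the
density: shifting the interval of integration turns the difference over `t` into one over `w`. -/
def refineTerm (x : ℤ) (t₁ t₂ : ℝ) (l : ℤ) : ℝ :=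
  ∫ w in ((x : ℝ) - 2 + 8 * (l : ℝ) - t₂)..((x : ℝ) - 2 + 8 * (l : ℝ) - t₁),
    (bell (w + 1) - bell w)

theorem hasSum_refineTerm (x : ℤ) (t₁ t₂ : ℝ) :
    HasSum (fun l : ℤ => (√(2 * Real.pi))⁻¹ * refineTerm x t₁ t₂ l)
      (refineFn x t₁ - refineFn x t₂) := by
  rw [refineFn_eq_real, refineFn_eq_real]
  refine (funext fun l => ?_ : (fun l : ℤ => (√(2 * Real.pi))⁻¹ * refineTerm x t₁ t₂ l) = _) ▸
    (hasSum_refineFn x t₁).sub (hasSum_refineFn x t₂)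
  have hint : ∀ a b, IntervalIntegrable bell volume a b := fun a b =>
    continuous_bell.intervalIntegrable a b
  have hshift : ∀ a b, IntervalIntegrable (fun w => bell (w + 1)) volume a b := fun a b =>
    (continuous_bell.comp (continuous_id.add continuous_const)).intervalIntegrable a b
  simp only [gaussianPDFReal_eq_bell, sub_zero, intervalIntegral.integral_const_mul]
  rw [← mul_sub, refineTerm, intervalIntegral.integral_sub (hshift _ _) (hint _ _),
    intervalIntegral.integral_comp_add_right (fun w => bell w),
    intervalIntegral.integral_comp_sub_right (fun w => bell w),
    intervalIntegral.integral_comp_sub_right (fun w => bell w)]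
  congr 1
  set c : ℝ := (x : ℝ) - 2 + 8 * (l : ℝ)
  have e1 : (x : ℝ) - 1 + 8 * (l : ℝ) - t₁ = c - t₁ + 1 := by ring
  have e2 : (x : ℝ) - 1 + 8 * (l : ℝ) - t₂ = c - t₂ + 1 := by ring
  rw [e1, e2]
  have h1 := intervalIntegral.integral_add_adjacent_intervals (hint (c - t₂) (c - t₁))
    (hint (c - t₁) (c - t₁ + 1))
  have h2 := intervalIntegral.integral_add_adjacent_intervals (hint (c - t₂) (c - t₂ + 1))
    (hint (c - t₂ + 1) (c - t₁ + 1))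
  linarith

theorem bell_add_one_sub_nonneg {w : ℝ} (hw : w ≤ -1) : 0 ≤ bell (w + 1) - bell w := by
  unfold bell
  rw [sub_nonneg, Real.exp_le_exp]
  nlinarith

theorem bell_add_one_sub_ge {w : ℝ} (h1 : -4 ≤ w) (h2 : w ≤ -1) :
    3 * Real.exp (-8) ≤ bell (w + 1) - bell w := by
  have e1 : bell w = bell (w + 1) * Real.exp (w + 1 / 2) := by
    unfold bell; rw [← Real.exp_add]; congr 1; ring
  have e2 : Real.exp (-(9 / 2)) ≤ bell (w + 1) := by
    unfold bell; rw [Real.exp_le_exp]; nlinarith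
  have e3 : Real.exp (w + 1 / 2) ≤ 2 / 3 := by
    have h3 : Real.exp (w + 1 / 2) ≤ Real.exp (-(1 / 2)) := by rw [Real.exp_le_exp]; linarith
    rw [Real.exp_neg] at h3
    have h4 := Real.add_one_le_exp (1 / 2 : ℝ)
    refine h3.trans (inv_le_of_inv_le₀ (by norm_num) (by linarith))
  have e4 : Real.exp (-(9 / 2)) = Real.exp (-8) * Real.exp (7 / 2) := by
    rw [← Real.exp_add]; norm_num
  have e5 : 9 ≤ Real.exp (7 / 2) := by
    have := Real.quadratic_le_exp_of_nonneg (x := 7 / 2) (by norm_num)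
    linarith
  have e6 := Real.exp_pos (-8)
  have e7 := bell_pos (w + 1)
  calc 3 * Real.exp (-8) ≤ Real.exp (-8) * Real.exp (7 / 2) * (1 / 3) := by nlinarith
    _ ≤ bell (w + 1) * (1 - Real.exp (w + 1 / 2)) := by
        rw [← e4]; gcongr; linarith
    _ = _ := by rw [e1]; ring

theorem continuous_bell_add_one_sub : Continuous fun w => bell (w + 1) - bell w :=
  (continuous_bell.comp (continuous_id.add continuous_const)).sub continuous_bell

theorem mul_sub_le_refineTerm {x : ℤ} {t₁ t₂ : ℝ} {l : ℤ} (ht : t₁ ≤ t₂) {c : ℝ}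
    (h : ∀ w ∈ Set.Icc ((x : ℝ) - 2 + 8 * (l : ℝ) - t₂) ((x : ℝ) - 2 + 8 * (l : ℝ) - t₁),
      c ≤ bell (w + 1) - bell w) :
    c * (t₂ - t₁) ≤ refineTerm x t₁ t₂ l := by
  have h1 := intervalIntegral.integral_mono_on (μ := volume)
    (a := (x : ℝ) - 2 + 8 * (l : ℝ) - t₂) (b := (x : ℝ) - 2 + 8 * (l : ℝ) - t₁) (by linarith)
    intervalIntegrable_const (continuous_bell_add_one_sub.intervalIntegrable _ _) h
  rw [intervalIntegral.integral_const, smul_eq_mul] at h1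
  refine le_trans (le_of_eq ?_) h1
  ring

/-- On `[x - 1, x + 2]` the function `refineFn x` decreases at least linearly: the intervals with
`l ≤ 0` lose mass, the one with `l = 0` at a definite rate, while those with `l > 0` are at distance
at least `4` and gain little. -/
theorem refineFn_sub_ge {x : ℤ} {t₁ t₂ : ℝ} (h1 : (x : ℝ) - 1 ≤ t₁) (h12 : t₁ ≤ t₂)
    (h2 : t₂ ≤ (x : ℝ) + 2) :
    (√(2 * Real.pi))⁻¹ * Real.exp (-8) * (t₂ - t₁) ≤ refineFn x t₁ - refineFn x t₂ := by
  have hK : 0 < (√(2 * Real.pi))⁻¹ := by positivity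
  have hE := Real.exp_pos (-8)
  have hd : 0 ≤ t₂ - t₁ := by linarith
  have hsum : HasSum (refineTerm x t₁ t₂) (√(2 * Real.pi) * (refineFn x t₁ - refineFn x t₂)) := by
    have := (hasSum_refineTerm x t₁ t₂).mul_left (√(2 * Real.pi))
    have h0 : √(2 * Real.pi) ≠ 0 := by positivity
    simpa only [mul_inv_cancel_left₀ h0] using this
  -- a summable minorant of the terms
  set g : ℤ → ℝ := fun l => Int.rec (fun n => if n = 0 then 3 * Real.exp (-8) * (t₂ - t₁) else
    -(Real.exp (-8) * (1 / 2) ^ (n - 1) * (t₂ - t₁))) (fun _ => 0) l with hg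
  have hgsum : HasSum g (3 * Real.exp (-8) * (t₂ - t₁) - 2 * Real.exp (-8) * (t₂ - t₁) + 0) := by
    refine HasSum.int_rec ?_ hasSum_zero
    rw [sub_eq_add_neg]
    refine (hasSum_nat_add_iff' 1).1 ?_
    simp only [Finset.range_one, Finset.sum_singleton, if_true, Nat.add_eq_zero_iff, one_ne_zero,
      and_false, if_false, Nat.add_sub_cancel]
    have := (hasSum_geometric_two.mul_left (Real.exp (-8) * (t₂ - t₁))).neg
    convert this using 1
    · ext n; ring
    · ring
  have hle : ∀ l, g l ≤ refineTerm x t₁ t₂ l := by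
    intro l
    rcases l with n | n
    · simp only [hg]
      split_ifs with hn
      · refine mul_sub_le_refineTerm h12 fun w hw => bell_add_one_sub_ge ?_ ?_
        · have := hw.1; simp [hn] at this; linarith
        · have := hw.2; simp [hn] at this; linarith
      · rw [← neg_mul]
        refine mul_sub_le_refineTerm h12 fun w hw => ?_
        obtain ⟨k, rfl⟩ : ∃ k, n = k + 1 := ⟨n - 1, by lia⟩
        have hk : (0 : ℝ) ≤ k := by positivity
        have hw4 : 8 * (k : ℝ) + 4 ≤ w := by
          have := hw.1; simp at this; linarith
        have hb : bell w ≤ Real.exp (-8) * (1 / 2) ^ (k + 1 - 1) := by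
          have hhalf : Real.exp (-1) ≤ 1 / 2 := by
            rw [Real.exp_neg]
            refine inv_le_of_inv_le₀ (by norm_num) ?_
            linarith [Real.add_one_le_exp (1 : ℝ)]
          rw [Nat.add_sub_cancel]
          calc bell w ≤ Real.exp (-8 + k * (-1)) := by
                unfold bell; rw [Real.exp_le_exp]; nlinarith
            _ = Real.exp (-8) * Real.exp (-1) ^ k := by rw [Real.exp_add, ← Real.exp_nat_mul]
            _ ≤ _ := by gcongr
        linarith [bell_pos (w + 1)]
    · simp only [hg]
      have := mul_sub_le_refineTerm (x := x) (l := Int.negSucc n) h12 (c := 0) fun w hw =>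
        bell_add_one_sub_nonneg (by
          have := hw.2
          push_cast at this
          have hn0 : (0 : ℝ) ≤ n := by positivity
          linarith)
      linarith
  have hfin := hasSum_le hle hgsum hsum
  have hK' : 0 < √(2 * Real.pi) := by positivity
  rw [mul_assoc, inv_mul_le_iff₀ hK']
  nlinarith [mul_nonneg hE.le hd]

/-- A lower bound for the rate of decrease of `refineFn`. -/
def refineRate : ℝ := (√(2 * Real.pi))⁻¹ * Real.exp (-8)

theorem refineRate_pos : 0 < refineRate := by unfold refineRate; positivity

theorem exists_refineFn_eq {x : ℤ} {r : ℝ} (h1 : refineFn x (x + 2) < r)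
    (h2 : r < refineFn x (x - 1)) : ∃ y ∈ Set.Icc ((x : ℝ) - 1) (x + 2), refineFn x y = r :=
  intermediate_value_Icc' (by linarith) (continuous_refineFn x).continuousOn ⟨h1.le, h2.le⟩

theorem refinePoint_mem_Icc (x : ℤ) (r : ℝ) : refinePoint x r ∈ Set.Icc ((x : ℝ) - 1) (x + 2) := by
  unfold refinePoint
  split_ifs with h1 h2
  · constructor <;> linarith
  · constructor <;> linarith
  · exact Function.invFunOn_mem (exists_refineFn_eq (not_le.1 h1) (not_le.1 h2))

/-- The refined estimate is as precise as the observed frequency. -/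
theorem abs_refinePoint_sub_le {x : ℤ} {t : ℝ} (ht : t ∈ Set.Icc ((x : ℝ) - 1) (x + 2)) (r : ℝ) :
    |refinePoint x r - t| ≤ |r - refineFn x t| / refineRate := by
  rw [le_div_iff₀ refineRate_pos, mul_comm]
  have key : ∀ t₁ t₂ : ℝ, (x : ℝ) - 1 ≤ t₁ → t₁ ≤ t₂ → t₂ ≤ x + 2 →
      refineRate * (t₂ - t₁) ≤ refineFn x t₁ - refineFn x t₂ := fun _ _ => refineFn_sub_ge
  unfold refinePoint
  split_ifs with h1 h2
  · rw [abs_of_nonneg (by linarith [ht.2])]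
    have := key t (x + 2) ht.1 ht.2 le_rfl
    linarith [neg_abs_le (r - refineFn x t)]
  · rw [abs_of_nonpos (by linarith [ht.1])]
    have := key (x - 1) t le_rfl ht.1 ht.2
    linarith [le_abs_self (r - refineFn x t)]
  · have hex := exists_refineFn_eq (not_le.1 h1) (not_le.1 h2)
    have hmem := Function.invFunOn_mem hex
    have heq := Function.invFunOn_eq hex
    set y := Function.invFunOn (refineFn x) (Set.Icc ((x : ℝ) - 1) (x + 2)) r
    rcases le_total y t with hyt | hyt
    · rw [abs_of_nonpos (by linarith)]
      have := key y t hmem.1 hyt ht.2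
      linarith [le_abs_self (r - refineFn x t)]
    · rw [abs_of_nonneg (by linarith)]
      have := key t y ht.1 hyt hmem.2
      linarith [neg_abs_le (r - refineFn x t)]

/-! ### Probabilities for a single standardized error -/

theorem gaussianReal_eq_map_add (t : ℝ) :
    gaussianReal t 1 = (gaussianReal 0 1).map fun z => t + z := by
  rw [gaussianReal_map_const_add, zero_add]

theorem measureReal_preimage_residueSet (x : ℤ) (t : ℝ) :
    (gaussianReal 0 1).real ((fun z => t + z) ⁻¹' residueSet x) = refineFn x t := by
  rw [refineFn_eq_real, gaussianReal_eq_map_add t,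
    map_measureReal_apply (by fun_prop) (measurableSet_residueSet x)]

theorem bell_ge {w : ℝ} (hw : w ^ 2 ≤ 1) :
    1 - w ^ 2 / 2 + w ^ 4 / 8 - w ^ 6 / 36 ≤ bell w := by
  have h0 : 0 ≤ w ^ 2 := sq_nonneg w
  have h := Real.exp_bound (x := -(w ^ 2 / 2)) (by rw [abs_neg, abs_of_nonneg] <;> linarith)
    (n := 3) (by norm_num)
  rw [abs_neg, abs_of_nonneg (by linarith : 0 ≤ w ^ 2 / 2)] at h
  have h1 := (abs_le.1 h).1
  simp only [Finset.sum_range_succ, Finset.sum_range_zero, Nat.factorial] at h1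
  norm_num at h1
  unfold bell
  nlinarith

/-- Every interval of length one that contains the mean has probability larger than `1 / 3`. -/
theorem measureReal_Ico_ge {a : ℝ} (h1 : -1 ≤ a) (h2 : a ≤ 0) :
    338 / 1000 ≤ (gaussianReal 0 1).real (Set.Ico a (a + 1)) := by
  have hK : (398 / 1000 : ℝ) ≤ (√(2 * Real.pi))⁻¹ := by
    refine le_inv_of_le_inv₀ (by positivity) (Real.sqrt_le_iff.2 ⟨by norm_num, ?_⟩)
    have := Real.pi_lt_d4
    norm_num
    linarith
  have h : (gaussianReal 0 1).real (Set.Ico a (a + 1)) =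
      (√(2 * Real.pi))⁻¹ * ∫ w in a..(a + 1), bell w := by
    rw [Measure.real, gaussianReal_apply_eq_integral 0 one_ne_zero,
      ENNReal.toReal_ofReal (integral_nonneg fun _ => gaussianPDFReal_nonneg _ _ _),
      intervalIntegral.integral_of_le (by linarith), integral_Ico_eq_integral_Ioc,
      ← integral_const_mul]
    simp only [gaussianPDFReal_eq_bell, sub_zero]
  have hpoly : ∫ w in a..(a + 1), (1 - w ^ 2 / 2 + w ^ 4 / 8 - w ^ 6 / 36) =
      1 - ((a + 1) ^ 3 - a ^ 3) / 6 + ((a + 1) ^ 5 - a ^ 5) / 40 -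
        ((a + 1) ^ 7 - a ^ 7) / 252 := by
    have hd : ∀ w : ℝ, HasDerivAt (fun w : ℝ => w - w ^ 3 / 6 + w ^ 5 / 40 - w ^ 7 / 252)
        (1 - w ^ 2 / 2 + w ^ 4 / 8 - w ^ 6 / 36) w := by
      intro w
      have := (((hasDerivAt_id' w).sub ((hasDerivAt_pow 3 w).div_const 6)).add
        ((hasDerivAt_pow 5 w).div_const 40)).sub ((hasDerivAt_pow 7 w).div_const 252)
      refine this.congr_deriv ?_
      norm_num
      ring
    rw [intervalIntegral.integral_eq_sub_of_hasDerivAt (fun w _ => hd w)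
      (Continuous.intervalIntegrable (by fun_prop) _ _)]
    ring
  have hint : (85 / 100 : ℝ) ≤ ∫ w in a..(a + 1), bell w := by
    calc (85 / 100 : ℝ) ≤ _ := by
          -- in terms of `b = -a (1 + a)`, which lies in `[0, 1/4]`
          have hb0 : 0 ≤ -a * (1 + a) := mul_nonneg (by linarith) (by linarith)
          have hb1 : -a * (1 + a) ≤ 1 / 4 := by nlinarith [sq_nonneg (a + 1 / 2)]
          have hp : 1 - ((a + 1) ^ 3 - a ^ 3) / 6 + ((a + 1) ^ 5 - a ^ 5) / 40 -
              ((a + 1) ^ 7 - a ^ 7) / 252 = 1 - (1 - 3 * (-a * (1 + a))) / 6 +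
              (1 - 5 * (-a * (1 + a)) + 5 * (-a * (1 + a)) ^ 2) / 40 -
              (1 - 7 * (-a * (1 + a)) + 14 * (-a * (1 + a)) ^ 2 - 7 * (-a * (1 + a)) ^ 3) / 252 := by
            ring
          rw [hp]
          set b := -a * (1 + a)
          nlinarith [pow_nonneg hb0 3, sq_nonneg b]
      _ = _ := hpoly.symm
      _ ≤ _ := by
          refine intervalIntegral.integral_mono_on (by linarith)
            (Continuous.intervalIntegrable (by fun_prop) _ _)
            (continuous_bell.intervalIntegrable _ _) fun w hw => bell_ge ?_
          nlinarith [hw.1, hw.2]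
  rw [h]
  calc (338 / 1000 : ℝ) ≤ 398 / 1000 * (85 / 100) := by norm_num
    _ ≤ _ := by gcongr

theorem measurableSet_floor_eq (t : ℝ) : MeasurableSet {z : ℝ | ⌊t + z⌋ = ⌊t⌋} :=
  (Int.measurable_floor.comp (measurable_const_add t)) (measurableSet_singleton ⌊t⌋)

theorem measurableSet_one_le_abs : MeasurableSet {z : ℝ | 1 ≤ |z|} :=
  measurableSet_le measurable_const (by fun_prop)

/-- The cell of the mean is more likely than all observations at distance at least one from the
mean together. -/
theorem measureReal_one_le_abs_le (t : ℝ) :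
    (gaussianReal 0 1).real {z : ℝ | 1 ≤ |z|} + 14 / 1000 ≤
      (gaussianReal 0 1).real {z : ℝ | ⌊t + z⌋ = ⌊t⌋} := by
  have h1 : {z : ℝ | ⌊t + z⌋ = ⌊t⌋} = Set.Ico (⌊t⌋ - t) (⌊t⌋ - t + 1) := by
    ext z
    simp only [Set.mem_ofPred_eq, Int.floor_eq_iff, Set.mem_Ico]
    constructor <;> rintro ⟨h1, h2⟩ <;> constructor <;> linarith
  have h2 := measureReal_Ico_ge (a := ⌊t⌋ - t) (by linarith [Int.lt_floor_add_one t])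
    (by linarith [Int.floor_le t])
  have h3 : 338 / 1000 ≤ (gaussianReal 0 1).real (Set.Ico (-1 : ℝ) 0) := by
    simpa using measureReal_Ico_ge (a := -1) le_rfl (by norm_num)
  have h4 : 338 / 1000 ≤ (gaussianReal 0 1).real (Set.Ico (0 : ℝ) 1) := by
    simpa using measureReal_Ico_ge (a := 0) (by norm_num) le_rfl
  have h5 : (gaussianReal 0 1).real ((Set.Ico (-1 : ℝ) 0 ∪ Set.Ico (0 : ℝ) 1) ∪
      {z : ℝ | 1 ≤ |z|} \ {-1}) ≤ 1 := measureReal_le_one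
  have hdisj1 : Disjoint (Set.Ico (-1 : ℝ) 0) (Set.Ico (0 : ℝ) 1) :=
    Set.disjoint_left.2 fun z hz hz' => by have := hz.2; have := hz'.1; linarith
  have hdisj2 : Disjoint (Set.Ico (-1 : ℝ) 0 ∪ Set.Ico (0 : ℝ) 1)
      ({z : ℝ | 1 ≤ |z|} \ {-1}) := by
    refine Set.disjoint_left.2 fun z hz hz' => hz'.2 ?_
    have h6 : 1 ≤ |z| := hz'.1
    rw [Set.mem_singleton_iff]
    rcases hz with hz | hz
    · rw [abs_of_nonpos (by linarith [hz.2])] at h6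
      linarith [hz.1]
    · rw [abs_of_nonneg hz.1] at h6
      linarith [hz.2]
  have hnull : (gaussianReal 0 1).real ({z : ℝ | 1 ≤ |z|} \ {-1}) =
      (gaussianReal 0 1).real {z : ℝ | 1 ≤ |z|} := by
    have := nullSingletonClass_gaussianReal (μ := 0) (v := 1) one_ne_zero
    rw [Measure.real, Measure.real, measure_sdiff_null (measure_singleton _)]
  rw [measureReal_union hdisj2 (measurableSet_one_le_abs.diff (measurableSet_singleton _)),
    measureReal_union hdisj1 measurableSet_Ico, hnull] at h5
  rw [h1]
  linarith

/-- The score of a finer localization machine: positive if it is misleading, negative if it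
reports the cell of the mean. -/
def localizationScore (t z : ℝ) : ℝ :=
  Set.indicator {z : ℝ | 1 ≤ |z|} 1 z - Set.indicator {z : ℝ | ⌊t + z⌋ = ⌊t⌋} 1 z

theorem abs_localizationScore_le (t z : ℝ) : |localizationScore t z| ≤ 1 := by
  unfold localizationScore
  by_cases h1 : z ∈ {z : ℝ | 1 ≤ |z|} <;> by_cases h2 : z ∈ {z : ℝ | ⌊t + z⌋ = ⌊t⌋} <;>
    simp [Set.indicator, h1, h2]

theorem measurable_localizationScore (t : ℝ) : Measurable (localizationScore t) :=
  (measurable_one.indicator measurableSet_one_le_abs).sub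
    (measurable_one.indicator (measurableSet_floor_eq t))

/-- The rate in the Chernoff bound for the scores. With gap `14 / 1000` in the mean, the moment
generating function at `v` is at most `1 - 14 / 1000 * v + v ^ 2`, which is smallest at
`v = 7 / 1000`. -/
def scoreRate : ℝ := 49 / 10 ^ 6

theorem integral_exp_localizationScore_le (t : ℝ) :
    ∫ z, Real.exp (7 / 1000 * localizationScore t z) ∂(gaussianReal 0 1) ≤
      Real.exp (-scoreRate) := by
  have hi1 : Integrable (Set.indicator {z : ℝ | 1 ≤ |z|} (1 : ℝ → ℝ)) (gaussianReal 0 1) :=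
    (integrable_const (1 : ℝ)).indicator measurableSet_one_le_abs
  have hi2 : Integrable (Set.indicator {z : ℝ | ⌊t + z⌋ = ⌊t⌋} (1 : ℝ → ℝ)) (gaussianReal 0 1) :=
    (integrable_const (1 : ℝ)).indicator (measurableSet_floor_eq t)
  have hint : Integrable (localizationScore t) (gaussianReal 0 1) := hi1.sub hi2
  have hmean : ∫ z, localizationScore t z ∂(gaussianReal 0 1) ≤ -(14 / 1000) := by
    unfold localizationScore
    rw [integral_sub hi1 hi2, integral_indicator_one measurableSet_one_le_abs,
      integral_indicator_one (measurableSet_floor_eq t)]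
    linarith [measureReal_one_le_abs_le t]
  have hpt : ∀ z, Real.exp (7 / 1000 * localizationScore t z) ≤
      (1 + (7 / 1000) ^ 2) + 7 / 1000 * localizationScore t z := by
    intro z
    have h1 := abs_localizationScore_le t z
    have h2 : |7 / 1000 * localizationScore t z| ≤ 7 / 1000 := by
      rw [abs_mul, abs_of_pos (by norm_num)]; linarith
    have h3 := (abs_le.1 (Real.abs_exp_sub_one_sub_id_le (h2.trans (by norm_num)))).2
    have h4 := sq_le_sq' (abs_le.1 h2).1 (abs_le.1 h2).2
    linarith
  calc ∫ z, Real.exp (7 / 1000 * localizationScore t z) ∂(gaussianReal 0 1)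
      ≤ ∫ z, ((1 + (7 / 1000) ^ 2) + 7 / 1000 * localizationScore t z) ∂(gaussianReal 0 1) :=
        integral_mono_of_nonneg (Filter.Eventually.of_forall fun _ => (Real.exp_pos _).le)
          ((integrable_const _).add (hint.const_mul _)) (Filter.Eventually.of_forall hpt)
    _ = (1 + (7 / 1000) ^ 2) + 7 / 1000 * ∫ z, localizationScore t z ∂(gaussianReal 0 1) := by
        rw [integral_add (integrable_const _) (hint.const_mul _), integral_const_mul]
        simp
    _ ≤ -scoreRate + 1 := by unfold scoreRate; linarith
    _ ≤ _ := Real.add_one_le_exp _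

/-- The event that among the machines in `F` at least as many are misleading as report the cell of
the mean. -/
def misled {m : ℕ} (t : ℝ) (F : Finset (Fin m)) : Set (Fin m → ℝ) :=
  {z | (F.filter fun i => ⌊t + z i⌋ = ⌊t⌋).card ≤ (F.filter fun i => 1 ≤ |z i|).card}

theorem indicator_misled_le {m : ℕ} (t : ℝ) (F : Finset (Fin m)) (z : Fin m → ℝ) :
    (misled t F).indicator 1 z ≤
      ∏ i, (if i ∈ F then Real.exp (7 / 1000 * localizationScore t (z i)) else 1) := by
  rw [Finset.prod_ite_mem, Finset.univ_inter, ← Real.exp_sum]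
  by_cases hz : z ∈ misled t F
  · rw [Set.indicator_of_mem hz, Pi.one_apply]
    refine Real.one_le_exp ?_
    rw [← Finset.mul_sum]
    refine mul_nonneg (by norm_num) ?_
    simp only [localizationScore, Finset.sum_sub_distrib, Set.indicator_apply, Set.mem_ofPred_eq,
      Pi.one_apply, Finset.sum_boole, sub_nonneg, Nat.cast_le]
    exact hz
  · rw [Set.indicator_of_notMem hz]
    exact (Real.exp_pos _).le

theorem measurableSet_misled {m : ℕ} (t : ℝ) (F : Finset (Fin m)) : MeasurableSet (misled t F) := by
  have hcard : ∀ (A : Set ℝ) [DecidablePred (· ∈ A)], MeasurableSet A →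
      Measurable fun z : Fin m → ℝ => (F.filter fun i => z i ∈ A).card := by
    intro A _ hA
    simp only [Finset.card_filter]
    exact Finset.measurable_sum _ fun i _ =>
      Measurable.ite (hA.preimage (measurable_pi_apply i)) measurable_const measurable_const
  classical
  refine measurableSet_le (f := fun z : Fin m → ℝ => _) (g := fun z : Fin m → ℝ => _)
    ((?_ : Measurable fun z : Fin m → ℝ => (F.filter fun i => ⌊t + z i⌋ = ⌊t⌋).card))
    ((?_ : Measurable fun z : Fin m → ℝ => (F.filter fun i => 1 ≤ |z i|).card))
  · exact hcard {z : ℝ | ⌊t + z⌋ = ⌊t⌋} (measurableSet_floor_eq t)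
  · exact hcard {z : ℝ | 1 ≤ |z|} measurableSet_one_le_abs

/-- Chernoff bound: the finer localization machines are rarely misled. -/
theorem noiseLaw_misled_le {m : ℕ} (t : ℝ) (F : Finset (Fin m)) :
    noiseLaw m (misled t F) ≤ ENNReal.ofReal (Real.exp (-(scoreRate * F.card))) := by
  set f : Fin m → ℝ → ℝ := fun i y =>
    if i ∈ F then Real.exp (7 / 1000 * localizationScore t y) else 1 with hf
  have hmeas : ∀ i, Measurable (f i) := by
    intro i
    by_cases hi : i ∈ F
    · simp only [hf, hi, if_true]
      exact Real.measurable_exp.comp ((measurable_localizationScore t).const_mul _)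
    · simp only [hf, hi, if_false]; exact measurable_const
  have hf0 : ∀ i y, 0 ≤ f i y := by
    intro i y
    simp only [hf]; split_ifs
    · exact (Real.exp_pos _).le
    · norm_num
  have hf2 : ∀ i y, f i y ≤ 2 := by
    intro i y
    simp only [hf]; split_ifs
    · have h1 := (abs_le.1 (abs_localizationScore_le t y)).2
      have h2 : Real.exp (7 / 1000 * localizationScore t y) ≤ Real.exp (1 / 2) := by
        rw [Real.exp_le_exp]; linarith
      have h3 := Real.exp_bound_div_one_sub_of_interval' (x := 1 / 2) (by norm_num) (by norm_num)
      norm_num at h3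
      linarith
    · norm_num
  have hint : Integrable (fun z : Fin m → ℝ => ∏ i, f i (z i)) (noiseLaw m) := by
    refine Integrable.fintype_prod fun i => ?_
    exact Integrable.of_bound (hmeas i).aestronglyMeasurable 2 (Filter.Eventually.of_forall fun y => by
      rw [Real.norm_of_nonneg (hf0 i y)]; exact hf2 i y)
  have h1 : (noiseLaw m).real (misled t F) ≤ ∫ z, ∏ i, f i (z i) ∂(noiseLaw m) := by
    rw [← integral_indicator_one (measurableSet_misled t F)]
    exact integral_mono_of_nonneg
      (Filter.Eventually.of_forall fun z => Set.indicator_nonneg (fun _ _ => zero_le_one) z) hint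
      (Filter.Eventually.of_forall (indicator_misled_le t F))
  rw [← ofReal_measureReal]
  refine ENNReal.ofReal_le_ofReal (h1.trans ?_)
  rw [noiseLaw, integral_fintype_prod_eq_prod]
  calc ∏ i, ∫ y, f i y ∂(gaussianReal 0 1)
      ≤ ∏ i, (if i ∈ F then Real.exp (-scoreRate) else 1) := by
        refine Finset.prod_le_prod (fun i _ => integral_nonneg (hf0 i)) fun i _ => ?_
        by_cases hi : i ∈ F
        · simp only [hf, hi, if_true]; exact integral_exp_localizationScore_le t
        · simp [hf, hi]
    _ = Real.exp (-(scoreRate * F.card)) := by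
        rw [Finset.prod_ite_mem, Finset.univ_inter, Finset.prod_const, ← Real.exp_nat_mul]
        congr 1; ring

/-- The mean squared error of an observed frequency. -/
theorem lintegral_sq_frequency_le {m : ℕ} (R : Finset (Fin m)) (hR : R.Nonempty) {A : Set ℝ}
    [DecidablePred (· ∈ A)] (hA : MeasurableSet A) :
    ∫⁻ z, ENNReal.ofReal ((((R.filter fun i => z i ∈ A).card : ℝ) / R.card -
        (gaussianReal 0 1).real A) ^ 2) ∂(noiseLaw m) ≤ ENNReal.ofReal (1 / R.card) := by
  have hn : (0 : ℝ) < R.card := by exact_mod_cast hR.card_pos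
  set X : Fin m → ℝ → ℝ := fun i => if i ∈ R then A.indicator 1 else 0 with hX
  have hXmeas : ∀ i, Measurable (X i) := by
    intro i
    by_cases hi : i ∈ R
    · simp only [hX, hi, if_true]; exact measurable_one.indicator hA
    · simp only [hX, hi, if_false]; exact measurable_zero
  have hX01 : ∀ i y, X i y ∈ Set.Icc (0 : ℝ) 1 := by
    intro i y
    by_cases hi : i ∈ R <;> by_cases hy : y ∈ A <;> simp [hX, hi, hy]
  have hLp : ∀ i, MemLp (X i) 2 (gaussianReal 0 1) := fun i =>
    MemLp.of_bound (hXmeas i).aestronglyMeasurable 1 (Filter.Eventually.of_forall fun y => by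
      rw [Real.norm_of_nonneg (hX01 i y).1]; exact (hX01 i y).2)
  have hLp' : ∀ i, MemLp (fun z : Fin m → ℝ => X i (z i)) 2 (noiseLaw m) := fun i =>
    MemLp.of_bound ((hXmeas i).comp (measurable_pi_apply i)).aestronglyMeasurable 1
      (Filter.Eventually.of_forall fun z => by
        rw [Real.norm_of_nonneg (hX01 i _).1]; exact (hX01 i _).2)
  set S : (Fin m → ℝ) → ℝ := ∑ i, fun z => X i (z i) with hS
  have hScard : ∀ z, S z = ((R.filter fun i => z i ∈ A).card : ℝ) := by
    intro z
    simp only [hS, Finset.sum_apply, hX]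
    have : ∀ i : Fin m, (if i ∈ R then A.indicator 1 else 0 : ℝ → ℝ) (z i) =
        if i ∈ R then (if z i ∈ A then 1 else 0) else 0 := by
      intro i; by_cases hi : i ∈ R <;> simp [hi, Set.indicator_apply]
    rw [Finset.sum_congr rfl fun i _ => this i, Finset.sum_ite_mem, Finset.univ_inter,
      Finset.sum_boole]
  have hSLp : MemLp S 2 (noiseLaw m) := memLp_finsetSum' _ fun i _ => hLp' i
  have hvar : Var[S; noiseLaw m] ≤ R.card := by
    rw [hS, noiseLaw, variance_sum_pi hLp]
    calc ∑ i, Var[X i; gaussianReal 0 1] ≤ ∑ i, (if i ∈ R then (1 : ℝ) else 0) := by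
          refine Finset.sum_le_sum fun i _ => ?_
          by_cases hi : i ∈ R
          · rw [if_pos hi]
            refine (variance_le_sq_of_bounded (Filter.Eventually.of_forall (hX01 i))
              (hXmeas i).aemeasurable).trans (by norm_num)
          · simp [hX, hi]
      _ = R.card := by simp
  have hmean : ∫ z, S z ∂(noiseLaw m) = R.card * (gaussianReal 0 1).real A := by
    simp only [hS, Finset.sum_apply]
    rw [integral_finsetSum _ fun i _ => (hLp' i).integrable (by norm_num)]
    have : ∀ i : Fin m, ∫ z, X i (z i) ∂(noiseLaw m) =
        if i ∈ R then (gaussianReal 0 1).real A else 0 := by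
      intro i
      have h1 : ∫ z, X i (z i) ∂(noiseLaw m) = ∫ y, X i y ∂(gaussianReal 0 1) := by
        have h2 := (measurePreserving_eval (fun _ : Fin m => gaussianReal 0 1) i).map_eq
        rw [← h2, integral_map (measurable_pi_apply i).aemeasurable
          (hXmeas i).aestronglyMeasurable]
        rfl
      rw [h1]
      by_cases hi : i ∈ R
      · simp only [hX, hi, if_true]; exact integral_indicator_one hA
      · simp [hX, hi]
    rw [Finset.sum_congr rfl fun i _ => this i]
    simp
  have hev := ofReal_variance hSLp
  rw [evariance_eq_lintegral_ofReal, hmean] at hev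
  have hpt : ∀ z : Fin m → ℝ, ENNReal.ofReal ((((R.filter fun i => z i ∈ A).card : ℝ) / R.card -
      (gaussianReal 0 1).real A) ^ 2) = ENNReal.ofReal (1 / (R.card : ℝ) ^ 2) *
        ENNReal.ofReal ((S z - R.card * (gaussianReal 0 1).real A) ^ 2) := by
    intro z
    rw [← ENNReal.ofReal_mul (by positivity), hScard]
    congr 1; field_simp
  rw [lintegral_congr hpt, lintegral_const_mul' _ _ ENNReal.ofReal_ne_top, ← hev,
    ← ENNReal.ofReal_mul (by positivity)]
  refine ENNReal.ofReal_le_ofReal ?_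
  calc 1 / (R.card : ℝ) ^ 2 * Var[S; noiseLaw m] ≤ 1 / (R.card : ℝ) ^ 2 * R.card := by gcongr
    _ = _ := by field_simp

/-! ### The refined estimate of one coefficient -/

theorem modeStat_spec {ι : Type*} {sel : Finset ℤ → ℤ} (hsel : IsTieBreak sel) {L : ℕ} (hL : 0 < L)
    (S : Finset ι) (v : ι → ℤ) :
    modeStat sel L S v ∈ Finset.Ico (0 : ℤ) L ∧ ∀ z ∈ Finset.Ico (0 : ℤ) L,
      (S.filter fun i => v i = z).card ≤ (S.filter fun i => v i = modeStat sel L S v).card := by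
  have hne : (Finset.Ico (0 : ℤ) L).Nonempty := ⟨0, by simpa using hL⟩
  obtain ⟨y, hy, hmax⟩ := Finset.exists_max_image (Finset.Ico (0 : ℤ) L)
    (fun z => (S.filter fun i => v i = z).card) hne
  have h := hsel ((Finset.Ico (0 : ℤ) L).filter fun z => ∀ z' ∈ Finset.Ico (0 : ℤ) L,
    (S.filter fun i => v i = z').card ≤ (S.filter fun i => v i = z).card)
    ⟨y, Finset.mem_filter.2 ⟨hy, hmax⟩⟩
  exact Finset.mem_filter.1 h

theorem refineEstimate_congr {m : ℕ} [NeZero m] (sel : Finset ℤ → ℤ) (u : ℝ) {v w : Fin m → ℤ}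
    (h0 : v 0 = w 0) (h1 : ∀ i ∈ finerMachines m u, v i = w i)
    (h2 : ∀ i ∈ refinementMachines m u, v i = w i) :
    refineEstimate m sel u v = refineEstimate m sel u w := by
  have hmode : modeStat sel (modulus u) (finerMachines m u) v =
      modeStat sel (modulus u) (finerMachines m u) w := by
    have : ∀ z : ℤ, ((finerMachines m u).filter fun i => v i = z) =
        (finerMachines m u).filter fun i => w i = z := fun z =>
      Finset.filter_congr fun i hi => by rw [h1 i hi]
    simp only [modeStat, this]
  have hfreq : ∀ r : ℤ, ((refinementMachines m u).filter fun i => v i = r) =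
      (refinementMachines m u).filter fun i => w i = r := fun r =>
    Finset.filter_congr fun i hi => by rw [h2 i hi]
  simp only [refineEstimate, h0, hmode, hfreq]

/-- The integers that the machines send for a coefficient with rescaled observations `y i`; the
value `0` of a silent machine is irrelevant. -/
def sentSymbols (m : ℕ) [NeZero m] (u : ℝ) (y : Fin m → ℝ) (i : Fin m) : ℤ :=
  match machineSymbol m u i with
  | some f => f (y i)
  | none => 0

theorem sentSymbols_zero {m : ℕ} [NeZero m] (u : ℝ) (y : Fin m → ℝ) :
    sentSymbols m u y 0 = ⌊y 0⌋ := by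
  simp [sentSymbols, machineSymbol]

theorem sentSymbols_of_mem_finerMachines {m : ℕ} [NeZero m] {u : ℝ} (y : Fin m → ℝ) {i : Fin m}
    (hi : i ∈ finerMachines m u) : sentSymbols m u y i = ⌊y i⌋ % (modulus u : ℤ) := by
  have h0 : i ≠ 0 := fun h => zero_notMem_finerMachines u (h ▸ hi)
  simp [sentSymbols, machineSymbol, h0, hi]

theorem sentSymbols_of_mem_refinementMachines {m : ℕ} [NeZero m] {u : ℝ} (y : Fin m → ℝ)
    {i : Fin m} (hi : i ∈ refinementMachines m u) : sentSymbols m u y i = ⌊y i⌋ % 8 := by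
  have h0 : i ≠ 0 := fun h => zero_notMem_refinementMachines u (h ▸ hi)
  have h1 := notMem_finerMachines_of_mem hi
  simp [sentSymbols, machineSymbol, h0, h1, hi]

theorem measurable_sentSymbols (m : ℕ) [NeZero m] (u : ℝ) : Measurable (sentSymbols m u) := by
  refine measurable_pi_lambda _ fun i => ?_
  unfold sentSymbols
  cases h : machineSymbol m u i with
  | some f => exact (measurable_machineSymbol h).comp (measurable_pi_apply i)
  | none => exact measurable_const

/-- The estimate, in units of `σ`, of a coefficient from its rescaled observations. -/
def coeffEstimate (m : ℕ) [NeZero m] (sel : Finset ℤ → ℤ) (u : ℝ) (y : Fin m → ℝ) : ℝ :=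
  refineEstimate m sel u (sentSymbols m u y)

theorem measurable_coeffEstimate (m : ℕ) [NeZero m] (sel : Finset ℤ → ℤ) (u : ℝ) :
    Measurable (coeffEstimate m sel u) :=
  (measurable_of_countable (refineEstimate m sel u)).comp (measurable_sentSymbols m u)

/-- The cell around which the finer localization machines make the estimator refine. -/
def localizedCell (m : ℕ) [NeZero m] (sel : Finset ℤ → ℤ) (u : ℝ) (y : Fin m → ℝ) : ℤ :=
  fineCenter ⌊y 0⌋ (modulus u) (modeStat sel (modulus u) (finerMachines m u) (sentSymbols m u y))

/-- The observed frequency of the residue of `x - 2` among the refinement machines. -/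
def residueFreq (m : ℕ) (u : ℝ) (x : ℤ) (y : Fin m → ℝ) : ℝ :=
  (((refinementMachines m u).filter fun i => ⌊y i⌋ % 8 = (x - 2) % 8).card : ℝ) /
    (refinementMachines m u).card

theorem coeffEstimate_eq {m : ℕ} [NeZero m] (sel : Finset ℤ → ℤ) (u : ℝ) (y : Fin m → ℝ) :
    coeffEstimate m sel u y = refinePoint (localizedCell m sel u y)
      (residueFreq m u (localizedCell m sel u y) y) := by
  simp only [coeffEstimate, refineEstimate, sentSymbols_zero, residueFreq]
  rw [← localizedCell]
  congr 3
  refine congrArg Finset.card (Finset.filter_congr fun i hi => ?_)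
  rw [sentSymbols_of_mem_refinementMachines y hi]

theorem localizedCell_mem {m : ℕ} [NeZero m] (sel : Finset ℤ → ℤ) (u : ℝ) (y : Fin m → ℝ) :
    leftEnd ⌊y 0⌋ (modulus u) ≤ localizedCell m sel u y ∧
      localizedCell m sel u y < leftEnd ⌊y 0⌋ (modulus u) + modulus u := by
  have hL : (0 : ℤ) < modulus u := by exact_mod_cast modulus_pos u
  unfold localizedCell fineCenter
  have h0 := Int.emod_nonneg (modeStat sel (modulus u) (finerMachines m u) (sentSymbols m u y) -
    leftEnd ⌊y 0⌋ (modulus u)) hL.ne'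
  have h1 := Int.emod_lt_of_pos (modeStat sel (modulus u) (finerMachines m u) (sentSymbols m u y) -
    leftEnd ⌊y 0⌋ (modulus u)) hL
  constructor <;> lia

/-- The estimate is never much further from the mean than the observation of machine `1`. -/
theorem abs_coeffEstimate_sub_le {m : ℕ} [NeZero m] (sel : Finset ℤ → ℤ) (u t : ℝ)
    (z : Fin m → ℝ) :
    |coeffEstimate m sel u (fun i => t + z i) - t| ≤ |z 0| + modulus u + 4 := by
  rw [coeffEstimate_eq]
  obtain ⟨h1, h2⟩ := localizedCell_mem sel u fun i => t + z i
  set x := localizedCell m sel u fun i => t + z i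
  obtain ⟨h3, h4⟩ := refinePoint_mem_Icc x (residueFreq m u x fun i => t + z i)
  set ρ := refinePoint x (residueFreq m u x fun i => t + z i)
  have h5 := Int.floor_le (t + z 0)
  have h6 := Int.lt_floor_add_one (t + z 0)
  have h7 : (((modulus u / 2 : ℕ) : ℤ) : ℝ) ≤ modulus u := by
    exact_mod_cast Nat.div_le_self _ _
  have h8 : (0 : ℝ) ≤ ((modulus u / 2 : ℕ) : ℤ) := by positivity
  unfold leftEnd at h1 h2
  have h1' : ((⌊t + z 0⌋ : ℝ) - ((modulus u / 2 : ℕ) : ℤ)) ≤ x := by exact_mod_cast h1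
  have h2' : (x : ℝ) < (⌊t + z 0⌋ : ℝ) - ((modulus u / 2 : ℕ) : ℤ) + modulus u := by
    exact_mod_cast h2
  rw [abs_le]
  constructor <;> cases abs_cases (z 0) <;> linarith

/-- If the finer localization machines are not misled and machine `1` is not far off, then the
refinement takes place around the mean. -/
theorem mem_Icc_localizedCell {m : ℕ} [NeZero m] {sel : Finset ℤ → ℤ} (hsel : IsTieBreak sel)
    {u t : ℝ} {z : Fin m → ℝ} (hz0 : |z 0| ≤ modulus u / 2 - 3)
    (hz : z ∉ misled t (finerMachines m u)) :
    t ∈ Set.Icc ((localizedCell m sel u fun i => t + z i : ℤ) - 1 : ℝ)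
      ((localizedCell m sel u fun i => t + z i : ℤ) + 2) := by
  have hL := modulus_pos u
  have hLz : (0 : ℤ) < modulus u := by exact_mod_cast hL
  set y : Fin m → ℝ := fun i => t + z i with hy
  set F := finerMachines m u with hF
  set v := sentSymbols m u y with hv
  obtain ⟨hmem, hmax⟩ := modeStat_spec hsel hL F v
  set md := modeStat sel (modulus u) F v with hmd
  -- some machine near the mean voted for the mode
  obtain ⟨i, hiF, himd, hi1⟩ : ∃ i ∈ F, v i = md ∧ |z i| < 1 := by
    by_contra! hcon
    refine hz ?_
    calc (F.filter fun i => ⌊t + z i⌋ = ⌊t⌋).card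
        ≤ (F.filter fun i => v i = ⌊t⌋ % (modulus u : ℤ)).card := by
          refine Finset.card_le_card fun i hi => ?_
          rw [Finset.mem_filter] at hi ⊢
          refine ⟨hi.1, ?_⟩
          rw [hv, sentSymbols_of_mem_finerMachines y hi.1, hy]
          simp only [hi.2]
      _ ≤ (F.filter fun i => v i = md).card :=
          hmax _ (Finset.mem_Ico.2 ⟨Int.emod_nonneg _ hLz.ne', Int.emod_lt_of_pos _ hLz⟩)
      _ ≤ (F.filter fun i => 1 ≤ |z i|).card := by
          refine Finset.card_le_card fun i hi => ?_
          rw [Finset.mem_filter] at hi ⊢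
          exact ⟨hi.1, hcon i hi.1 hi.2⟩
  rw [hv, sentSymbols_of_mem_finerMachines y hiF] at himd
  obtain ⟨hz1, hz2⟩ := abs_lt.1 hi1
  obtain ⟨hw1, hw2⟩ := abs_le.1 hz0
  have h1 := Int.floor_le (y i)
  have h2 := Int.lt_floor_add_one (y i)
  have h3 := Int.floor_le (y 0)
  have h4 := Int.lt_floor_add_one (y 0)
  have h5 : ((modulus u / 2 : ℕ) : ℝ) ≤ (modulus u : ℝ) / 2 := Nat.cast_div_le
  have h6 : (modulus u : ℝ) ≤ 2 * ((modulus u / 2 : ℕ) : ℝ) + 1 := by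
    exact_mod_cast (by lia : modulus u ≤ 2 * (modulus u / 2) + 1)
  simp only [hy] at h1 h2 h3 h4
  have hcell : ⌊y i⌋ = localizedCell m sel u y := by
    rw [localizedCell, ← hmd, eq_fineCenter_iff _ _ _ _ (Finset.mem_Ico.1 hmem).1
      (Finset.mem_Ico.1 hmem).2]
    refine ⟨⟨?_, ?_⟩, himd⟩
    · rw [leftEnd, ← @Int.cast_le ℝ]
      simp only [Int.cast_sub, Int.cast_natCast, hy]
      linarith
    · rw [leftEnd, ← @Int.cast_lt ℝ]
      simp only [Int.cast_sub, Int.cast_add, Int.cast_natCast, hy]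
      linarith
  rw [← hcell]
  simp only [hy]
  constructor <;> linarith

theorem sq_coeffEstimate_sub_le {m : ℕ} [NeZero m] {sel : Finset ℤ → ℤ} (hsel : IsTieBreak sel)
    (u t : ℝ) (z : Fin m → ℝ) :
    (coeffEstimate m sel u (fun i => t + z i) - t) ^ 2 ≤
      (∑ x ∈ Finset.Icc (⌊t⌋ - 2) (⌊t⌋ + 1), 1 / refineRate ^ 2 *
        (residueFreq m u x (fun i => t + z i) - refineFn x t) ^ 2) +
      100 * Real.exp (6 - modulus u) * (Real.exp (4 * z 0) + Real.exp (-4 * z 0)) +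
      4 * (modulus u : ℝ) ^ 2 * (misled t (finerMachines m u)).indicator 1 z := by
  have hc := refineRate_pos
  have hA : 0 ≤ ∑ x ∈ Finset.Icc (⌊t⌋ - 2) (⌊t⌋ + 1), 1 / refineRate ^ 2 *
        (residueFreq m u x (fun i => t + z i) - refineFn x t) ^ 2 :=
    Finset.sum_nonneg fun x _ => by positivity
  have hB : 0 ≤ 100 * Real.exp (6 - modulus u) * (Real.exp (4 * z 0) + Real.exp (-4 * z 0)) := by
    positivity
  have hC : 0 ≤ 4 * (modulus u : ℝ) ^ 2 * (misled t (finerMachines m u)).indicator 1 z :=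
    mul_nonneg (by positivity) (Set.indicator_nonneg (fun _ _ => zero_le_one) z)
  have hcrude := abs_coeffEstimate_sub_le sel u t z
  rcases lt_or_ge ((modulus u : ℝ) / 2 - 3) |z 0| with h0 | h0
  · refine le_trans ?_ (le_add_of_nonneg_right hC)
    refine le_trans ?_ (le_add_of_nonneg_left hA)
    have h1 : |coeffEstimate m sel u (fun i => t + z i) - t| ≤ 10 * Real.exp |z 0| := by
      have := Real.add_one_le_exp |z 0|
      linarith [abs_nonneg (z 0)]
    have h2 : Real.exp (4 * |z 0|) ≤ Real.exp (4 * z 0) + Real.exp (-4 * z 0) := by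
      rcases abs_cases (z 0) with h | h
      · rw [h.1]; linarith [Real.exp_pos (-4 * z 0)]
      · rw [h.1, show 4 * -z 0 = -4 * z 0 by ring]; linarith [Real.exp_pos (4 * z 0)]
    calc (coeffEstimate m sel u (fun i => t + z i) - t) ^ 2 ≤ (10 * Real.exp |z 0|) ^ 2 :=
          sq_le_sq' (by linarith [neg_abs_le (coeffEstimate m sel u (fun i => t + z i) - t)])
            ((le_abs_self _).trans h1)
      _ = 100 * Real.exp (2 * |z 0|) := by
          rw [mul_pow, ← Real.exp_nat_mul]; norm_num
      _ ≤ 100 * Real.exp ((6 - modulus u) + 4 * |z 0|) := by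
          gcongr; linarith
      _ = 100 * Real.exp (6 - modulus u) * Real.exp (4 * |z 0|) := by rw [Real.exp_add]; ring
      _ ≤ _ := by gcongr
  by_cases hz : z ∈ misled t (finerMachines m u)
  · refine le_trans ?_ (le_add_of_nonneg_left (add_nonneg hA hB))
    rw [Set.indicator_of_mem hz, Pi.one_apply, mul_one]
    have h1 : |coeffEstimate m sel u (fun i => t + z i) - t| ≤ 2 * modulus u := by
      linarith [abs_nonneg (z 0)]
    calc (coeffEstimate m sel u (fun i => t + z i) - t) ^ 2 ≤ (2 * modulus u) ^ 2 :=
          sq_le_sq' (by linarith [neg_abs_le (coeffEstimate m sel u (fun i => t + z i) - t)])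
            ((le_abs_self _).trans h1)
      _ = _ := by ring
  · refine le_trans ?_ (le_add_of_nonneg_right hC)
    refine le_trans ?_ (le_add_of_nonneg_right hB)
    have ht := mem_Icc_localizedCell hsel h0 hz
    have hest := coeffEstimate_eq sel u fun i => t + z i
    set x := localizedCell m sel u fun i => t + z i with hx
    have hxmem : x ∈ Finset.Icc (⌊t⌋ - 2) (⌊t⌋ + 1) := by
      have h1 := Int.floor_le t
      have h2 := Int.lt_floor_add_one t
      rw [Finset.mem_Icc]
      constructor
      · have : (⌊t⌋ : ℝ) ≤ x + 2 := h1.trans ht.2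
        have : ⌊t⌋ ≤ x + 2 := by exact_mod_cast this
        lia
      · have : (x : ℝ) - 1 < ⌊t⌋ + 1 := lt_of_le_of_lt ht.1 h2
        have : x - 1 < ⌊t⌋ + 1 := by exact_mod_cast this
        lia
    refine le_trans ?_ (Finset.single_le_sum (f := fun x : ℤ => 1 / refineRate ^ 2 *
        (residueFreq m u x (fun i => t + z i) - refineFn x t) ^ 2)
        (fun x _ => by positivity) hxmem)
    have h3 := abs_refinePoint_sub_le ht (residueFreq m u x fun i => t + z i)
    rw [← hest] at h3
    rw [← sq_abs]
    refine (pow_le_pow_left₀ (abs_nonneg _) h3 2).trans (le_of_eq ?_)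
    rw [div_pow, sq_abs]; ring

theorem lintegral_exp_mul_gaussian (c : ℝ) :
    ∫⁻ z, ENNReal.ofReal (Real.exp (c * z)) ∂(gaussianReal 0 1) =
      ENNReal.ofReal (Real.exp (c ^ 2 / 2)) := by
  rw [← ofReal_integral_eq_lintegral_ofReal (integrable_exp_mul_gaussianReal c)
    (Filter.Eventually.of_forall fun _ => (Real.exp_pos _).le)]
  congr 1
  have := mgf_gaussianReal (X := id) (p := gaussianReal 0 1) Measure.map_id c
  simpa [mgf] using this

theorem measurable_residueFreq (m : ℕ) (u t : ℝ) (x : ℤ) :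
    Measurable fun z : Fin m → ℝ => residueFreq m u x fun i => t + z i := by
  unfold residueFreq
  simp only [Finset.card_filter, Nat.cast_sum, Nat.cast_ite]
  refine Measurable.div_const (Finset.measurable_sum _ fun i _ => ?_) _
  refine Measurable.ite ?_ measurable_const measurable_const
  exact (measurableSet_residueSet x).preimage
    (by fun_prop : Measurable fun z : Fin m → ℝ => t + z i)

theorem lintegral_sq_residueFreq_le {m : ℕ} {u : ℝ} (hR : (refinementMachines m u).Nonempty)
    (t : ℝ) (x : ℤ) :
    ∫⁻ z, ENNReal.ofReal ((residueFreq m u x (fun i => t + z i) - refineFn x t) ^ 2)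
      ∂(noiseLaw m) ≤ ENNReal.ofReal (1 / (refinementMachines m u).card) := by
  let _ : DecidablePred (· ∈ (fun z => t + z) ⁻¹' residueSet x) := fun z =>
    inferInstanceAs (Decidable (⌊t + z⌋ % 8 = (x - 2) % 8))
  have h := lintegral_sq_frequency_le (refinementMachines m u) hR
    ((measurableSet_residueSet x).preimage (measurable_const_add t))
  rw [measureReal_preimage_residueSet] at h
  exact h

theorem lintegral_sq_coeffEstimate_le {m : ℕ} [NeZero m] {sel : Finset ℤ → ℤ}
    (hsel : IsTieBreak sel) (u t : ℝ) (hR : (refinementMachines m u).Nonempty) :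
    ∫⁻ z, ENNReal.ofReal ((coeffEstimate m sel u (fun i => t + z i) - t) ^ 2) ∂(noiseLaw m) ≤
      ENNReal.ofReal (4 / refineRate ^ 2 * (1 / (refinementMachines m u).card) +
        200 * Real.exp (14 - modulus u) +
        4 * (modulus u : ℝ) ^ 2 * Real.exp (-(scoreRate * (finerMachines m u).card))) := by
  have hc := refineRate_pos
  set f1 : ℤ → (Fin m → ℝ) → ℝ := fun x z => 1 / refineRate ^ 2 *
        (residueFreq m u x (fun i => t + z i) - refineFn x t) ^ 2 with hf1
  have hf1nn : ∀ x z, 0 ≤ f1 x z := fun x z => by simp only [hf1]; positivity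
  have hf1meas : ∀ x, Measurable (f1 x) := by
    intro x
    exact (((measurable_residueFreq m u t x).sub_const _).pow_const 2).const_mul _
  have hind : ∀ z, 0 ≤ 4 * (modulus u : ℝ) ^ 2 * (misled t (finerMachines m u)).indicator 1 z :=
    fun z => mul_nonneg (by positivity) (Set.indicator_nonneg (fun _ _ => zero_le_one) z)
  have h1 : ∀ x, ∫⁻ z, ENNReal.ofReal (f1 x z) ∂(noiseLaw m) ≤
      ENNReal.ofReal (1 / refineRate ^ 2 * (1 / (refinementMachines m u).card)) := by
    intro x
    simp only [hf1]
    rw [lintegral_congr fun z => ENNReal.ofReal_mul (by positivity),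
      lintegral_const_mul' _ _ ENNReal.ofReal_ne_top, ENNReal.ofReal_mul (by positivity)]
    exact mul_le_mul' le_rfl (lintegral_sq_residueFreq_le hR t x)
  have h2 : ∫⁻ z : Fin m → ℝ, ENNReal.ofReal (100 * Real.exp (6 - modulus u) *
      (Real.exp (4 * z 0) + Real.exp (-4 * z 0))) ∂(noiseLaw m) ≤
      ENNReal.ofReal (200 * Real.exp (14 - modulus u)) := by
    rw [lintegral_noise_eval (0 : Fin m) (F := fun y => ENNReal.ofReal (100 *
      Real.exp (6 - modulus u) * (Real.exp (4 * y) + Real.exp (-4 * y)))) (by fun_prop),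
      lintegral_congr fun z => ENNReal.ofReal_mul (by positivity),
      lintegral_const_mul' _ _ ENNReal.ofReal_ne_top,
      lintegral_congr fun z => ENNReal.ofReal_add (by positivity) (by positivity),
      lintegral_add_left (by fun_prop), lintegral_exp_mul_gaussian, lintegral_exp_mul_gaussian,
      ← ENNReal.ofReal_add (by positivity) (by positivity), ← ENNReal.ofReal_mul (by positivity)]
    refine ENNReal.ofReal_le_ofReal (le_of_eq ?_)
    have e : Real.exp (14 - modulus u) = Real.exp (6 - modulus u) * Real.exp 8 := by
      rw [← Real.exp_add]; congr 1; ring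
    rw [e]; norm_num; ring
  have h3 : ∫⁻ z, ENNReal.ofReal (4 * (modulus u : ℝ) ^ 2 *
      (misled t (finerMachines m u)).indicator 1 z) ∂(noiseLaw m) ≤
      ENNReal.ofReal (4 * (modulus u : ℝ) ^ 2 *
        Real.exp (-(scoreRate * (finerMachines m u).card))) := by
    rw [lintegral_congr fun z => ENNReal.ofReal_mul (by positivity),
      lintegral_const_mul' _ _ ENNReal.ofReal_ne_top, ENNReal.ofReal_mul (q := Real.exp _) (by positivity)]
    refine mul_le_mul' le_rfl ?_
    refine le_trans (le_of_eq ?_) (noiseLaw_misled_le t (finerMachines m u))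
    rw [← lintegral_indicator_one (measurableSet_misled t _)]
    refine lintegral_congr fun z => ?_
    by_cases hz : z ∈ misled t (finerMachines m u) <;> simp [hz]
  calc _ ≤ ∫⁻ z, ((∑ x ∈ Finset.Icc (⌊t⌋ - 2) (⌊t⌋ + 1), ENNReal.ofReal (f1 x z)) +
        ENNReal.ofReal (100 * Real.exp (6 - modulus u) *
          (Real.exp (4 * z 0) + Real.exp (-4 * z 0))) +
        ENNReal.ofReal (4 * (modulus u : ℝ) ^ 2 *
          (misled t (finerMachines m u)).indicator 1 z)) ∂(noiseLaw m) := by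
        refine lintegral_mono fun z => ?_
        rw [← ENNReal.ofReal_sum_of_nonneg fun x _ => hf1nn x z,
          ← ENNReal.ofReal_add (Finset.sum_nonneg fun x _ => hf1nn x z) (by positivity),
          ← ENNReal.ofReal_add (add_nonneg (Finset.sum_nonneg fun x _ => hf1nn x z) (by positivity))
            (hind z)]
        exact ENNReal.ofReal_le_ofReal (sq_coeffEstimate_sub_le hsel u t z)
    _ = (∑ x ∈ Finset.Icc (⌊t⌋ - 2) (⌊t⌋ + 1), ∫⁻ z, ENNReal.ofReal (f1 x z) ∂(noiseLaw m)) +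
        ∫⁻ z : Fin m → ℝ, ENNReal.ofReal (100 * Real.exp (6 - modulus u) *
          (Real.exp (4 * z 0) + Real.exp (-4 * z 0))) ∂(noiseLaw m) +
        ∫⁻ z, ENNReal.ofReal (4 * (modulus u : ℝ) ^ 2 *
          (misled t (finerMachines m u)).indicator 1 z) ∂(noiseLaw m) := by
        have hm1 : Measurable fun z : Fin m → ℝ =>
            ∑ x ∈ Finset.Icc (⌊t⌋ - 2) (⌊t⌋ + 1), ENNReal.ofReal (f1 x z) :=
          Finset.measurable_sum _ fun x _ => (hf1meas x).ennreal_ofReal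
        have hm2 : Measurable fun z : Fin m → ℝ => ENNReal.ofReal (100 * Real.exp (6 - modulus u) *
          (Real.exp (4 * z 0) + Real.exp (-4 * z 0))) := by fun_prop
        have hm12 : Measurable fun z : Fin m → ℝ =>
            (∑ x ∈ Finset.Icc (⌊t⌋ - 2) (⌊t⌋ + 1), ENNReal.ofReal (f1 x z)) +
              ENNReal.ofReal (100 * Real.exp (6 - modulus u) *
                (Real.exp (4 * z 0) + Real.exp (-4 * z 0))) := hm1.add hm2
        rw [lintegral_add_left hm12, lintegral_add_left hm1,
          lintegral_finsetSum _ fun x _ => (hf1meas x).ennreal_ofReal]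
    _ ≤ (∑ x ∈ Finset.Icc (⌊t⌋ - 2) (⌊t⌋ + 1),
          ENNReal.ofReal (1 / refineRate ^ 2 * (1 / (refinementMachines m u).card))) +
        ENNReal.ofReal (200 * Real.exp (14 - modulus u)) +
        ENNReal.ofReal (4 * (modulus u : ℝ) ^ 2 *
        Real.exp (-(scoreRate * (finerMachines m u).card))) := by
        gcongr with x hx
        · exact h1 x
    _ = _ := by
        have hcard : (Finset.Icc (⌊t⌋ - 2) (⌊t⌋ + 1)).card = 4 := by
          rw [Int.card_Icc]; lia
        rw [Finset.sum_const, hcard, ← ENNReal.ofReal_nsmul,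
          ← ENNReal.ofReal_add (by positivity) (by positivity),
          ← ENNReal.ofReal_add (by positivity) (by positivity)]
        congr 3
        rw [nsmul_eq_mul]; push_cast; ring

/-- The bound without refinement, for a bounded number of machines. -/
theorem lintegral_sq_coeffEstimate_le_of_crude {m : ℕ} [NeZero m] (sel : Finset ℤ → ℤ) (u t : ℝ) :
    ∫⁻ z, ENNReal.ofReal ((coeffEstimate m sel u (fun i => t + z i) - t) ^ 2) ∂(noiseLaw m) ≤
      ENNReal.ofReal (2 * (modulus u + 4) ^ 2 + 2) := by
  calc _ ≤ ∫⁻ z : Fin m → ℝ, ENNReal.ofReal (2 * ((modulus u : ℝ) + 4) ^ 2 + 2 * z 0 ^ 2)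
        ∂(noiseLaw m) := by
        refine lintegral_mono fun z => ENNReal.ofReal_le_ofReal ?_
        have h := abs_coeffEstimate_sub_le sel u t z
        rw [← sq_abs]
        refine (pow_le_pow_left₀ (abs_nonneg _) h 2).trans ?_
        nlinarith [sq_nonneg (|z 0| - (modulus u + 4)), sq_abs (z 0)]
    _ = _ := by
        rw [lintegral_noise_eval (0 : Fin m) (F := fun y => ENNReal.ofReal
          (2 * ((modulus u : ℝ) + 4) ^ 2 + 2 * y ^ 2)) (by fun_prop),
          lintegral_affine_sq_gaussian (by positivity) (by norm_num)]

/-! ### The risk of one coefficient is of order `1 / u` -/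

theorem le_card_finerMachines {m : ℕ} {u : ℝ} (hu : 0 ≤ u) (hum : u ≤ m)
    (h : Real.logb 2 u ^ 2 + 2 ≤ u) :
    Real.logb 2 u ^ 2 - 1 ≤ ((finerMachines m u).card : ℝ) := by
  have h1 : (finerCount u : ℝ) ≤ Real.logb 2 u ^ 2 := Nat.floor_le (sq_nonneg _)
  have h2 : Real.logb 2 u ^ 2 < finerCount u + 1 := Nat.lt_floor_add_one _
  have h3 : 1 + finerCount u ≤ ⌊u⌋₊ := Nat.le_floor (by push_cast; linarith)
  have h4 : ⌊u⌋₊ ≤ m := Nat.floor_le_of_le hum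
  have h5 : (finerMachines m u).card = finerCount u := by
    rw [finerMachines_eq hu, card_filter_machineNo (by norm_num) (by lia)]
    lia
  rw [h5]; linarith

theorem le_card_refinementMachines {m : ℕ} {u : ℝ} (hu : 0 ≤ u) (hum : u ≤ m) :
    u - 2 - Real.logb 2 u ^ 2 ≤ ((refinementMachines m u).card : ℝ) := by
  have h1 : (finerCount u : ℝ) ≤ Real.logb 2 u ^ 2 := Nat.floor_le (sq_nonneg _)
  have h2 : u < ⌊u⌋₊ + 1 := Nat.lt_floor_add_one u
  have h5 : (refinementMachines m u).card = ⌊u⌋₊ + 1 - (2 + finerCount u) := by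
    rw [refinementMachines_eq hu, card_filter_machineNo (by lia) (Nat.floor_le_of_le hum)]
  have h6 : (⌊u⌋₊ : ℝ) ≤ (refinementMachines m u).card + (1 + finerCount u) := by
    exact_mod_cast (by lia : ⌊u⌋₊ ≤ (refinementMachines m u).card + (1 + finerCount u))
  linarith

theorem modulus_le {u : ℝ} (hu : 1 ≤ u) : (modulus u : ℝ) ≤ u := by
  have hL0 : 0 ≤ Real.logb 2 u := Real.logb_nonneg (by norm_num) hu
  have hL : Real.logb 2 u ≤ u := by
    have h1 := Real.log_le_sub_one_of_pos (x := u / 2) (by linarith)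
    rw [Real.log_div (by linarith) (by norm_num)] at h1
    have h2 := Real.log_two_gt_d9
    have h3 := Real.log_two_lt_d9
    rw [Real.logb, div_le_iff₀ (by linarith)]
    nlinarith
  unfold modulus
  push_cast
  exact max_le hu ((Nat.floor_le hL0).trans hL)

theorem exists_large_threshold : ∃ u₀ : ℝ, 1 ≤ u₀ ∧ ∀ u, u₀ ≤ u →
    1 + 3 / scoreRate ≤ Real.logb 2 u ∧ Real.logb 2 u ^ 2 + 2 ≤ u / 2 := by
  have h1 : ∀ᶠ u : ℝ in Filter.atTop, 1 + 3 / scoreRate ≤ Real.logb 2 u :=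
    (Real.tendsto_logb_atTop (by norm_num)).eventually_ge_atTop _
  have hlog2 : 0 < Real.log 2 := Real.log_pos one_lt_two
  have h2 := (Real.isLittleO_pow_log_id_atTop (n := 2)).bound
    (by positivity : 0 < Real.log 2 ^ 2 / 4)
  obtain ⟨u₀, hu₀⟩ := ((h1.and h2).and (Filter.eventually_ge_atTop (8 : ℝ))).exists_forall_of_atTop
  refine ⟨max u₀ 1, le_max_right _ _, fun u hu => ?_⟩
  obtain ⟨⟨h3, h4⟩, h5⟩ := hu₀ u ((le_max_left _ _).trans hu)
  refine ⟨h3, ?_⟩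
  rw [Real.norm_of_nonneg (by positivity), id, Real.norm_of_nonneg (by linarith)] at h4
  have h6 : Real.logb 2 u ^ 2 ≤ u / 4 := by
    rw [Real.logb, div_pow, div_le_iff₀ (by positivity)]
    linarith
  linarith

/-- For a large number of machines all contributions to the risk are of order `1 / u`. -/
theorem lintegral_sq_coeffEstimate_le_of_large {m : ℕ} [NeZero m] {sel : Finset ℤ → ℤ}
    (hsel : IsTieBreak sel) {u : ℝ} (hu1 : 1 ≤ u) (hum : u ≤ m)
    (hL : 1 + 3 / scoreRate ≤ Real.logb 2 u) (hLu : Real.logb 2 u ^ 2 + 2 ≤ u / 2) (t : ℝ) :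
    ∫⁻ z, ENNReal.ofReal ((coeffEstimate m sel u (fun i => t + z i) - t) ^ 2) ∂(noiseLaw m) ≤
      ENNReal.ofReal ((8 / refineRate ^ 2 + 200 * Real.exp 15 + 4) / u) := by
  have hu0 : 0 < u := by linarith
  have hκ : 0 < scoreRate := by unfold scoreRate; norm_num
  have hc := refineRate_pos
  have hRge := le_card_refinementMachines hu0.le hum
  have hFge := le_card_finerMachines hu0.le hum (by linarith)
  have hRpos : (0 : ℝ) < (refinementMachines m u).card := by linarith
  have hR : (refinementMachines m u).Nonempty := Finset.card_pos.1 (by exact_mod_cast hRpos)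
  refine (lintegral_sq_coeffEstimate_le hsel u t hR).trans (ENNReal.ofReal_le_ofReal ?_)
  have h3κ : 0 < 3 / scoreRate := by positivity
  set L := Real.logb 2 u with hLdef
  have hmod : (modulus u : ℝ) ≤ L := by
    unfold modulus; push_cast
    exact max_le (by linarith) (Nat.floor_le (by linarith))
  have hmod' : L - 1 ≤ modulus u := by
    have h1 : L < ⌊L⌋₊ + 1 := Nat.lt_floor_add_one L
    have h2 : (⌊L⌋₊ : ℝ) ≤ modulus u := by exact_mod_cast le_max_right 1 _
    linarith
  have hexpL : Real.exp (-L) ≤ 1 / u := by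
    have h1 : u = Real.exp (L * Real.log 2) := by
      rw [hLdef, Real.logb, div_mul_cancel₀ _ (Real.log_pos one_lt_two).ne', Real.exp_log hu0]
    rw [Real.exp_neg, ← one_div]
    refine one_div_le_one_div_of_le hu0 ?_
    conv_lhs => rw [h1]
    rw [Real.exp_le_exp]
    nlinarith [Real.log_two_lt_d9]
  have hterm1 : 4 / refineRate ^ 2 * (1 / ((refinementMachines m u).card : ℝ)) ≤
      4 / refineRate ^ 2 * (2 / u) := by
    gcongr ?_ * ?_
    rw [div_le_div_iff₀ hRpos hu0]
    linarith
  have hterm2 : 200 * Real.exp (14 - modulus u) ≤ 200 * (Real.exp 15 * (1 / u)) := by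
    have h1 : Real.exp (14 - modulus u) ≤ Real.exp 15 * Real.exp (-L) := by
      rw [← Real.exp_add, Real.exp_le_exp]; linarith
    have h2 : Real.exp 15 * Real.exp (-L) ≤ Real.exp 15 * (1 / u) := by gcongr
    linarith
  have hterm3 : 4 * (modulus u : ℝ) ^ 2 * Real.exp (-(scoreRate * (finerMachines m u).card)) ≤
      4 * (1 / u) := by
    have h1 : 3 * L ≤ scoreRate * (finerMachines m u).card := by
      have h2 : 3 / scoreRate * L ≤ (finerMachines m u).card := by nlinarith
      calc 3 * L = scoreRate * (3 / scoreRate * L) := by field_simp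
        _ ≤ _ := by gcongr
    have h2 : (modulus u : ℝ) ^ 2 ≤ Real.exp (2 * L) := by
      have h3 : (modulus u : ℝ) ≤ Real.exp L := by linarith [Real.add_one_le_exp L]
      calc (modulus u : ℝ) ^ 2 ≤ Real.exp L ^ 2 := by gcongr
        _ = Real.exp (2 * L) := by rw [← Real.exp_nat_mul]; norm_num
    calc 4 * (modulus u : ℝ) ^ 2 * Real.exp (-(scoreRate * (finerMachines m u).card))
        ≤ 4 * Real.exp (2 * L) * Real.exp (-(3 * L)) := by gcongr
      _ = 4 * Real.exp (-L) := by
          rw [mul_assoc, ← Real.exp_add]; congr 2; ring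
      _ ≤ _ := by gcongr
  calc _ ≤ 4 / refineRate ^ 2 * (2 / u) + 200 * (Real.exp 15 * (1 / u)) + 4 * (1 / u) := by
        gcongr
    _ = _ := by ring

theorem exists_coeff_risk_constant : ∃ C : ℝ, 0 < C ∧
    ∀ (m : ℕ) [NeZero m] (sel : Finset ℤ → ℤ), IsTieBreak sel → ∀ u : ℝ, 1 ≤ u → u ≤ m → ∀ t : ℝ,
      ∫⁻ z, ENNReal.ofReal ((coeffEstimate m sel u (fun i => t + z i) - t) ^ 2) ∂(noiseLaw m) ≤
        ENNReal.ofReal (C / u) := by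
  obtain ⟨u₀, hu₀1, hu₀⟩ := exists_large_threshold
  have hc := refineRate_pos
  have hu₀0 : 0 < u₀ := by linarith
  set C₁ := 8 / refineRate ^ 2 + 200 * Real.exp 15 + 4 with hC₁
  have hC₁0 : 0 < C₁ := by positivity
  refine ⟨C₁ + (2 * (u₀ + 4) ^ 2 + 2) * u₀, by positivity, fun m _ sel hsel u hu1 hum t => ?_⟩
  have hu0 : 0 < u := by linarith
  rcases le_or_gt u₀ u with h | h
  · obtain ⟨h1, h2⟩ := hu₀ u h
    refine (lintegral_sq_coeffEstimate_le_of_large hsel hu1 hum h1 h2 t).trans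
      (ENNReal.ofReal_le_ofReal ?_)
    have : 0 ≤ (2 * (u₀ + 4) ^ 2 + 2) * u₀ := by positivity
    exact div_le_div_of_nonneg_right (by linarith) hu0.le
  · refine (lintegral_sq_coeffEstimate_le_of_crude sel u t).trans (ENNReal.ofReal_le_ofReal ?_)
    rw [le_div_iff₀ hu0]
    have h1 : (modulus u : ℝ) ≤ u₀ := (modulus_le hu1).trans h.le
    calc (2 * ((modulus u : ℝ) + 4) ^ 2 + 2) * u ≤ (2 * (u₀ + 4) ^ 2 + 2) * u₀ := by gcongr
      _ ≤ _ := by linarith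

/-! ### From single coefficients to the mean squared error -/

/-- Bias of the coefficients beyond the first `N` levels. -/
theorem tsum_sq_tail_le {α M : ℝ} {p q : ℝ≥0∞} (hα : 0 < α) (hM : 0 < M) (hp : 2 ≤ p) (hq : 0 < q)
    {θ : Seq} (hθ : θ ∈ besovBall α p q M) (N : ℕ) :
    ∑' i : ℕ, ∑ k : Fin (2 ^ (i + N)), ENNReal.ofReal (θ ⟨i + N, k⟩ ^ 2) ≤
      ENNReal.ofReal (2 / (1 - (2 : ℝ) ^ (-2 * α)) * (M ^ 2 * ((2 : ℝ) ^ N) ^ (-2 * α))) := by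
  set r : ℝ := (2 : ℝ) ^ (-2 * α) with hr
  have hr0 : 0 < r := by positivity
  have hr1 : r < 1 := Real.rpow_lt_one_of_one_lt_of_neg (by norm_num) (by linarith)
  have hrN : ((2 : ℝ) ^ N) ^ (-2 * α) = r ^ N := by
    rw [hr, ← Real.rpow_natCast, ← Real.rpow_natCast, ← Real.rpow_mul (by norm_num),
      ← Real.rpow_mul (by norm_num), mul_comm]
  have hlevel : ∀ j : ℕ, 2 * 2 ^ j * levelScale α M j ^ 2 = 2 * M ^ 2 * r ^ j := by
    intro j
    have : (2 : ℝ) ^ j * ((2 : ℝ) ^ (-((j : ℝ) * (α + 1 / 2)))) ^ 2 = r ^ j := by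
      rw [hr, ← Real.rpow_natCast 2 j, ← Real.rpow_natCast _ 2, ← Real.rpow_natCast _ j,
        ← Real.rpow_mul (by norm_num), ← Real.rpow_mul (by norm_num), ← Real.rpow_add (by norm_num)]
      congr 1; push_cast; ring
    rw [levelScale, mul_pow, ← this]; ring
  have hsum : HasSum (fun i : ℕ => 2 * M ^ 2 * r ^ N * r ^ i) (2 * M ^ 2 * r ^ N * (1 - r)⁻¹) :=
    (hasSum_geometric_of_lt_one hr0.le hr1).mul_left _
  calc _ ≤ ∑' i : ℕ, ENNReal.ofReal (2 * M ^ 2 * r ^ N * r ^ i) := by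
        refine ENNReal.tsum_le_tsum fun i => ?_
        rw [← ENNReal.ofReal_sum_of_nonneg fun _ _ => sq_nonneg _]
        refine ENNReal.ofReal_le_ofReal ((sum_sq_level_le hM hp hq hθ (i + N)).trans (le_of_eq ?_))
        rw [hlevel]; ring
    _ = ENNReal.ofReal (2 * M ^ 2 * r ^ N * (1 - r)⁻¹) := by
        rw [← hsum.tsum_eq, ENNReal.ofReal_tsum_of_nonneg (fun i => by positivity) hsum.summable]
    _ ≤ _ := by
        refine ENNReal.ofReal_le_ofReal (le_of_eq ?_)
        rw [hrN]; ring

/-- The risk of a protocol that estimates the coefficients of the first `numLevels α M δ` levels up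
to an error of order `δ`, in terms of `T = (M / δ) ^ (1 / (α + 1/2))`. -/
theorem mse_le_of_coeff {m : ℕ} {P : Protocol m} {α M σ δ K : ℝ} {p q : ℝ≥0∞} (hα : 0 < α)
    (hM : 0 < M) (hδ : 0 < δ) (hK : 0 ≤ K) (hp : 2 ≤ p) (hq : 0 < q) {θ : Seq}
    (hθ : θ ∈ besovBall α p q M)
    (hmeas : ∀ a, Measurable fun X => P.estimate X a)
    (hlow : ∀ a : Idx, a.1 < numLevels α M δ →
      ∫⁻ X, ENNReal.ofReal ((P.estimate X a - θ a) ^ 2) ∂(dataLaw m σ θ) ≤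
        ENNReal.ofReal (K * δ ^ 2))
    (hhigh : ∀ a : Idx, numLevels α M δ ≤ a.1 → ∀ X, P.estimate X a = 0) :
    P.mse σ θ ≤ ENNReal.ofReal ((2 * K + 2 / (1 - (2 : ℝ) ^ (-2 * α))) *
      (M ^ 2 * ((M / δ) ^ (1 / (α + 1 / 2))) ^ (-2 * α))) := by
  set N := numLevels α M δ with hN
  set T := (M / δ) ^ (1 / (α + 1 / 2)) with hT
  have hT0 : 0 < T := by positivity
  have hr1 : (2 : ℝ) ^ (-2 * α) < 1 :=
    Real.rpow_lt_one_of_one_lt_of_neg (by norm_num) (by linarith)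
  have hTδ : T * δ ^ 2 = M ^ 2 * T ^ (-2 * α) := by
    have h1 : T ^ (α + 1 / 2) = M / δ := by
      rw [hT, ← Real.rpow_mul (by positivity), one_div_mul_cancel (by positivity), Real.rpow_one]
    have h2 : T ^ (-2 * α) = T * (T ^ (α + 1 / 2)) ^ (-2 : ℝ) := by
      rw [← Real.rpow_mul hT0.le]
      nth_rewrite 2 [← Real.rpow_one T]
      rw [← Real.rpow_add hT0]
      congr 1; ring
    rw [h2, h1, Real.rpow_neg (by positivity), Real.rpow_two]
    field_simp
  have hbias : 0 ≤ 2 / (1 - (2 : ℝ) ^ (-2 * α)) := div_nonneg (by norm_num) (by linarith)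
  unfold Protocol.mse
  rw [lintegral_tsum fun a => (((hmeas a).sub_const _).pow_const 2).ennreal_ofReal.aemeasurable,
    ENNReal.tsum_sigma']
  simp only [tsum_fintype]
  rw [← Summable.sum_add_tsum_nat_add' (k := N) ENNReal.summable]
  calc _ ≤ (∑ j ∈ Finset.range N, ∑ _k : Fin (2 ^ j), ENNReal.ofReal (K * δ ^ 2)) +
        ∑' i : ℕ, ∑ k : Fin (2 ^ (i + N)), ENNReal.ofReal (θ ⟨i + N, k⟩ ^ 2) := by
        refine add_le_add (Finset.sum_le_sum fun j hj => Finset.sum_le_sum fun k _ =>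
          hlow ⟨j, k⟩ (Finset.mem_range.1 hj)) (ENNReal.tsum_le_tsum fun i =>
            Finset.sum_le_sum fun k _ => ?_)
        simp [hhigh ⟨i + N, k⟩ (Nat.le_add_left N i)]
    _ ≤ ENNReal.ofReal (2 * T * (K * δ ^ 2)) +
        ENNReal.ofReal (2 / (1 - (2 : ℝ) ^ (-2 * α)) * (M ^ 2 * T ^ (-2 * α))) := by
        refine add_le_add ?_ ((tsum_sq_tail_le hα hM hp hq hθ N).trans
          (ENNReal.ofReal_le_ofReal ?_))
        · calc _ = ENNReal.ofReal ((∑ j ∈ Finset.range N, (2 : ℝ) ^ j) * (K * δ ^ 2)) := by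
                rw [ENNReal.ofReal_mul (Finset.sum_nonneg fun _ _ => by positivity),
                  ENNReal.ofReal_sum_of_nonneg fun _ _ => by positivity, Finset.sum_mul]
                simp
            _ ≤ _ := by
                refine ENNReal.ofReal_le_ofReal ?_
                gcongr
                exact sum_two_pow_numLevels_le hα hM hδ
        · have h1 : ((2 : ℝ) ^ N) ^ (-2 * α) ≤ T ^ (-2 * α) :=
            Real.rpow_le_rpow_of_nonpos hT0 (two_pow_numLevels_gt hα hM hδ).le (by linarith)
          gcongr
    _ = _ := by
        rw [← ENNReal.ofReal_add (by positivity) (by positivity)]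
        congr 1
        linear_combination (2 * K) * hTδ

/-! ### The mean squared error of the two protocols -/

theorem estimate_crudeProtocol {m : ℕ} [NeZero m] (δ : ℝ) (N : ℕ) (X : Fin m → Seq) (a : Idx) :
    (crudeProtocol m δ N).estimate X a = if a.1 < N then (⌊X 0 a / δ⌋ : ℝ) * δ else 0 := by
  simp only [Protocol.estimate, crudeProtocol, if_true]
  split_ifs with h
  · rw [decodeBlock_encodeBlock _ h]
  · rfl

theorem estimate_refinedProtocol {m : ℕ} [NeZero m] (sel : Finset ℤ → ℤ) (σ u : ℝ) (N : ℕ)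
    (X : Fin m → Seq) (a : Idx) :
    (refinedProtocol m sel σ u N).estimate X a =
      if a.1 < N then coeffEstimate m sel u (fun i => X i a / σ) * σ else 0 := by
  simp only [Protocol.estimate, refinedProtocol]
  split_ifs with h
  · congr 1
    have hsym : ∀ i, i = 0 ∨ i ∈ finerMachines m u ∨ i ∈ refinementMachines m u →
        decodeBlock N ((refinedProtocol m sel σ u N).enc i (X i)) a =
          sentSymbols m u (fun i => X i a / σ) i := by
      intro i hi
      obtain ⟨f, hf⟩ : ∃ f, machineSymbol m u i = some f := by
        unfold machineSymbol
        split_ifs with h0 h1 h2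
        · exact ⟨_, rfl⟩
        · exact ⟨_, rfl⟩
        · exact ⟨_, rfl⟩
        · simp [h0, h1, h2] at hi
      simp only [refinedProtocol, sentSymbols, hf]
      exact decodeBlock_encodeBlock _ h
    exact refineEstimate_congr sel u (hsym 0 (Or.inl rfl)) (fun i hi => hsym i (Or.inr (Or.inl hi)))
      fun i hi => hsym i (Or.inr (Or.inr hi))
  · rfl

theorem measurable_observation {m : ℕ} (i : Fin m) (a : Idx) :
    Measurable fun X : Fin m → Seq => X i a :=
  (measurable_pi_apply a).comp (measurable_pi_apply i)

theorem mse_crudeProtocol_le {m : ℕ} [NeZero m] {α M σ δ : ℝ} {p q : ℝ≥0∞} (hα : 0 < α)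
    (hM : 0 < M) (hσ : 0 < σ) (hσδ : σ ≤ δ) (hp : 2 ≤ p) (hq : 0 < q) {θ : Seq}
    (hθ : θ ∈ besovBall α p q M) :
    (crudeProtocol m δ (numLevels α M δ)).mse σ θ ≤
      ENNReal.ofReal ((2 * 4 + 2 / (1 - (2 : ℝ) ^ (-2 * α))) *
        (M ^ 2 * ((M / δ) ^ (1 / (α + 1 / 2))) ^ (-2 * α))) := by
  have hδ : 0 < δ := hσ.trans_le hσδ
  refine mse_le_of_coeff hα hM hδ (by norm_num) hp hq hθ (fun a => ?_) (fun a ha => ?_)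
    fun a ha X => ?_
  · simp only [estimate_crudeProtocol]
    split_ifs
    · have h1 : Measurable fun X : Fin m → Seq => X 0 a / δ :=
        (measurable_observation 0 a).div_const δ
      exact ((measurable_of_countable fun n : ℤ => (n : ℝ)).comp
        (Int.measurable_floor.comp h1)).mul_const δ
    · exact measurable_const
  · simp only [estimate_crudeProtocol, ha, if_true]
    have hmeas : Measurable fun x : ℝ => ENNReal.ofReal (((⌊x / δ⌋ : ℝ) * δ - θ a) ^ 2) :=
      ((((measurable_of_countable fun n : ℤ => (n : ℝ)).comp
        (Int.measurable_floor.comp (measurable_id.div_const δ))).mul_const δ).sub_const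
          _).pow_const 2 |>.ennreal_ofReal
    rw [lintegral_coeff_eval σ θ 0 a hmeas]
    calc _ ≤ ∫⁻ z, ENNReal.ofReal (2 * δ ^ 2 + 2 * σ ^ 2 * z ^ 2) ∂(gaussianReal 0 1) := by
          refine lintegral_mono fun z => ENNReal.ofReal_le_ofReal ?_
          have h1 := Int.floor_le ((θ a + σ * z) / δ)
          have h2 := Int.lt_floor_add_one ((θ a + σ * z) / δ)
          rw [le_div_iff₀ hδ] at h1
          rw [div_lt_iff₀ hδ] at h2
          set e := (⌊(θ a + σ * z) / δ⌋ : ℝ) * δ - θ a - σ * z with he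
          have h3 : e ^ 2 ≤ δ ^ 2 := sq_le_sq' (by linarith) (by linarith)
          have h4 : (⌊(θ a + σ * z) / δ⌋ : ℝ) * δ - θ a = e + σ * z := by rw [he]; ring
          rw [h4]
          nlinarith [sq_nonneg (e - σ * z)]
      _ = ENNReal.ofReal (2 * δ ^ 2 + 2 * σ ^ 2) :=
          lintegral_affine_sq_gaussian (by positivity) (by positivity)
      _ ≤ _ := by
          refine ENNReal.ofReal_le_ofReal ?_
          nlinarith
  · simp [estimate_crudeProtocol, not_lt.2 ha]

theorem mse_refinedProtocol_le {m : ℕ} [NeZero m] {sel : Finset ℤ → ℤ} {α M σ u C : ℝ}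
    {p q : ℝ≥0∞} (hα : 0 < α) (hM : 0 < M) (hσ : 0 < σ) (hu : 0 < u) (hC : 0 ≤ C)
    (hcoeff : ∀ t : ℝ, ∫⁻ z, ENNReal.ofReal ((coeffEstimate m sel u (fun i => t + z i) - t) ^ 2)
      ∂(noiseLaw m) ≤ ENNReal.ofReal (C / u))
    (hp : 2 ≤ p) (hq : 0 < q) {θ : Seq} (hθ : θ ∈ besovBall α p q M) :
    (refinedProtocol m sel σ u (numLevels α M (σ / √u))).mse σ θ ≤
      ENNReal.ofReal ((2 * C + 2 / (1 - (2 : ℝ) ^ (-2 * α))) *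
        (M ^ 2 * ((M / (σ / √u)) ^ (1 / (α + 1 / 2))) ^ (-2 * α))) := by
  refine mse_le_of_coeff hα hM (by positivity) hC hp hq hθ (fun a => ?_) (fun a ha => ?_)
    fun a ha X => ?_
  · simp only [estimate_refinedProtocol]
    split_ifs
    · have h1 : Measurable fun (X : Fin m → Seq) i => X i a / σ :=
        measurable_pi_lambda _ fun i => (measurable_observation i a).div_const σ
      exact ((measurable_coeffEstimate m sel u).comp h1).mul_const σ
    · exact measurable_const
  · simp only [estimate_refinedProtocol, ha, if_true]
    have hdiv : Measurable fun (x : Fin m → ℝ) i => x i / σ := by fun_prop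
    have hest : Measurable fun x : Fin m → ℝ => coeffEstimate m sel u (fun i => x i / σ) :=
      (measurable_coeffEstimate m sel u).comp hdiv
    have hmeas : Measurable fun x : Fin m → ℝ =>
        ENNReal.ofReal ((coeffEstimate m sel u (fun i => x i / σ) * σ - θ a) ^ 2) :=
      (((hest.mul_const σ).sub_const _).pow_const 2).ennreal_ofReal
    rw [lintegral_coeff m σ θ a hmeas]
    have hpt : ∀ z : Fin m → ℝ,
        ENNReal.ofReal ((coeffEstimate m sel u (fun i => (θ a + σ * z i) / σ) * σ - θ a) ^ 2) =
        ENNReal.ofReal (σ ^ 2) *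
          ENNReal.ofReal ((coeffEstimate m sel u (fun i => θ a / σ + z i) - θ a / σ) ^ 2) := by
      intro z
      have h1 : (fun i => (θ a + σ * z i) / σ) = fun i => θ a / σ + z i := by
        ext i; field_simp
      rw [h1, ← ENNReal.ofReal_mul (by positivity), ← mul_pow]
      congr 2
      field_simp
    rw [lintegral_congr hpt, lintegral_const_mul' _ _ ENNReal.ofReal_ne_top]
    refine (mul_le_mul' le_rfl (hcoeff (θ a / σ))).trans (le_of_eq ?_)
    rw [← ENNReal.ofReal_mul (by positivity), div_pow, Real.sq_sqrt hu.le]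
    congr 1; ring
  · simp [estimate_refinedProtocol, not_lt.2 ha]

/-! ### The three-phase rate -/

/-- The number of machines that would exhaust the budget if the constants were `1`. -/
def budgetMachines (α M σ B : ℝ) : ℝ :=
  (M / σ) ^ (-1 / (α + 1)) * B ^ ((2 * α + 1) / (2 * α + 2))

theorem budgetMachines_pos {α M σ B : ℝ} (hM : 0 < M) (hσ : 0 < σ) (hB : 0 < B) :
    0 < budgetMachines α M σ B := by unfold budgetMachines; positivity

/-- The risk, up to a constant, of the best estimator from the full data of `u` machines. -/
def machineRisk (α M σ u : ℝ) : ℝ := M ^ 2 * ((M / σ) ^ 2 * u) ^ (-(2 * α / (2 * α + 1)))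

theorem machineRisk_anti {α M σ u u' : ℝ} (hα : 0 < α) (hM : 0 < M) (hσ : 0 < σ) (hu : 0 < u)
    (h : u ≤ u') : machineRisk α M σ u' ≤ machineRisk α M σ u := by
  unfold machineRisk
  refine mul_le_mul_of_nonneg_left ?_ (by positivity)
  exact Real.rpow_le_rpow_of_nonpos (by positivity) (by gcongr)
    (by rw [neg_nonpos]; positivity)

theorem machineRisk_mul {α M σ u c : ℝ} (hM : 0 < M) (hσ : 0 < σ) (hu : 0 < u) (hc : 0 < c) :
    machineRisk α M σ (c * u) = c ^ (-(2 * α / (2 * α + 1))) * machineRisk α M σ u := by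
  unfold machineRisk
  rw [mul_left_comm _ c, Real.mul_rpow hc.le (by positivity)]
  ring

theorem machineRisk_eq {α M σ u : ℝ} (hα : 0 < α) (hM : 0 < M) (hσ : 0 < σ) (hu : 0 < u) :
    machineRisk α M σ u = M ^ (2 / (2 * α + 1)) * (σ ^ 2 / u) ^ (2 * α / (2 * α + 1)) := by
  have h1 : (M / σ) ^ 2 * u = M ^ 2 * (σ ^ 2 / u)⁻¹ := by field_simp
  have hq : 0 < σ ^ 2 / u := by positivity
  rw [machineRisk, h1, Real.mul_rpow (by positivity) (by positivity), Real.inv_rpow hq.le,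
    ← Real.rpow_neg hq.le, neg_neg, ← mul_assoc, ← Real.rpow_two, ← Real.rpow_mul hM.le,
    ← Real.rpow_add hM]
  congr 2
  field_simp; ring

theorem machineRisk_budgetMachines {α M σ B : ℝ} (hα : 0 < α) (hM : 0 < M) (hσ : 0 < σ)
    (hB : 0 < B) : machineRisk α M σ (budgetMachines α M σ B) =
      M ^ (2 / (α + 1)) * (σ ^ 2 / B) ^ (α / (α + 1)) := by
  have hA : 0 < M / σ := by positivity
  have h1 : (M / σ) ^ 2 * budgetMachines α M σ B =
      ((M / σ) ^ 2 * B) ^ ((2 * α + 1) / (2 * α + 2)) := by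
    rw [budgetMachines, Real.mul_rpow (by positivity) hB.le, ← mul_assoc, ← Real.rpow_two,
      ← Real.rpow_mul hA.le, ← Real.rpow_add hA]
    congr 2
    field_simp; ring
  have h2 : (M / σ) ^ 2 * B = M ^ 2 * (σ ^ 2 / B)⁻¹ := by field_simp
  have hq : 0 < σ ^ 2 / B := by positivity
  rw [machineRisk, h1, ← Real.rpow_mul (by positivity)]
  have h3 : (2 * α + 1) / (2 * α + 2) * -(2 * α / (2 * α + 1)) = -(α / (α + 1)) := by
    field_simp
  rw [h3, h2, Real.mul_rpow (by positivity) (by positivity), Real.inv_rpow hq.le,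
    ← Real.rpow_neg hq.le, neg_neg, ← mul_assoc, ← Real.rpow_two, ← Real.rpow_mul hM.le,
    ← Real.rpow_add hM]
  congr 2
  field_simp; ring

/-- Beyond the first phase the rate is the risk of the affordable number of machines. -/
theorem threePhaseRate_eq {m : ℕ} [NeZero m] {α M σ B : ℝ} (hα : 0 < α) (hM : 0 < M) (hσ : 0 < σ)
    (hB : 0 < B) (h : (M / σ) ^ (2 / (2 * α + 1)) ≤ B) :
    threePhaseRate m α M σ B = machineRisk α M σ (min (budgetMachines α M σ B) m) := by
  have hm : (0 : ℝ) < m := by exact_mod_cast Nat.pos_of_ne_zero (NeZero.ne m)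
  have hA : 0 < M / σ := by positivity
  have hiff : B < (M / σ) ^ (2 / (2 * α + 1)) * (m : ℝ) ^ ((2 * α + 2) / (2 * α + 1)) ↔
      budgetMachines α M σ B < m := by
    have h1 : (m : ℝ) = ((m : ℝ) ^ ((2 * α + 2) / (2 * α + 1))) ^ ((2 * α + 1) / (2 * α + 2)) := by
      rw [← Real.rpow_mul hm.le]
      have : (2 * α + 2) / (2 * α + 1) * ((2 * α + 1) / (2 * α + 2)) = 1 := by field_simp
      rw [this, Real.rpow_one]
    have h2 : (M / σ) ^ (-1 / (α + 1)) =
        (((M / σ) ^ (2 / (2 * α + 1))) ^ ((2 * α + 1) / (2 * α + 2)))⁻¹ := by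
      rw [← Real.rpow_mul hA.le, ← Real.rpow_neg hA.le]
      congr 1
      field_simp
    rw [budgetMachines, h2, ← div_eq_inv_mul, div_lt_iff₀ (by positivity)]
    conv_rhs => rw [h1]
    rw [← Real.mul_rpow (by positivity) (by positivity), mul_comm]
    exact (Real.rpow_lt_rpow_iff hB.le (by positivity) (by positivity)).symm
  unfold threePhaseRate
  rw [if_neg (not_lt.2 h)]
  by_cases h2 : budgetMachines α M σ B < m
  · rw [if_pos (hiff.2 h2), min_eq_left h2.le, machineRisk_budgetMachines hα hM hσ hB]
  · rw [if_neg (mt hiff.1 h2), min_eq_right (not_lt.1 h2), machineRisk_eq hα hM hσ hm]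

/-- The first phase bound holds for every budget. -/
theorem sq_mul_rpow_le_threePhaseRate {m : ℕ} [NeZero m] {α M σ B : ℝ} (hα : 0 < α) (hM : 0 < M)
    (hσ : 0 < σ) (hB : 0 < B) : M ^ 2 * B ^ (-2 * α) ≤ threePhaseRate m α M σ B := by
  have hm : (0 : ℝ) < m := by exact_mod_cast Nat.pos_of_ne_zero (NeZero.ne m)
  have hA : 0 < M / σ := by positivity
  rcases lt_or_ge B ((M / σ) ^ (2 / (2 * α + 1))) with h | h
  · rw [threePhaseRate, if_pos h]
  · rw [threePhaseRate_eq hα hM hσ hB h]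
    have hb := budgetMachines_pos (α := α) hM hσ hB
    refine le_trans ?_ (machineRisk_anti hα hM hσ (lt_min hb hm) (min_le_left _ _))
    unfold machineRisk
    refine mul_le_mul_of_nonneg_left ?_ (by positivity)
    have h1 : B ^ (-2 * α) = (B ^ (2 * α + 1)) ^ (-(2 * α / (2 * α + 1))) := by
      rw [← Real.rpow_mul hB.le]; congr 1; field_simp
    rw [h1]
    refine Real.rpow_le_rpow_of_nonpos (by positivity) ?_ (by rw [neg_nonpos]; positivity)
    have h2 : M / σ ≤ B ^ ((2 * α + 1) / 2) := by
      have h3 := Real.rpow_le_rpow (by positivity) h (by positivity : 0 ≤ (2 * α + 1) / 2)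
      rw [← Real.rpow_mul hA.le] at h3
      have h4 : 2 / (2 * α + 1) * ((2 * α + 1) / 2) = 1 := by field_simp
      rwa [h4, Real.rpow_one] at h3
    have h5 : (M / σ) ^ 2 * budgetMachines α M σ B =
        (M / σ) ^ ((2 * α + 1) / (α + 1)) * B ^ ((2 * α + 1) / (2 * α + 2)) := by
      rw [budgetMachines, ← mul_assoc, ← Real.rpow_two, ← Real.rpow_add hA]
      congr 2
      field_simp; ring
    rw [h5]
    calc _ ≤ (B ^ ((2 * α + 1) / 2)) ^ ((2 * α + 1) / (α + 1)) *
          B ^ ((2 * α + 1) / (2 * α + 2)) := by gcongr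
      _ = B ^ (2 * α + 1) := by
          rw [← Real.rpow_mul hB.le, ← Real.rpow_add hB]
          congr 1
          field_simp; ring

theorem machineRisk_eq_of_step {α M σ u : ℝ} (hα : 0 < α) (hM : 0 < M) (hσ : 0 < σ) (hu : 0 < u) :
    M ^ 2 * ((M / (σ / √u)) ^ (1 / (α + 1 / 2))) ^ (-2 * α) = machineRisk α M σ u := by
  have h1 : (M / σ) ^ 2 * u = (M / (σ / √u)) ^ (2 : ℝ) := by
    have h2 : M / (σ / √u) = M / σ * √u := by field_simp
    rw [Real.rpow_two, h2, mul_pow, Real.sq_sqrt hu.le]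
  rw [machineRisk, h1, ← Real.rpow_mul (by positivity), ← Real.rpow_mul (by positivity)]
  congr 2
  field_simp

theorem machineRisk_effectiveMachines_le {m : ℕ} [NeZero m] {α Λ₀ M σ B : ℝ} (hα : 0 < α)
    (hΛ : 1 ≤ Λ₀) (hM : 0 < M) (hσ : 0 < σ) (hB : 0 < B)
    (h : (Λ₀ * M / σ) ^ (2 / (2 * α + 1)) ≤ B) :
    machineRisk α M σ (effectiveMachines m α M σ B Λ₀) ≤
      (Λ₀ ^ (-1 / (α + 1))) ^ (-(2 * α / (2 * α + 1))) * threePhaseRate m α M σ B := by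
  have hm : (0 : ℝ) < m := by exact_mod_cast Nat.pos_of_ne_zero (NeZero.ne m)
  have hΛ0 : 0 < Λ₀ := by linarith
  have hb := budgetMachines_pos (α := α) hM hσ hB
  have h1 : (M / σ) ^ (2 / (2 * α + 1)) ≤ B := by
    refine le_trans ?_ h
    gcongr
    exact le_mul_of_one_le_left hM.le hΛ
  set c := Λ₀ ^ (-1 / (α + 1)) with hc
  have hc0 : 0 < c := by positivity
  have hc1 : c ≤ 1 := Real.rpow_le_one_of_one_le_of_nonpos hΛ
    (div_nonpos_of_nonpos_of_nonneg (by norm_num) (by linarith))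
  rw [threePhaseRate_eq hα hM hσ hB h1, ← machineRisk_mul hM hσ (lt_min hb hm) hc0]
  refine machineRisk_anti hα hM hσ (by positivity) ?_
  rw [effectiveMachines]
  refine le_min ?_ ?_
  · calc c * min (budgetMachines α M σ B) m ≤ c * budgetMachines α M σ B := by
          gcongr; exact min_le_left _ _
      _ = _ := by
          rw [budgetMachines, mul_div_assoc, Real.mul_rpow hΛ0.le (by positivity)]; ring
  · calc c * min (budgetMachines α M σ B) m ≤ 1 * m := by
          gcongr; exact min_le_right _ _
      _ = m := one_mul _

theorem exists_mse_constant {α Λ₀ : ℝ} (hα : 0 < α)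
    (hΛ : (24 * α + 64) ^ (α + 1 / 2) < Λ₀) :
    ∃ C : ℝ, 0 < C ∧
      ∀ (m : ℕ) [NeZero m] (sel : Finset ℤ → ℤ), IsTieBreak sel →
      ∀ (σ M B : ℝ), 0 < σ → 0 < M → 0 < B → ∀ (p q : ℝ≥0∞), 2 ≤ p → 0 < q →
        ⨆ θ ∈ besovBall α p q M, (seqModgame m sel α M σ B Λ₀).mse σ θ ≤
          ENNReal.ofReal (C * threePhaseRate m α M σ B) := by
  have hΛ1 := one_lt_of_tuning hα hΛ
  have hΛ0 : 0 < Λ₀ := by linarith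
  obtain ⟨K, hK, hcoeff⟩ := exists_coeff_risk_constant
  set b : ℝ := 2 / (1 - (2 : ℝ) ^ (-2 * α)) with hb
  have hb0 : 0 ≤ b := div_nonneg (by norm_num) (by
    linarith [Real.rpow_lt_one_of_one_lt_of_neg (x := 2) (z := -2 * α) (by norm_num) (by linarith)])
  set c₁ : ℝ := (2 * 4 + b) * (Λ₀ ^ (1 / (α + 1 / 2)))⁻¹ ^ (-2 * α) with hc₁
  set c₂ : ℝ := (2 * K + b) * (Λ₀ ^ (-1 / (α + 1))) ^ (-(2 * α / (2 * α + 1))) with hc₂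
  have hc₁0 : 0 < c₁ := by positivity
  have hc₂0 : 0 < c₂ := by positivity
  refine ⟨c₁ + c₂, by positivity, fun m _ sel hsel σ M B hσ hM hB p q hp hq => ?_⟩
  have hrate := sq_mul_rpow_le_threePhaseRate (m := m) hα hM hσ hB
  have hrate0 : 0 ≤ threePhaseRate m α M σ B := le_trans (by positivity) hrate
  refine iSup₂_le fun θ hθ => ?_
  unfold seqModgame
  split_ifs with hcase
  · have hstep := lt_crude_step hα hΛ0 hM hσ hB hcase
    refine (mse_crudeProtocol_le hα hM hσ hstep.le hp hq hθ).trans (ENNReal.ofReal_le_ofReal ?_)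
    rw [rpow_div_crude_step hα hΛ0 hM hB, div_eq_mul_inv B,
      Real.mul_rpow hB.le (by positivity)]
    calc _ = c₁ * (M ^ 2 * B ^ (-2 * α)) := by rw [hc₁]; ring
      _ ≤ c₁ * threePhaseRate m α M σ B := by gcongr
      _ ≤ _ := by gcongr; linarith
  · rw [not_lt] at hcase
    have hu1 := one_le_effectiveMachines (m := m) hα hΛ0 hM hσ hcase
    have hum : effectiveMachines m α M σ B Λ₀ ≤ m := min_le_right _ _
    have hrisk := machineRisk_effectiveMachines_le (m := m) hα hΛ1.le hM hσ hB hcase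
    simp only
    set u := effectiveMachines m α M σ B Λ₀
    have hu0 : 0 < u := by linarith
    refine (mse_refinedProtocol_le hα hM hσ hu0 hK.le (hcoeff m sel hsel u hu1 hum) hp hq hθ).trans
      (ENNReal.ofReal_le_ofReal ?_)
    rw [machineRisk_eq_of_step hα hM hσ hu0]
    calc _ ≤ (2 * K + b) * ((Λ₀ ^ (-1 / (α + 1))) ^ (-(2 * α / (2 * α + 1))) *
          threePhaseRate m α M σ B) := by gcongr
      _ = c₂ * threePhaseRate m α M σ B := by rw [hc₂]; ring
      _ ≤ _ := by gcongr; linarith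

end

end SeqModgame

theorem theorem1 (α Λ₀ : ℝ) (hα : 0 < α)
    (hΛ : (24 * α + 64) ^ (α + 1 / 2) < Λ₀) :
    (∀ (m : ℕ) [NeZero m] (sel : Finset ℤ → ℤ), SeqModgame.IsTieBreak sel →
      ∀ (σ M B : ℝ), 0 < σ → 0 < M → 0 < B →
      ∀ (p q : ℝ≥0∞), 0 < p → 0 < q → 0 < SeqModgame.besovIndex α p →
        SeqModgame.seqModgame m sel α M σ B Λ₀ ∈
          SeqModgame.budgetClass m σ B (SeqModgame.besovBall α p q M)) ∧
    ∃ C : ℝ, 0 < C ∧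
      ∀ (m : ℕ) [NeZero m] (sel : Finset ℤ → ℤ), SeqModgame.IsTieBreak sel →
      ∀ (σ M B : ℝ), 0 < σ → 0 < M → 0 < B →
      ∀ (p q : ℝ≥0∞), 2 ≤ p → 0 < q →
        ⨆ θ ∈ SeqModgame.besovBall α p q M,
            (SeqModgame.seqModgame m sel α M σ B Λ₀).mse σ θ ≤
          ENNReal.ofReal (C * SeqModgame.threePhaseRate m α M σ B) := by
  exact ⟨fun m _ sel _ σ M B hσ hM hB p q hp hq hs =>
    SeqModgame.seqModgame_mem_budgetClass hα hΛ m sel hσ hM hB hp hq hs,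
    SeqModgame.exists_mse_constant hα hΛ⟩
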